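/- Let $\mu_1,\mu_2,\rho:\mathbb R\to\mathbb R$ be $1$-periodic, piecewise continuous (finitely many discontinuities in every bounded interval, finite one-sided limits everywhere) and strictly positive, i.e. bounded below by a positive constant. For real $K$ and $k$ consider the eigenvalue problem on $[0,1]$ $$-\frac1{\rho}\,(\mu_1u')'+k^2\,\frac{\mu_2}{\rho}\,u=\lambda u\ \text{ a.e.},\qquad u(1)=e^{iK}u(0),\qquad (\mu_1u')(1)=e^{iK}(\mu_1u')(0),$$ for $u:[0,1]\to\mathbb C$ such that $u$ and $\mu_1u'$ are absolutely continuous. Let $m=\min_{y\in[0,1]}\mu_2(y)/\rho(y)$, where at a jump of $\mu_2/\rho$ the two one-sided limits are taken in place of the value at the jump; this minimum is attained. Then the following hold for every fixed $K\in\mathbb R$. (a) For every $k\in\mathbb R$ the eigenvalues, counted with multiplicity, are real and non-negative and form a unique nondecreasing infinite sequence $\omega_1^2(k)\le\omega_2^2(k)\le\dots$ with $\omega_n(k)\ge 0$. (b) For every $n\ge1$, $$\lim_{k\to\infty}\frac{\omega_n^2(k)}{k^2}=m=\min_{y\in[0,1]}\frac{\mu_2(y)}{\rho(y)}.$$ (c)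 Regard $v_n^2=\omega_n^2/k^2$ as a function of $k^2\in(0,\infty)$. Wherever $\omega_n^2(k)$, $k>0$, is a simple eigenvalue, with eigenfunction $u_n\neq0$, it is differentiable and $$\frac{\mathrm d v_n^2}{\mathrm d(k^2)}=-\frac1{k^4}\,\frac{\int_0^1\mu_1|u_n'|^2\,\mathrm dy}{\int_0^1\rho|u_n|^2\,\mathrm dy}.$$ Except in the case where $n=1$, $K\in2\pi\mathbb Z$ and $\mu_2/\rho$ is almost everywhere constant, $v_n^2$ is strictly decreasing in $k^2$ on $(0,\infty)$, and the right-hand side of this formula is strictly negative for every $k>0$ and every eigenfunction $u_n\ne0$ with eigenvalue $\omega_n^2(k)$. -/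

import Mathlib

open Set Filter Topology MeasureTheory

/-- `f` is piecewise continuous on the line: finitely many discontinuities on every bounded
interval, and finite one-sided limits everywhere. -/
def PiecewiseContinuous (f : ℝ → ℝ) : Prop :=
  (∀ a b : ℝ, {y | y ∈ Icc a b ∧ ¬ ContinuousAt f y}.Finite) ∧
    ∀ y : ℝ, (∃ l, Tendsto f (𝓝[<] y) (𝓝 l)) ∧ ∃ r, Tendsto f (𝓝[>] y) (𝓝 r)

/-- An admissible material coefficient: `1`-periodic, piecewise continuous and strictly positive
(with a positive lower bound, so that the one-sided limits at the jumps are positive as well). -/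
structure IsCoefficient (f : ℝ → ℝ) : Prop where
  periodic : Function.Periodic f 1
  piecewiseContinuous : PiecewiseContinuous f
  pos : ∃ c : ℝ, 0 < c ∧ ∀ y, c ≤ f y

/-- The one-sided limits of `f` at the points of `[0,1]`. At a point of continuity both are the
value of `f`; at a jump these are the two one-sided values, and the (irrelevant) value that `f`
is given at the jump itself does not enter. -/
def oneSidedLimits (f : ℝ → ℝ) : Set ℝ :=
  {l | ∃ y ∈ Icc (0 : ℝ) 1, Tendsto f (𝓝[<] y) (𝓝 l) ∨ Tendsto f (𝓝[>] y) (𝓝 l)}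

/-- `u` is absolutely continuous on `[0,1]` and `p` is the absolutely continuous representative
on `[0,1]` of `μ₁ u'`. -/
structure IsFlux (μ₁ : ℝ → ℝ) (u p : ℝ → ℂ) : Prop where
  ac : AbsolutelyContinuousOnInterval u 0 1
  ac_flux : AbsolutelyContinuousOnInterval p 0 1
  eq : ∀ᵐ y : ℝ, y ∈ Icc (0 : ℝ) 1 → p y = μ₁ y * deriv u y

/-- `u` lies in the domain `D_K` (`u`, `μ₁ u'` absolutely continuous and quasi-periodic with
factor `e^{iK}`) and satisfies `-(1/ρ)(μ₁ u')' + k² (μ₂/ρ) u = lam u` almost everywhere on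
`[0,1]`. -/
def SolvesFloquet (μ₁ μ₂ ρ : ℝ → ℝ) (K k : ℝ) (lam : ℂ) (u : ℝ → ℂ) : Prop :=
  ∃ p : ℝ → ℂ, IsFlux μ₁ u p ∧
    u 1 = Complex.exp (Complex.I * K) * u 0 ∧
    p 1 = Complex.exp (Complex.I * K) * p 0 ∧
    ∀ᵐ y : ℝ, y ∈ Icc (0 : ℝ) 1 →
      -(1 / (ρ y : ℂ)) * deriv p y + (k : ℂ) ^ 2 * ((μ₂ y : ℂ) / ρ y) * u y = lam * u y

theorem ae_differentiableAt_of_ac {u : ℝ → ℂ} (hu : AbsolutelyContinuousOnInterval u 0 1) :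
    ∀ᵐ y : ℝ, y ∈ Icc (0 : ℝ) 1 → DifferentiableAt ℝ u y := by
  have h := hu.boundedVariationOn.ae_differentiableAt_of_mem_uIcc
  rwa [uIcc_of_le zero_le_one] at h

theorem SolvesFloquet.add {μ₁ μ₂ ρ : ℝ → ℝ} {K k : ℝ} {lam : ℂ} {u v : ℝ → ℂ}
    (hu : SolvesFloquet μ₁ μ₂ ρ K k lam u) (hv : SolvesFloquet μ₁ μ₂ ρ K k lam v) :
    SolvesFloquet μ₁ μ₂ ρ K k lam (u + v) := by
  obtain ⟨p, hp, h1, h2, h3⟩ := hu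
  obtain ⟨q, hq, g1, g2, g3⟩ := hv
  refine ⟨p + q, ⟨hp.ac.add hq.ac, hp.ac_flux.add hq.ac_flux, ?_⟩, ?_, ?_, ?_⟩
  · filter_upwards [hp.eq, hq.eq, ae_differentiableAt_of_ac hp.ac,
      ae_differentiableAt_of_ac hq.ac] with y e1 e2 d1 d2 hy
    rw [deriv_add (d1 hy) (d2 hy), Pi.add_apply, e1 hy, e2 hy]
    ring
  · simp only [Pi.add_apply, h1, g1]; ring
  · simp only [Pi.add_apply, h2, g2]; ring
  · filter_upwards [h3, g3, ae_differentiableAt_of_ac hp.ac_flux,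
      ae_differentiableAt_of_ac hq.ac_flux] with y e1 e2 d1 d2 hy
    rw [deriv_add (d1 hy) (d2 hy), Pi.add_apply, mul_add lam, ← e1 hy, ← e2 hy]
    ring

theorem SolvesFloquet.smul {μ₁ μ₂ ρ : ℝ → ℝ} {K k : ℝ} {lam : ℂ} {u : ℝ → ℂ} (c : ℂ)
    (hu : SolvesFloquet μ₁ μ₂ ρ K k lam u) :
    SolvesFloquet μ₁ μ₂ ρ K k lam (c • u) := by
  obtain ⟨p, hp, h1, h2, h3⟩ := hu
  refine ⟨c • p, ⟨hp.ac.const_smul c, hp.ac_flux.const_smul c, ?_⟩, ?_, ?_, ?_⟩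
  · filter_upwards [hp.eq, ae_differentiableAt_of_ac hp.ac] with y e1 d1 hy
    rw [deriv_const_smul c (d1 hy), Pi.smul_apply, e1 hy]
    simp only [smul_eq_mul]; ring
  · simp only [Pi.smul_apply, smul_eq_mul, h1]; ring
  · simp only [Pi.smul_apply, smul_eq_mul, h2]; ring
  · filter_upwards [h3, ae_differentiableAt_of_ac hp.ac_flux] with y e1 d1 hy
    rw [deriv_const_smul c (d1 hy), Pi.smul_apply]
    simp only [smul_eq_mul]
    linear_combination c * e1 hy

theorem SolvesFloquet.zero {μ₁ μ₂ ρ : ℝ → ℝ} {K k : ℝ} {lam : ℂ} :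
    SolvesFloquet μ₁ μ₂ ρ K k lam 0 := by
  have h0 : AbsolutelyContinuousOnInterval (0 : ℝ → ℂ) 0 1 := by
    simpa [AbsolutelyContinuousOnInterval] using tendsto_const_nhds
  have hd : ∀ y : ℝ, deriv (0 : ℝ → ℂ) y = 0 := fun y => deriv_const y (0 : ℂ)
  exact ⟨0, ⟨h0, h0, by simp [hd]⟩, by simp, by simp, by simp [hd]⟩

/-- The space of solutions `u` of the eigenvalue equation `𝒜_K u = lam u`, where
`𝒜_K u = -(1/ρ)(μ₁ u')' + k² (μ₂/ρ) u` on the domain `D_K`. A function on `[0,1]` is represented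
by its extension by zero to `ℝ`. -/
def floquetEigenspace (μ₁ μ₂ ρ : ℝ → ℝ) (K k : ℝ) (lam : ℂ) : Submodule ℂ (ℝ → ℂ) where
  carrier := {u | SolvesFloquet μ₁ μ₂ ρ K k lam u ∧ ∀ y, y ∉ Icc (0 : ℝ) 1 → u y = 0}
  add_mem' hu hv := ⟨hu.1.add hv.1, fun y hy => by simp [hu.2 y hy, hv.2 y hy]⟩
  zero_mem' := ⟨SolvesFloquet.zero, fun _ _ => rfl⟩
  smul_mem' c u hu := ⟨hu.1.smul c, fun y hy => by simp [hu.2 y hy]⟩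

/-- `0 ≤ ω 0 ≤ ω 1 ≤ …` are the eigenfrequencies of `𝒜_K(k)`: every complex number `lam` occurs
among the `(ω n)²` exactly as often as its multiplicity as an eigenvalue of `𝒜_K(k)` (so that
numbers which are not eigenvalues do not occur). The index `n` starts at `0`. -/
structure IsFloquetSpectrum (μ₁ μ₂ ρ : ℝ → ℝ) (K k : ℝ) (ω : ℕ → ℝ) : Prop where
  nonneg : ∀ n, 0 ≤ ω n
  mono : Monotone ω
  multiplicity : ∀ lam : ℂ, {n : ℕ | ((ω n : ℂ)) ^ 2 = lam}.encard =
    (Module.finrank ℂ (floquetEigenspace μ₁ μ₂ ρ K k lam) : ℕ∞)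

/-! A quasi-periodic function `u` with `u(1) = (α + 2) u(0)`, where `α + 2 = e^{iK}`, is coded by `g
= u' - α u(0)` in `L²(0,1)`. The mean of `g` is then `u(0)`, so `u' = slopeOp α g` and `u = valueOp
α g`, and every `g` occurs: the boundary condition disappears from the Hilbert space. The eigenvalue
problem becomes `(D + k² Q) g = lam B g`, where `D`, `Q`, `B` carry the forms `∫ μ₁|u'|²`, `∫
μ₂|u|²`, `∫ ρ|u|²`; weak and strong solutions agree by `map_pencilEigenspace_formOp`. Here `B` is
compact, because integration is, and `D + B` is coercive.

With `S = D + k² Q`, conjugation by `(S + B)^{1/2}` turns the pencil into a compact symmetric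
operator with eigenvalues `1/(lam + 1)`. This yields (a), and also half of the min-max principle: a
subspace on which `S ≤ x B` has at most the dimension of the span of the eigenspaces up to `x`
(`finrank_le_of_le`). Hence bounds on the `n`-th eigenvalue follow from test subspaces.

For (b), `Q ≥ m B` bounds the quotient from below. Functions supported where `μ₂/ρ < m + ε` form
test spaces of any dimension; on each, `D` is bounded relative to `B`, and its contribution vanishes
after division by `k²`.

For (c), write `s = k²`. Compactness of normalized eigenvectors gives the Hellmann-Feynman
derivative `⟪Q u, u⟫ / ⟪B u, u⟫` of a simple eigenvalue; the quotient rule and the Rayleigh identity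
turn it into the formula. For strict decrease, multiple eigenvalues included, the form of `D + t Q`
is at most `t/s` times that of `D + s Q` for `t > s`, with surplus `(t/s - 1) D`. On the finite
dimensional test space this leaves a uniform gap unless `D` annihilates an eigenvector. Such an
eigenvector has `u' = 0`, so `u` is a nonzero constant: `e^{iK} = 1`, `μ₂/ρ` is constant, and the
eigenvalue is the lowest one, which is simple. -/

open scoped InnerProductSpace

/-! ### Spectral subspaces of compact symmetric operators -/

section CompactSelfAdjoint

open Module.End

variable {H : Type*} [NormedAddCommGroup H] [InnerProductSpace ℂ H]

/-- A symmetric positive semidefinite operator annihilates the zeros of its quadratic form. -/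
theorem apply_eq_zero_of_re_inner_eq_zero {S : H →ₗ[ℂ] H} (hS : S.IsSymmetric)
    (hpos : ∀ v, 0 ≤ (⟪S v, v⟫_ℂ).re) {u : H} (hu : (⟪S u, u⟫_ℂ).re = 0) : S u = 0 := by
  by_contra hne
  set a := ‖S u‖ ^ 2 with ha
  have ha0 : 0 < a := by positivity
  set b := (⟪S (S u), S u⟫_ℂ).re with hb
  have hb0 : 0 ≤ b := hpos _
  have key : ∀ t : ℝ, 0 ≤ 2 * t * a + t ^ 2 * b := by
    intro t
    have h := hpos (u + (t : ℂ) • S u)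
    have h2 : ⟪S u, S u⟫_ℂ = ((a : ℝ) : ℂ) := by
      rw [inner_self_eq_norm_sq_to_K, ha]; norm_cast
    have h1 : ⟪S (S u), u⟫_ℂ = ((a : ℝ) : ℂ) := by rw [hS (S u) u, h2]
    simp only [map_add, map_smul, inner_add_left, inner_add_right, inner_smul_left,
      inner_smul_right, Complex.conj_ofReal, Complex.add_re, h1, h2, Complex.re_ofReal_mul,
      Complex.ofReal_re, hu, ← hb] at h
    nlinarith [h]
  -- The minimizer of the quadratic is `-a/b`; the shift to `b + 1` also covers `b = 0` and still
  -- gives a negative value.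
  have h := key (-(a / (b + 1)))
  have hb1 : 0 < b + 1 := by linarith
  have : 2 * -(a / (b + 1)) * a + (-(a / (b + 1))) ^ 2 * b
      = -(a ^ 2 * (b + 2) / (b + 1) ^ 2) := by field_simp; ring
  rw [this] at h
  have : 0 < a ^ 2 * (b + 2) / (b + 1) ^ 2 := by positivity
  linarith

/-- The span of the eigenspaces of `T` for the real eigenvalues in `s`. -/
def spectralSubspace (T : H →L[ℂ] H) (s : Set ℝ) : Submodule ℂ H :=
  ⨆ x : s, eigenspace (T : H →ₗ[ℂ] H) ((x : ℝ) : ℂ)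

variable {T : H →L[ℂ] H}

/-- Eigenspaces for different eigenvalues are orthogonal, so the norm and the form both split over
the components. All form bounds on spectral subspaces are read off from these two sums. -/
theorem exists_finsupp_of_mem_spectralSubspace (hs : (T : H →ₗ[ℂ] H).IsSymmetric) {s : Set ℝ}
    {w : H} (hw : w ∈ spectralSubspace T s) :
    ∃ (t : Finset s) (f : s → H), (∀ i : s, f i ∈ eigenspace (T : H →ₗ[ℂ] H) ((i : ℝ) : ℂ)) ∧
      w = ∑ i ∈ t, f i ∧ ‖w‖ ^ 2 = ∑ i ∈ t, ‖f i‖ ^ 2 ∧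
      (⟪T w, w⟫_ℂ).re = ∑ i ∈ t, (i : ℝ) * ‖f i‖ ^ 2 := by
  classical
  obtain ⟨f, hf, rfl⟩ := (Submodule.mem_iSup_iff_exists_finsupp _ _).1 hw
  have hTf : ∀ i, T (f i) = ((i : ℝ) : ℂ) • f i := fun i => mem_eigenspace_iff.1 (hf i)
  have horth : ∀ i j : s, i ≠ j → ⟪f i, f j⟫_ℂ = 0 := by
    intro i j hij
    have := hs.orthogonalFamily_eigenspaces (i := ((i : ℝ) : ℂ)) (j := ((j : ℝ) : ℂ))
      (fun h => hij (Subtype.ext (Complex.ofReal_injective h)))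
    exact this ⟨f i, hf i⟩ ⟨f j, hf j⟩
  have hinner : ∀ c : s → ℂ, ⟪∑ i ∈ f.support, c i • f i, ∑ i ∈ f.support, f i⟫_ℂ
      = ∑ i ∈ f.support, starRingEnd ℂ (c i) * ((‖f i‖ ^ 2 : ℝ) : ℂ) := by
    intro c
    rw [sum_inner]
    refine Finset.sum_congr rfl fun i hi => ?_
    rw [inner_smul_left, inner_sum, Finset.sum_eq_single i]
    · rw [inner_self_eq_norm_sq_to_K]; norm_cast
    · intro j _ hj; exact horth i j hj.symm
    · intro h; exact absurd hi h
  refine ⟨f.support, f, hf, rfl, ?_, ?_⟩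
  · have h := hinner fun _ => 1
    simp only [one_smul, map_one, one_mul] at h
    have h2 : (((‖∑ i ∈ f.support, f i‖ ^ 2 : ℝ)) : ℂ)
        = ⟪∑ i ∈ f.support, f i, ∑ i ∈ f.support, f i⟫_ℂ := by
      rw [inner_self_eq_norm_sq_to_K]; norm_cast
    rw [h] at h2
    exact_mod_cast h2
  · have h := hinner fun i => ((i : ℝ) : ℂ)
    have h3 : T (∑ i ∈ f.support, f i) = ∑ i ∈ f.support, ((i : ℝ) : ℂ) • f i := by
      rw [map_sum]; exact Finset.sum_congr rfl fun i _ => hTf i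
    change (⟪T (∑ i ∈ f.support, f i), ∑ i ∈ f.support, f i⟫_ℂ).re = _
    rw [h3, h]
    simp only [Complex.conj_ofReal, ← Complex.ofReal_mul, ← Complex.ofReal_sum, Complex.ofReal_re]

theorem le_re_inner_of_mem_spectralSubspace (hs : (T : H →ₗ[ℂ] H).IsSymmetric) {ν : ℝ} {w : H}
    (hw : w ∈ spectralSubspace T (Ici ν)) : ν * ‖w‖ ^ 2 ≤ (⟪T w, w⟫_ℂ).re := by
  obtain ⟨t, f, -, -, h1, h2⟩ := exists_finsupp_of_mem_spectralSubspace hs hw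
  rw [h1, h2, Finset.mul_sum]
  exact Finset.sum_le_sum fun i _ => mul_le_mul_of_nonneg_right i.2 (by positivity)

theorem re_inner_le_of_mem_spectralSubspace (hs : (T : H →ₗ[ℂ] H).IsSymmetric) {ν : ℝ} {w : H}
    (hw : w ∈ spectralSubspace T (Iic ν)) : (⟪T w, w⟫_ℂ).re ≤ ν * ‖w‖ ^ 2 := by
  obtain ⟨t, f, -, -, h1, h2⟩ := exists_finsupp_of_mem_spectralSubspace hs hw
  rw [h1, h2, Finset.mul_sum]
  exact Finset.sum_le_sum fun i _ => mul_le_mul_of_nonneg_right i.2 (by positivity)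

/-- Equality case of the lower bound: each component with eigenvalue above `ν` would contribute a
strictly positive excess, so only the `ν`-component survives. -/
theorem mem_eigenspace_of_mem_spectralSubspace (hs : (T : H →ₗ[ℂ] H).IsSymmetric) {ν : ℝ} {w : H}
    (hw : w ∈ spectralSubspace T (Ici ν)) (h : (⟪T w, w⟫_ℂ).re ≤ ν * ‖w‖ ^ 2) :
    w ∈ eigenspace (T : H →ₗ[ℂ] H) (ν : ℂ) := by
  obtain ⟨t, f, hf, hsum, h1, h2⟩ := exists_finsupp_of_mem_spectralSubspace hs hw
  have h0 : ∀ i ∈ t, 0 ≤ ((i : ℝ) - ν) * ‖f i‖ ^ 2 := fun i _ =>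
    mul_nonneg (sub_nonneg.2 i.2) (by positivity)
  have hz : ∑ i ∈ t, ((i : ℝ) - ν) * ‖f i‖ ^ 2 = 0 := by
    refine le_antisymm ?_ (Finset.sum_nonneg h0)
    rw [h1, h2, Finset.mul_sum] at h
    simp only [sub_mul, Finset.sum_sub_distrib]
    linarith
  rw [hsum]
  refine Submodule.sum_mem _ fun i hi => ?_
  rcases mul_eq_zero.1 ((Finset.sum_eq_zero_iff_of_nonneg h0).1 hz i hi) with h | h
  · rw [← sub_eq_zero.1 h]; exact hf i
  · have : f i = 0 := by simpa using h
    rw [this]; exact Submodule.zero_mem _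

/-- A compact operator whose form is bounded below by `ν > 0` on a subspace forces this subspace
to be finite dimensional. -/
theorem finiteDimensional_of_le_re_inner [CompleteSpace H] (hc : IsCompactOperator T) {ν : ℝ}
    (hν : 0 < ν) {W : Submodule ℂ H} (hW : ∀ w ∈ W, ν * ‖w‖ ^ 2 ≤ (⟪T w, w⟫_ℂ).re) :
    FiniteDimensional ℂ W := by
  -- The bound extends to the closure, which is complete. There `T` is bounded below, hence a closed
  -- embedding, and compactness of `T` pulls back to compactness of the identity.
  set U := W.topologicalClosure
  have hUcl : IsClosed (U : Set H) := W.isClosed_topologicalClosure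
  have hU : ∀ w ∈ U, ν * ‖w‖ ^ 2 ≤ (⟪T w, w⟫_ℂ).re := by
    have hcl : IsClosed {w : H | ν * ‖w‖ ^ 2 ≤ (⟪T w, w⟫_ℂ).re} :=
      isClosed_le (by fun_prop) (by fun_prop)
    intro w hw
    exact closure_minimal (fun w hw => hW w hw) hcl hw
  have : CompleteSpace U := hUcl.completeSpace_coe
  let f : U →L[ℂ] H := T.comp U.subtypeL
  have hf : ∀ w : U, ν * ‖w‖ ≤ ‖f w‖ := by
    intro w
    have h1 := hU w w.2
    have h2 : (⟪T w, w⟫_ℂ).re ≤ ‖T w‖ * ‖(w : H)‖ :=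
      (Complex.re_le_norm _).trans (norm_inner_le_norm _ _)
    rcases eq_or_lt_of_le (norm_nonneg (w : H)) with h | h
    · change ν * ‖(w : H)‖ ≤ _
      rw [← h]; simp
    · change ν * ‖(w : H)‖ ≤ ‖T w‖
      nlinarith
  have hanti : AntilipschitzWith (Real.toNNReal ν⁻¹) f := by
    refine ContinuousLinearMap.antilipschitz_of_bound f fun w => ?_
    rw [Real.coe_toNNReal _ (by positivity), inv_mul_eq_div, le_div_iff₀ hν, mul_comm]
    exact hf w
  have hemb : IsClosedEmbedding f := hanti.isClosedEmbedding f.uniformContinuous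
  obtain ⟨C, hC, hCn⟩ : IsCompactOperator f := hc.comp_clm U.subtypeL
  have hid : IsCompactOperator (id : U → U) := ⟨f ⁻¹' C, hemb.isCompact_preimage hC, hCn⟩
  have : FiniteDimensional ℂ U := isCompactOperator_id_iff_finiteDimensional.1 hid
  exact Submodule.finiteDimensional_of_le W.le_topologicalClosure

theorem finiteDimensional_spectralSubspace [CompleteSpace H] (hs : (T : H →ₗ[ℂ] H).IsSymmetric)
    (hc : IsCompactOperator T) {ν : ℝ} (hν : 0 < ν) :
    FiniteDimensional ℂ (spectralSubspace T (Ici ν)) :=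
  finiteDimensional_of_le_re_inner hc hν fun _ hw => le_re_inner_of_mem_spectralSubspace hs hw

theorem invariant_orthogonal_spectralSubspace (hs : (T : H →ₗ[ℂ] H).IsSymmetric) (s : Set ℝ) :
    ∀ w ∈ (spectralSubspace T s)ᗮ, (T : H →ₗ[ℂ] H) w ∈ (spectralSubspace T s)ᗮ := by
  intro w hw
  rw [spectralSubspace, ← Submodule.iInf_orthogonal] at hw ⊢
  exact LinearMap.iInf_invariant _ (fun x => hs.invariant_orthogonalComplement_eigenspace _) w hw

/-- The orthogonal complement is invariant and contains no eigenvector with eigenvalue at least `ν`.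
By the spectral theorem the remaining eigenspaces span it densely, so the form is at most `ν` there.
At equality the nonnegative operator `ν - T` annihilates the vector, which would then be an
eigenvector for `ν`. -/
theorem re_inner_lt_of_mem_orthogonal [CompleteSpace H] (hs : (T : H →ₗ[ℂ] H).IsSymmetric)
    (hc : IsCompactOperator T) {ν : ℝ} {w : H}
    (hw : w ∈ (spectralSubspace T (Ici ν))ᗮ) (hw0 : w ≠ 0) :
    (⟪T w, w⟫_ℂ).re < ν * ‖w‖ ^ 2 := by
  set U := (spectralSubspace T (Ici ν))ᗮ with hUdef
  have hinv := invariant_orthogonal_spectralSubspace hs (Ici ν)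
  let T' : U →L[ℂ] U := ⟨(T : H →ₗ[ℂ] H).restrict hinv, by
    exact (T.continuous.comp continuous_subtype_val).subtype_mk _⟩
  have hs' : (T' : U →ₗ[ℂ] U).IsSymmetric := hs.restrict_invariant hinv
  have : CompleteSpace U := (Submodule.isClosed_orthogonal _).completeSpace_coe
  have hc' : IsCompactOperator (T' : U → U) := hc.restrict' (f := (T : H →ₗ[ℂ] H)) hinv
  have hT' : ∀ x : U, ((T' x : U) : H) = T x := fun x => rfl
  have heig : ∀ x : ℝ, ν ≤ x → ∀ v : U, (T' : U →ₗ[ℂ] U) v = (x : ℂ) • v → v = 0 := by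
    intro x hx v hv
    have hv1 : T v = (x : ℂ) • (v : H) := congrArg Subtype.val hv
    have hv2 : (v : H) ∈ spectralSubspace T (Ici ν) :=
      (le_iSup (fun y : Ici ν => eigenspace (T : H →ₗ[ℂ] H) ((y : ℝ) : ℂ)) ⟨x, hx⟩)
        (mem_eigenspace_iff.2 hv1)
    have := v.2 _ hv2
    exact Subtype.ext (inner_self_eq_zero.1 this)
  have hle : (⨆ μ : ℂ, eigenspace (T' : U →ₗ[ℂ] U) μ) ≤ spectralSubspace T' (Iic ν) := by
    refine iSup_le fun μ v hv => ?_
    by_cases hv0 : v = 0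
    · rw [hv0]; exact Submodule.zero_mem _
    have hμ : HasEigenvalue (T' : U →ₗ[ℂ] U) μ :=
      hasEigenvalue_of_hasEigenvector ⟨hv, hv0⟩
    have hreal : ((μ.re : ℝ) : ℂ) = μ := Complex.conj_eq_iff_re.1 (hs'.conj_eigenvalue_eq_self hμ)
    have hlt : μ.re ≤ ν := by
      by_contra h
      exact hv0 (heig μ.re (not_le.1 h).le v (by rw [hreal]; exact mem_eigenspace_iff.1 hv))
    refine (le_iSup (fun y : Iic ν => eigenspace (T' : U →ₗ[ℂ] U) ((y : ℝ) : ℂ)) ⟨μ.re, hlt⟩) ?_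
    change v ∈ eigenspace (T' : U →ₗ[ℂ] U) ((μ.re : ℝ) : ℂ)
    rwa [hreal]
  have hdense : Dense ((spectralSubspace T' (Iic ν) : Submodule ℂ U) : Set U) := by
    rw [Submodule.dense_iff_topologicalClosure_eq_top, Submodule.topologicalClosure_eq_top_iff]
    refine le_bot_iff.1 ((Submodule.orthogonal_le hle).trans_eq ?_)
    exact ContinuousLinearMap.orthogonalComplement_iSup_eigenspaces_eq_bot hc' hs'
  have hform : ∀ v : U, (⟪T' v, v⟫_ℂ).re ≤ ν * ‖v‖ ^ 2 := by
    have hcl : IsClosed {v : U | (⟪T' v, v⟫_ℂ).re ≤ ν * ‖v‖ ^ 2} :=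
      isClosed_le (by fun_prop) (by fun_prop)
    intro v
    exact closure_minimal (fun v hv => re_inner_le_of_mem_spectralSubspace hs' hv) hcl (hdense v)
  let A : U →ₗ[ℂ] U := (ν : ℂ) • LinearMap.id - (T' : U →ₗ[ℂ] U)
  have hA : ∀ v : U, A v = (ν : ℂ) • v - T' v := fun v => rfl
  have hval : ∀ v : U, (⟪A v, v⟫_ℂ).re = ν * ‖v‖ ^ 2 - (⟪T' v, v⟫_ℂ).re := by
    intro v
    rw [hA, inner_sub_left, inner_smul_left, Complex.conj_ofReal, Complex.sub_re,
      Complex.re_ofReal_mul, inner_self_eq_norm_sq_to_K]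
    norm_cast
  refine lt_of_le_of_ne (hform ⟨w, hw⟩) fun heq => hw0 ?_
  have hz : A ⟨w, hw⟩ = 0 := by
    refine apply_eq_zero_of_re_inner_eq_zero ?_ ?_ ?_
    · refine LinearMap.IsSymmetric.sub ?_ hs'
      intro x y
      simp only [LinearMap.smul_apply, LinearMap.id_apply, inner_smul_left, inner_smul_right,
        Complex.conj_ofReal]
    · intro v; rw [hval]; linarith [hform v]
    · rw [hval]
      have : (⟪T' ⟨w, hw⟩, (⟨w, hw⟩ : U)⟫_ℂ).re = ν * ‖(⟨w, hw⟩ : U)‖ ^ 2 := heq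
      linarith
  rw [hA, sub_eq_zero] at hz
  exact congrArg Subtype.val (heig ν le_rfl ⟨w, hw⟩ hz.symm)

/-- A subspace on which the form is at least `ν` is not larger than the spectral subspace. -/
theorem finrank_le_finrank_spectralSubspace [CompleteSpace H] (hs : (T : H →ₗ[ℂ] H).IsSymmetric)
    (hc : IsCompactOperator T) {ν : ℝ} (hν : 0 < ν) {W : Submodule ℂ H}
    (hW : ∀ w ∈ W, ν * ‖w‖ ^ 2 ≤ (⟪T w, w⟫_ℂ).re) :
    Module.finrank ℂ W ≤ Module.finrank ℂ (spectralSubspace T (Ici ν)) := by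
  have := finiteDimensional_of_le_re_inner hc hν hW
  have := finiteDimensional_spectralSubspace hs hc hν
  set F := spectralSubspace T (Ici ν)
  by_contra hlt
  -- Dimension count: if `W` were larger than `F`, it would contain a nonzero vector orthogonal to
  -- `F`.
  have hker : LinearMap.ker ((F.orthogonalProjectionOnto : H →ₗ[ℂ] F) ∘ₗ W.subtype) ≠ ⊥ :=
    LinearMap.ker_ne_bot_of_finrank_lt (not_le.1 hlt)
  obtain ⟨w, hw, hw0⟩ := Submodule.exists_mem_ne_zero_of_ne_bot hker
  have hw' : (w : H) ∈ Fᗮ := by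
    rw [← Submodule.ker_orthogonalProjectionOnto]
    exact hw
  have := re_inner_lt_of_mem_orthogonal hs hc hw' (fun h => hw0 (Subtype.ext h))
  exact absurd (hW w w.2) (not_le.2 this)

end CompactSelfAdjoint

/-! ### Listing multiplicities as a nondecreasing sequence -/

section Enumeration

/-- The set `{i | f i ≤ x}` is an initial segment of `ℕ`, so it consists of the indices below its
cardinality. -/
theorem le_iff_lt_ncard_of_monotone {f : ℕ → ℝ} (hf : Monotone f) {x : ℝ}
    (hfin : {i | f i ≤ x}.Finite) (n : ℕ) : f n ≤ x ↔ n < {i | f i ≤ x}.ncard := by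
  constructor
  · intro h
    have hsub : Iic n ⊆ {i | f i ≤ x} := fun i hi => (hf hi).trans h
    have := Set.ncard_le_ncard hsub hfin
    rw [Set.ncard_eq_toFinset_card'] at this
    simp at this
    omega
  · intro h
    by_contra hlt
    have hsub : {i | f i ≤ x} ⊆ Iio n := fun i hi =>
      not_le.1 fun hni => hlt ((hf hni).trans hi)
    have := Set.ncard_le_ncard hsub (finite_Iio n)
    rw [Set.ncard_eq_toFinset_card' (Iio n)] at this
    simp at this
    omega

/-- Prescribed multiplicities, of finite total on every left half-line but infinite altogether,
are the multiplicities of a nondecreasing sequence. -/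
theorem exists_monotone_enumeration (d : ℝ → ℕ) (hfin : ∀ x : ℝ, Finite (Σ r : Iic x, Fin (d r)))
    (hinf : Infinite (Σ r : ℝ, Fin (d r))) :
    ∃ f : ℕ → ℝ, Monotone f ∧ ∀ r, {n | f n = r}.encard = d r := by
  -- Ordered lexicographically, the copies of the eigenvalues form a linear order with finite
  -- initial segments, a least element and no greatest one. Such an order is isomorphic to `ℕ`, and
  -- the isomorphism is the enumeration.
  let X := Σₗ r : ℝ, Fin (d r)
  have hmono : ∀ a b : X, a ≤ b → a.1 ≤ b.1 := by
    intro a b h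
    rcases Sigma.Lex.le_def.1 h with h | ⟨h, -⟩
    · exact h.le
    · exact h.le
  have hIic : ∀ a : X, (Iic a).Finite := by
    intro a
    have := hfin a.1
    let g : Iic a → Σ r : Iic a.1, Fin (d r) := fun b => ⟨⟨b.1.1, hmono _ _ b.2⟩, b.1.2⟩
    have hg : Function.Injective g := by
      rintro ⟨⟨r, i⟩, hb⟩ ⟨⟨r', i'⟩, hb'⟩ h
      obtain ⟨h1, h2⟩ := Sigma.mk.inj h
      obtain rfl : r = r' := congrArg Subtype.val h1
      obtain rfl := eq_of_heq h2
      rfl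
    exact Finite.of_injective g hg
  have hX : Infinite X := hinf
  let : LocallyFiniteOrder X :=
    LocallyFiniteOrder.ofFiniteIcc fun a b => (hIic b).subset Icc_subset_Iic_self
  obtain ⟨a₀⟩ : Nonempty X := inferInstance
  obtain ⟨b, hb, hbmin⟩ := Set.exists_min_image (Iic a₀) id (hIic a₀) ⟨a₀, mem_Iic.2 le_rfl⟩
  let : OrderBot X :=
    { bot := b
      bot_le := fun a => by
        rcases le_total a a₀ with h | h
        · exact hbmin a h
        · exact le_trans hb h }
  let : NoMaxOrder X := ⟨fun a => by
    by_contra h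
    push Not at h
    exact Set.infinite_univ ((hIic a).subset fun b _ => not_lt.1 (h b))⟩
  let : SuccOrder X := LinearLocallyFiniteOrder.succOrder X
  let : PredOrder X := LinearLocallyFiniteOrder.predOrder X
  let e : X ≃o ℕ := orderIsoNatOfLinearSuccPredArch
  refine ⟨fun n => (e.symm n).1, fun m n h => hmono _ _ (e.symm.monotone h), fun r => ?_⟩
  let mk : Fin (d r) → X := fun i => ⟨r, i⟩
  have himg : {n | (e.symm n).1 = r} = range (e ∘ mk) := by
    ext n
    constructor
    · intro h
      obtain ⟨a, rfl⟩ := e.surjective n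
      have h' : a.1 = r := (congrArg Sigma.fst (e.symm_apply_apply a)).symm.trans h
      subst h'
      exact ⟨a.2, rfl⟩
    · rintro ⟨i, rfl⟩
      exact congrArg Sigma.fst (e.symm_apply_apply (mk i))
  have hmk : Function.Injective mk := fun i j h => eq_of_heq (Sigma.mk.inj h).2
  rw [himg, ← Set.image_univ, (e.injective.comp hmk).encard_image, Set.encard_univ,
    ENat.card_eq_coe_fintype_card, Fintype.card_fin]

end Enumeration

/-! ### Generalized eigenvalue problems with compact right-hand side -/

section Pencil

variable {V : Type*} [NormedAddCommGroup V] [InnerProductSpace ℂ V]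

/-- A pair of symmetric operators with `S ≥ 0`, `B > 0` compact and `S + B` coercive. The
generalized eigenvalue problem `S v = lam • B v` then has discrete spectrum. -/
structure IsCompactPencil (S B : V →L[ℂ] V) : Prop where
  symm_left : (S : V →ₗ[ℂ] V).IsSymmetric
  symm_right : (B : V →ₗ[ℂ] V).IsSymmetric
  nonneg : ∀ v, 0 ≤ (⟪S v, v⟫_ℂ).re
  pos : ∀ v, v ≠ 0 → 0 < (⟪B v, v⟫_ℂ).re
  compact : IsCompactOperator B
  coercive : ∃ c : ℝ, 0 < c ∧ ∀ v, c * ‖v‖ ^ 2 ≤ (⟪S v, v⟫_ℂ).re + (⟪B v, v⟫_ℂ).re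

/-- The solutions of `S v = lam • B v`. -/
def pencilEigenspace (S B : V →L[ℂ] V) (lam : ℂ) : Submodule ℂ V :=
  LinearMap.ker ((S - lam • B : V →L[ℂ] V) : V →ₗ[ℂ] V)

theorem mem_pencilEigenspace {S B : V →L[ℂ] V} {lam : ℂ} {v : V} :
    v ∈ pencilEigenspace S B lam ↔ S v = lam • B v := by
  simp [pencilEigenspace, sub_eq_zero]

/-- The span of the eigenspaces of the pencil for the eigenvalues up to `x`. -/
def pencilSubspace (S B : V →L[ℂ] V) (x : ℝ) : Submodule ℂ V :=
  ⨆ r : Iic x, pencilEigenspace S B ((r : ℝ) : ℂ)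

/-- Coercivity makes `A` positive and invertible; its positive square root is then invertible as
well. -/
theorem exists_symmetric_sqrt [CompleteSpace V] {A : V →L[ℂ] V}
    (hA : (A : V →ₗ[ℂ] V).IsSymmetric) {c : ℝ} (hc : 0 < c)
    (hcoer : ∀ v, c * ‖v‖ ^ 2 ≤ (⟪A v, v⟫_ℂ).re) :
    ∃ R : V ≃L[ℂ] V, (∀ x y, ⟪R x, y⟫_ℂ = ⟪x, R y⟫_ℂ) ∧ ∀ x, R (R x) = A x := by
  have hpos : 0 ≤ A := by
    rw [ContinuousLinearMap.nonneg_iff_isPositive]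
    exact ⟨hA, fun v => le_trans (by positivity) (hcoer v)⟩
  have hunit : IsUnit A := by
    refine A.isUnit_of_forall_le_norm_inner_map (c := ⟨c, hc.le⟩) hc fun v => ?_
    rw [mul_comm]
    exact (hcoer v).trans (Complex.re_le_norm _)
  have hs : IsUnit (CFC.sqrt A) := (CFC.isUnit_sqrt_iff A hpos).2 hunit
  refine ⟨ContinuousLinearEquiv.unitsEquiv ℂ V hs.unit, fun x y => ?_, fun x => ?_⟩
  · have h := (ContinuousLinearMap.nonneg_iff_isPositive _).1 (CFC.sqrt_nonneg A)
    exact h.inner_left_eq_inner_right x y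
  · have h := CFC.sqrt_mul_sqrt_self A hpos
    exact congrArg (fun F : V →L[ℂ] V => F x) h

namespace IsCompactPencil

variable {S B : V →L[ℂ] V}

/-- An eigenvalue equals the Rayleigh quotient `⟪S v, v⟫ / ⟪B v, v⟫` of its eigenvector. -/
theorem eigenvalue_real (h : IsCompactPencil S B) {lam : ℂ} {v : V} (hv : S v = lam • B v) (hv0 : v ≠ 0) :
    0 ≤ lam.re ∧ ((lam.re : ℝ) : ℂ) = lam := by
  have hB : ((⟪B v, v⟫_ℂ).re : ℂ) = ⟪B v, v⟫_ℂ :=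
    h.symm_right.coe_re_inner_apply_self v
  have hS : ((⟪S v, v⟫_ℂ).re : ℂ) = ⟪S v, v⟫_ℂ :=
    h.symm_left.coe_re_inner_apply_self v
  have hpos := h.pos v hv0
  have h1 : ((⟪S v, v⟫_ℂ).re : ℂ) = starRingEnd ℂ lam * ((⟪B v, v⟫_ℂ).re : ℂ) := by
    rw [hS, hB, hv, inner_smul_left]
  have h2 : starRingEnd ℂ lam = (((⟪S v, v⟫_ℂ).re / (⟪B v, v⟫_ℂ).re : ℝ) : ℂ) := by
    rw [Complex.ofReal_div, eq_div_iff (by exact_mod_cast hpos.ne')]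
    exact h1.symm
  have h3 : lam = (((⟪S v, v⟫_ℂ).re / (⟪B v, v⟫_ℂ).re : ℝ) : ℂ) := by
    rw [← Complex.conj_conj lam, h2, Complex.conj_ofReal]
  rw [h3]
  exact ⟨by rw [Complex.ofReal_re]; exact div_nonneg (h.nonneg v) hpos.le, by simp⟩

theorem pencilEigenspace_eq_bot_of_neg (h : IsCompactPencil S B) {r : ℝ} (hr : r < 0) :
    pencilEigenspace S B (r : ℂ) = ⊥ := by
  refine (Submodule.eq_bot_iff _).2 fun v hv => ?_
  by_contra hv0
  have := (h.eigenvalue_real (mem_pencilEigenspace.1 hv) hv0).1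
  rw [Complex.ofReal_re] at this
  linarith

/-- The pencil is conjugate to a compact symmetric operator. -/
theorem exists_conjugate (h : IsCompactPencil S B) [CompleteSpace V] : ∃ (R : V ≃L[ℂ] V) (T : V →L[ℂ] V),
    (T : V →ₗ[ℂ] V).IsSymmetric ∧ IsCompactOperator T ∧
    (∀ v, ‖R v‖ ^ 2 = (⟪S v, v⟫_ℂ).re + (⟪B v, v⟫_ℂ).re) ∧
    (∀ v, (⟪T (R v), R v⟫_ℂ).re = (⟪B v, v⟫_ℂ).re) ∧
    ∀ (lam : ℂ) (v : V), v ∈ pencilEigenspace S B lam ↔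
      R v ∈ Module.End.eigenspace (T : V →ₗ[ℂ] V) (lam + 1)⁻¹ := by
  obtain ⟨c, hc, hcoer⟩ := h.coercive
  have hsymm : ((S + B : V →L[ℂ] V) : V →ₗ[ℂ] V).IsSymmetric := h.symm_left.add h.symm_right
  obtain ⟨R, hRs, hRR⟩ := exists_symmetric_sqrt hsymm hc fun v => by
    simpa [inner_add_left] using hcoer v
  have hRs' : ∀ x y, ⟪R.symm x, y⟫_ℂ = ⟪x, R.symm y⟫_ℂ := by
    intro x y
    rw [← R.apply_symm_apply y, ← hRs, R.apply_symm_apply, R.symm_apply_apply]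
  -- Here `R = (S + B)^{1/2}` and `T = R⁻¹ B R⁻¹`. Adding `B v` to `S v = lam • B v` gives `(S + B)
  -- v = (lam + 1) • B v`, which explains the eigenvalue `(lam + 1)⁻¹`.
  let T : V →L[ℂ] V := (R.symm : V →L[ℂ] V).comp (B.comp (R.symm : V →L[ℂ] V))
  have hT : ∀ v, T (R v) = R.symm (B v) := fun v => by simp [T]
  refine ⟨R, T, fun x y => ?_, ?_, fun v => ?_, fun v => ?_, fun lam v => ?_⟩
  · change ⟪R.symm (B (R.symm x)), y⟫_ℂ = ⟪x, R.symm (B (R.symm y))⟫_ℂ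
    exact (hRs' _ _).trans ((h.symm_right _ _).trans (hRs' _ _))
  · exact (h.compact.comp_clm (R.symm : V →L[ℂ] V)).clm_comp (R.symm : V →L[ℂ] V)
  · have : ⟪R v, R v⟫_ℂ = ⟪(S + B) v, v⟫_ℂ := by rw [← hRR, hRs (R v) v]
    rw [inner_self_eq_norm_sq_to_K, add_apply, inner_add_left] at this
    have := congrArg Complex.re this
    rw [Complex.add_re] at this
    rw [← this]
    norm_cast
  · rw [hT, hRs', R.symm_apply_apply]
  · rw [Module.End.mem_eigenspace_iff, mem_pencilEigenspace]
    have h1 : (T : V →ₗ[ℂ] V) (R v) = (lam + 1)⁻¹ • R v ↔ B v = (lam + 1)⁻¹ • (S v + B v) := by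
      change T (R v) = _ ↔ _
      rw [hT, ← R.injective.eq_iff, R.apply_symm_apply, map_smul, hRR]
      rfl
    rw [h1]
    by_cases hl : lam + 1 = 0
    · rw [hl, inv_zero, zero_smul]
      have hl' : lam = -1 := eq_neg_of_add_eq_zero_left hl
      constructor
      · intro hv
        by_contra hB
        have hv0 : v ≠ 0 := fun h0 => hB (by rw [h0, map_zero])
        have := (h.eigenvalue_real hv hv0).1
        rw [hl'] at this
        simp at this
        linarith
      · intro hB
        have hv0 : v = 0 := by
          by_contra hv0
          have := h.pos v hv0
          rw [hB] at this
          simp at this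
        rw [hv0, map_zero, map_zero, smul_zero]
    · rw [eq_inv_smul_iff₀ hl, add_smul, one_smul, add_left_inj, eq_comm]

/-- The map `lam ↦ (lam + 1)⁻¹` reverses the order on `lam > -1`, so low eigenvalues of the pencil
become high eigenvalues of `T`. Negative `r` in the union contribute nothing. -/
theorem exists_conjugate_subspace (h : IsCompactPencil S B) [CompleteSpace V] : ∃ (R : V ≃L[ℂ] V) (T : V →L[ℂ] V),
    (T : V →ₗ[ℂ] V).IsSymmetric ∧ IsCompactOperator T ∧
    (∀ v, ‖R v‖ ^ 2 = (⟪S v, v⟫_ℂ).re + (⟪B v, v⟫_ℂ).re) ∧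
    (∀ v, (⟪T (R v), R v⟫_ℂ).re = (⟪B v, v⟫_ℂ).re) ∧
    (∀ (lam : ℂ) (v : V), v ∈ pencilEigenspace S B lam ↔
      R v ∈ Module.End.eigenspace (T : V →ₗ[ℂ] V) (lam + 1)⁻¹) ∧
    ∀ x : ℝ, 0 ≤ x → (pencilSubspace S B x).map (R : V →ₗ[ℂ] V)
      = spectralSubspace T (Ici (x + 1)⁻¹) := by
  obtain ⟨R, T, h1, h2, h3, h4, h5⟩ := h.exists_conjugate
  refine ⟨R, T, h1, h2, h3, h4, h5, fun x hx => le_antisymm ?_ ?_⟩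
  · rw [pencilSubspace, Submodule.map_iSup]
    refine iSup_le fun r => ?_
    rcases lt_or_ge (r : ℝ) 0 with hr | hr
    · rw [h.pencilEigenspace_eq_bot_of_neg hr, Submodule.map_bot]
      exact bot_le
    · have hr' : ((r : ℝ) + 1)⁻¹ ∈ Ici (x + 1)⁻¹ := by
        have := r.2
        simp only [mem_Iic, mem_Ici] at this ⊢
        gcongr
      refine le_trans ?_ (le_iSup (fun y : Ici (x + 1)⁻¹ =>
        Module.End.eigenspace (T : V →ₗ[ℂ] V) ((y : ℝ) : ℂ)) ⟨_, hr'⟩)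
      rintro _ ⟨v, hv, rfl⟩
      have := (h5 _ v).1 hv
      push_cast
      exact this
  · refine iSup_le fun y w hw => ?_
    obtain ⟨v, rfl⟩ := R.surjective w
    refine ⟨v, ?_, rfl⟩
    have hx1 : 0 < (x + 1)⁻¹ := by positivity
    have hy : 0 < (y : ℝ) := lt_of_lt_of_le hx1 y.2
    have hr : (y : ℝ)⁻¹ - 1 ∈ Iic x := by
      have := inv_anti₀ hx1 y.2
      rw [inv_inv] at this
      simp only [mem_Iic]
      linarith
    refine (le_iSup (fun r : Iic x => pencilEigenspace S B ((r : ℝ) : ℂ)) ⟨_, hr⟩) ?_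
    rw [h5]
    push_cast
    rwa [sub_add_cancel, inv_inv]

theorem le_of_mem_pencilSubspace (h : IsCompactPencil S B) [CompleteSpace V] {x : ℝ} (hx : 0 ≤ x) {v : V}
    (hv : v ∈ pencilSubspace S B x) : (⟪S v, v⟫_ℂ).re ≤ x * (⟪B v, v⟫_ℂ).re := by
  obtain ⟨R, T, h1, h2, h3, h4, -, h6⟩ := h.exists_conjugate_subspace
  have hm : R v ∈ spectralSubspace T (Ici (x + 1)⁻¹) := by
    rw [← h6 x hx]; exact ⟨v, hv, rfl⟩
  have := le_re_inner_of_mem_spectralSubspace h1 hm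
  rw [h3, h4, inv_mul_le_iff₀ (by positivity)] at this
  linarith

theorem mem_pencilEigenspace_of_le (h : IsCompactPencil S B) [CompleteSpace V] {x : ℝ} (hx : 0 ≤ x) {v : V}
    (hv : v ∈ pencilSubspace S B x) (hle : x * (⟪B v, v⟫_ℂ).re ≤ (⟪S v, v⟫_ℂ).re) :
    v ∈ pencilEigenspace S B (x : ℂ) := by
  obtain ⟨R, T, h1, h2, h3, h4, h5, h6⟩ := h.exists_conjugate_subspace
  have hm : R v ∈ spectralSubspace T (Ici (x + 1)⁻¹) := by
    rw [← h6 x hx]; exact ⟨v, hv, rfl⟩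
  rw [h5]
  have := mem_eigenspace_of_mem_spectralSubspace h1 hm (by
    rw [h3, h4, ← div_eq_inv_mul, le_div_iff₀ (by positivity)]; linarith)
  push_cast at this
  exact this

theorem finiteDimensional_pencilSubspace (h : IsCompactPencil S B) [CompleteSpace V] {x : ℝ} (hx : 0 ≤ x) :
    FiniteDimensional ℂ (pencilSubspace S B x) := by
  obtain ⟨R, T, h1, h2, h3, h4, h5, h6⟩ := h.exists_conjugate_subspace
  have := finiteDimensional_spectralSubspace h1 h2 (ν := (x + 1)⁻¹) (by positivity)
  rw [← h6 x hx] at this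
  exact (R.toLinearEquiv.submoduleMap (pencilSubspace S B x)).symm.finiteDimensional

/-- The min-max principle in dimension form: among subspaces with Rayleigh quotient at most `x`, the
spectral one has the largest dimension. The condition `S ≤ x B` becomes `T ≥ (x + 1)⁻¹` after
conjugation. -/
theorem finrank_le_of_le (h : IsCompactPencil S B) [CompleteSpace V] {x : ℝ} (hx : 0 ≤ x) {W : Submodule ℂ V}
    (hW : ∀ v ∈ W, (⟪S v, v⟫_ℂ).re ≤ x * (⟪B v, v⟫_ℂ).re) :
    Module.finrank ℂ W ≤ Module.finrank ℂ (pencilSubspace S B x) := by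
  obtain ⟨R, T, h1, h2, h3, h4, h5, h6⟩ := h.exists_conjugate_subspace
  rw [← LinearEquiv.finrank_map_eq R.toLinearEquiv W,
    ← LinearEquiv.finrank_map_eq R.toLinearEquiv (pencilSubspace S B x)]
  have := finrank_le_finrank_spectralSubspace h1 h2 (ν := (x + 1)⁻¹) (by positivity)
    (W := W.map (R : V →ₗ[ℂ] V)) (by
      rintro _ ⟨v, hv, rfl⟩
      change _ * ‖R v‖ ^ 2 ≤ (⟪T (R v), R v⟫_ℂ).re
      rw [h3, h4, inv_mul_le_iff₀ (by positivity)]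
      linarith [hW v hv])
  rw [← h6 x hx] at this
  exact this

theorem iSupIndep_pencilEigenspace (h : IsCompactPencil S B) [CompleteSpace V] :
    iSupIndep fun lam : ℂ => pencilEigenspace S B lam := by
  obtain ⟨R, T, -, -, -, -, h5, -⟩ := h.exists_conjugate_subspace
  have hinj : Function.Injective fun lam : ℂ => (lam + 1)⁻¹ :=
    inv_injective.comp (add_left_injective 1)
  have h7 := ((Module.End.eigenspaces_iSupIndep (T : V →ₗ[ℂ] V)).comp hinj)
  have h8 := LinearMap.iSupIndep_map (R.symm : V →ₗ[ℂ] V) R.symm.injective h7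
  convert h8 using 2 with lam
  ext v
  rw [h5]
  constructor
  · intro hv; exact ⟨R v, hv, by simp⟩
  · rintro ⟨w, hw, rfl⟩; simpa using hw

theorem finiteDimensional_pencilEigenspace (h : IsCompactPencil S B) [CompleteSpace V] (lam : ℂ) :
    FiniteDimensional ℂ (pencilEigenspace S B lam) := by
  by_cases hbot : pencilEigenspace S B lam = ⊥
  · rw [hbot]; infer_instance
  · obtain ⟨v, hv, hv0⟩ := Submodule.exists_mem_ne_zero_of_ne_bot hbot
    obtain ⟨hr, hlam⟩ := h.eigenvalue_real (mem_pencilEigenspace.1 hv) hv0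
    have := h.finiteDimensional_pencilSubspace hr
    rw [← hlam]
    exact Submodule.finiteDimensional_of_le (S₂ := pencilSubspace S B lam.re) (le_iSup (fun r : Iic lam.re =>
      pencilEigenspace S B ((r : ℝ) : ℂ)) ⟨lam.re, mem_Iic.2 le_rfl⟩)

/-- Bases of the independent eigenspaces combine into a basis of their span. Its index type is
therefore finite, and its cardinality counts the eigenvalues up to `x` with multiplicity. -/
theorem finite_and_finrank_pencilSubspace (h : IsCompactPencil S B) [CompleteSpace V] {x : ℝ} (hx : 0 ≤ x) :
    Finite (Σ r : Iic x, Fin (Module.finrank ℂ (pencilEigenspace S B ((r : ℝ) : ℂ)))) ∧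
    Module.finrank ℂ (pencilSubspace S B x) =
      Nat.card (Σ r : Iic x, Fin (Module.finrank ℂ (pencilEigenspace S B ((r : ℝ) : ℂ)))) := by
  classical
  have hind : iSupIndep fun r : Iic x => pencilEigenspace S B ((r : ℝ) : ℂ) :=
    h.iSupIndep_pencilEigenspace.comp
      (f := fun r : Iic x => ((r : ℝ) : ℂ)) (Complex.ofReal_injective.comp Subtype.val_injective)
  have := fun lam => h.finiteDimensional_pencilEigenspace lam
  have := h.finiteDimensional_pencilSubspace hx
  let e := (LinearEquiv.ofInjective _ hind.dfinsupp_lsum_injective).trans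
    (LinearEquiv.ofEq _ (pencilSubspace S B x) (Submodule.iSup_eq_range_dfinsupp_lsum _).symm)
  let b := (DFinsupp.basis fun r : Iic x =>
    Module.finBasis ℂ (pencilEigenspace S B ((r : ℝ) : ℂ))).map e
  have hfin : Finite (Σ r : Iic x, Fin (Module.finrank ℂ (pencilEigenspace S B ((r : ℝ) : ℂ)))) :=
    Module.Finite.finite_basis b
  exact ⟨hfin, Module.finrank_eq_nat_card_basis b⟩

end IsCompactPencil

end Pencil

/-! ### Eigenvalue sequences: existence, uniqueness, variational bounds -/

section PencilSpectrum

variable {V : Type*} [NormedAddCommGroup V] [InnerProductSpace ℂ V]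

/-- `0 ≤ ω 0 ≤ ω 1 ≤ …` and the squares `(ω n)²` are the eigenvalues of the pencil, each occurring
according to its multiplicity. -/
structure IsPencilSpectrum (S B : V →L[ℂ] V) (ω : ℕ → ℝ) : Prop where
  nonneg : ∀ n, 0 ≤ ω n
  mono : Monotone ω
  multiplicity : ∀ lam : ℂ, {n : ℕ | ((ω n : ℂ)) ^ 2 = lam}.encard =
    (Module.finrank ℂ (pencilEigenspace S B lam) : ℕ∞)

/-- A form that is positive on a finite dimensional subspace is coercive there. -/
theorem exists_pos_le_re_inner {A : V →L[ℂ] V} {W : Submodule ℂ V} [FiniteDimensional ℂ W]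
    (hA : ∀ w ∈ W, w ≠ 0 → 0 < (⟪A w, w⟫_ℂ).re) :
    ∃ δ : ℝ, 0 < δ ∧ ∀ w ∈ W, δ * ‖w‖ ^ 2 ≤ (⟪A w, w⟫_ℂ).re := by
  have : ProperSpace W := FiniteDimensional.proper_rclike ℂ W
  -- The form attains a positive minimum on the compact unit sphere and scales quadratically. The
  -- sphere is empty only for `W = 0`.
  rcases (Metric.sphere (0 : W) 1).eq_empty_or_nonempty with hempty | hne
  · refine ⟨1, one_pos, fun w hw => ?_⟩
    by_cases hw0 : w = 0
    · simp [hw0]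
    · exfalso
      have hn : ‖w‖ ≠ 0 := norm_ne_zero_iff.2 hw0
      have : ((‖w‖⁻¹ : ℝ) : ℂ) • (⟨w, hw⟩ : W) ∈ Metric.sphere (0 : W) 1 := by
        simp [norm_smul, hn]
      rw [hempty] at this
      exact this
  · have hcont : Continuous fun w : W => (⟪A (w : V), (w : V)⟫_ℂ).re := by fun_prop
    obtain ⟨u, hu, hmin⟩ := (isCompact_sphere (0 : W) 1).exists_isMinOn hne hcont.continuousOn
    have hu1 : ‖(u : V)‖ = 1 := by simpa using hu
    refine ⟨_, hA u u.2 (by rw [← norm_ne_zero_iff, hu1]; exact one_ne_zero), fun w hw => ?_⟩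
    by_cases hw0 : w = 0
    · simp [hw0]
    have hn : ‖w‖ ≠ 0 := norm_ne_zero_iff.2 hw0
    have hmem : ((‖w‖⁻¹ : ℝ) : ℂ) • (⟨w, hw⟩ : W) ∈ Metric.sphere (0 : W) 1 := by
      simp [norm_smul, hn]
    have h := hmin hmem
    simp only [mem_ofPred_eq, Submodule.coe_smul, map_smul, inner_smul_left, inner_smul_right,
      Complex.conj_ofReal, Complex.re_ofReal_mul] at h
    calc _ ≤ (‖w‖⁻¹ * (‖w‖⁻¹ * (⟪A w, w⟫_ℂ).re)) * ‖w‖ ^ 2 := by gcongr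
      _ = _ := by field_simp

theorem re_inner_le_opNorm (A : V →L[ℂ] V) (w : V) : (⟪A w, w⟫_ℂ).re ≤ ‖A‖ * ‖w‖ ^ 2 := by
  refine (Complex.re_le_norm _).trans ((norm_inner_le_norm _ _).trans ?_)
  have := mul_le_mul_of_nonneg_right (A.le_opNorm w) (norm_nonneg w)
  linarith

/-- On a finite dimensional space any form is bounded relative to a positive one, so every such
space has a bounded Rayleigh quotient and can serve as a test space. -/
theorem exists_re_inner_le_mul {A B : V →L[ℂ] V} {W : Submodule ℂ V} [FiniteDimensional ℂ W]
    (hB : ∀ w ∈ W, w ≠ 0 → 0 < (⟪B w, w⟫_ℂ).re) :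
    ∃ x : ℝ, 0 ≤ x ∧ ∀ w ∈ W, (⟪A w, w⟫_ℂ).re ≤ x * (⟪B w, w⟫_ℂ).re := by
  obtain ⟨δ, hδ, h⟩ := exists_pos_le_re_inner hB
  refine ⟨‖A‖ / δ, by positivity, fun w hw => (re_inner_le_opNorm A w).trans ?_⟩
  rw [div_mul_eq_mul_div, le_div_iff₀ hδ]
  have := mul_le_mul_of_nonneg_left (h w hw) (norm_nonneg A)
  linarith

variable {S B : V →L[ℂ] V} {ω : ℕ → ℝ}

theorem IsPencilSpectrum.sq_mono (hω : IsPencilSpectrum S B ω) : Monotone fun n => ω n ^ 2 :=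
  fun _ _ hmn => pow_le_pow_left₀ (hω.nonneg _) (hω.mono hmn) 2

theorem IsPencilSpectrum.encard_eq (hω : IsPencilSpectrum S B ω) (r : ℝ) :
    {n : ℕ | ω n ^ 2 = r}.encard = (Module.finrank ℂ (pencilEigenspace S B (r : ℂ)) : ℕ∞) := by
  rw [← hω.multiplicity r]
  congr 1
  ext n
  change ω n ^ 2 = r ↔ ((ω n : ℂ)) ^ 2 = (r : ℂ)
  norm_cast

/-- Grouping the indices by the value of `ω n ^ 2` matches them with the index type of the basis of
eigenvectors. -/
theorem IsPencilSpectrum.ncard_eq [CompleteSpace V] (hω : IsPencilSpectrum S B ω)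
    (h : IsCompactPencil S B) {x : ℝ} (hx : 0 ≤ x) :
    {n | ω n ^ 2 ≤ x}.Finite ∧
      {n | ω n ^ 2 ≤ x}.ncard = Module.finrank ℂ (pencilSubspace S B x) := by
  obtain ⟨hfin, hcard⟩ := h.finite_and_finrank_pencilSubspace hx
  have hequiv : ∀ r : Iic x, Nonempty ({n : ℕ // ω n ^ 2 = r} ≃
      Fin (Module.finrank ℂ (pencilEigenspace S B ((r : ℝ) : ℂ)))) := by
    intro r
    have he := hω.encard_eq r
    have hf : {n : ℕ | ω n ^ 2 = r}.Finite := Set.finite_of_encard_eq_coe he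
    have : Finite {n : ℕ // ω n ^ 2 = r} := hf
    refine ⟨Finite.equivFinOfCardEq ?_⟩
    have h2 : {n : ℕ | ω n ^ 2 = r}.ncard =
        Module.finrank ℂ (pencilEigenspace S B ((r : ℝ) : ℂ)) := by
      rw [Set.ncard, he]; exact ENat.toNat_natCast _
    exact h2
  let e : {n : ℕ // ω n ^ 2 ≤ x} ≃
      Σ r : Iic x, Fin (Module.finrank ℂ (pencilEigenspace S B ((r : ℝ) : ℂ))) :=
    Equiv.trans
      { toFun := fun n => (⟨⟨ω n ^ 2, n.2⟩, ⟨n, rfl⟩⟩ : Σ r : Iic x, {n : ℕ // ω n ^ 2 = r})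
        invFun := fun p => ⟨p.2.1, p.2.2.trans_le p.1.2⟩
        left_inv := fun n => rfl
        right_inv := by
          rintro ⟨⟨r, hr⟩, ⟨n, hn⟩⟩
          change ω n ^ 2 = r at hn
          subst hn
          rfl }
      (Equiv.sigmaCongrRight fun r => (hequiv r).some)
  refine ⟨Finite.of_equiv _ e.symm, ?_⟩
  rw [hcard, ← Nat.card_congr e]
  rfl

/-- This translates inequalities between eigenvalues into inequalities between dimensions;
uniqueness of the sequence and the variational bound both rest on it. -/
theorem IsPencilSpectrum.le_iff [CompleteSpace V] (hω : IsPencilSpectrum S B ω)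
    (h : IsCompactPencil S B) {x : ℝ} (hx : 0 ≤ x) (n : ℕ) :
    ω n ^ 2 ≤ x ↔ n < Module.finrank ℂ (pencilSubspace S B x) := by
  obtain ⟨h1, h2⟩ := hω.ncard_eq h hx
  rw [le_iff_lt_ncard_of_monotone hω.sq_mono h1, h2]

/-- Variational upper bound for the eigenvalues. -/
theorem IsPencilSpectrum.le_of_forall_le [CompleteSpace V] (hω : IsPencilSpectrum S B ω)
    (h : IsCompactPencil S B) {x : ℝ} (hx : 0 ≤ x) {n : ℕ} {W : Submodule ℂ V}
    (hn : n < Module.finrank ℂ W)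
    (hW : ∀ v ∈ W, (⟪S v, v⟫_ℂ).re ≤ x * (⟪B v, v⟫_ℂ).re) : ω n ^ 2 ≤ x :=
  (hω.le_iff h hx n).2 (hn.trans_le (h.finrank_le_of_le hx hW))

theorem IsPencilSpectrum.lt_finrank [CompleteSpace V] (hω : IsPencilSpectrum S B ω)
    (h : IsCompactPencil S B) (n : ℕ) :
    n < Module.finrank ℂ (pencilSubspace S B (ω n ^ 2)) :=
  (hω.le_iff h (sq_nonneg _) n).1 le_rfl

theorem IsPencilSpectrum.unique [CompleteSpace V] (h : IsCompactPencil S B) {ω' : ℕ → ℝ}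
    (hω : IsPencilSpectrum S B ω) (hω' : IsPencilSpectrum S B ω') : ω = ω' := by
  funext n
  refine (sq_eq_sq₀ (hω.nonneg n) (hω'.nonneg n)).1 (le_antisymm ?_ ?_)
  · exact (hω.le_iff h (sq_nonneg _) n).2 (hω'.lt_finrank h n)
  · exact (hω'.le_iff h (sq_nonneg _) n).2 (hω.lt_finrank h n)

theorem IsPencilSpectrum.exists_eigenvector (hω : IsPencilSpectrum S B ω) (n : ℕ) :
    ∃ v, v ≠ 0 ∧ S v = ((ω n ^ 2 : ℝ) : ℂ) • B v := by
  have he := hω.encard_eq (ω n ^ 2)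
  have hne : pencilEigenspace S B ((ω n ^ 2 : ℝ) : ℂ) ≠ ⊥ := by
    intro hbot
    rw [hbot, finrank_bot, Nat.cast_zero, Set.encard_eq_zero] at he
    exact (he.subset (show n ∈ {m | ω m ^ 2 = ω n ^ 2} from rfl) : n ∈ (∅ : Set ℕ))
  obtain ⟨v, hv, hv0⟩ := Submodule.exists_mem_ne_zero_of_ne_bot hne
  exact ⟨v, hv0, mem_pencilEigenspace.1 hv⟩

/-- A compact pencil on an infinite dimensional space has an infinite spectrum. -/
theorem IsCompactPencil.exists_spectrum [CompleteSpace V] (h : IsCompactPencil S B)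
    (hV : ∀ n : ℕ, ∃ W : Submodule ℂ V, FiniteDimensional ℂ W ∧ n < Module.finrank ℂ W) :
    ∃ ω, IsPencilSpectrum S B ω := by
  let d : ℝ → ℕ := fun r => Module.finrank ℂ (pencilEigenspace S B (r : ℂ))
  have hd : ∀ r, r < 0 → d r = 0 := by
    intro r hr
    simp only [d]
    rw [h.pencilEigenspace_eq_bot_of_neg hr, finrank_bot]
  have hfin : ∀ x : ℝ, Finite (Σ r : Iic x, Fin (d r)) := by
    intro x
    have := (h.finite_and_finrank_pencilSubspace (le_max_right x 0)).1
    refine Finite.of_injective (β := Σ r : Iic (max x 0), Fin (d r))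
      (fun p => ⟨⟨p.1, p.1.2.trans (le_max_left x 0)⟩, p.2⟩) ?_
    rintro ⟨⟨r, hr⟩, i⟩ ⟨⟨r', hr'⟩, i'⟩ heq
    obtain ⟨h1, h2⟩ := Sigma.mk.inj heq
    obtain rfl : r = r' := congrArg Subtype.val h1
    obtain rfl := eq_of_heq h2
    rfl
  have hinf : Infinite (Σ r : ℝ, Fin (d r)) := by
    -- With finitely many eigenvalues in all, a test space of larger dimension with Rayleigh
    -- quotient bounded by some `x` would contradict the dimension bound.
    by_contra hnot
    have : Finite (Σ r : ℝ, Fin (d r)) := not_infinite_iff_finite.1 hnot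
    obtain ⟨W, hWf, hW⟩ := hV (Nat.card (Σ r : ℝ, Fin (d r)))
    obtain ⟨x, hx, hle⟩ := exists_re_inner_le_mul (A := S) (B := B) (W := W) fun w _ => h.pos w
    have h1 := h.finrank_le_of_le hx hle
    rw [(h.finite_and_finrank_pencilSubspace hx).2] at h1
    have h2 : Nat.card (Σ r : Iic x, Fin (d r)) ≤ Nat.card (Σ r : ℝ, Fin (d r)) := by
      refine Nat.card_le_card_of_injective (fun p => ⟨p.1, p.2⟩) ?_
      rintro ⟨⟨r, hr⟩, i⟩ ⟨⟨r', hr'⟩, i'⟩ heq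
      obtain ⟨h1, h2⟩ := Sigma.mk.inj heq
      obtain rfl : r = r' := h1
      obtain rfl := eq_of_heq h2
      rfl
    exact absurd (hW.trans_le (h1.trans h2)) (lt_irrefl _)
  obtain ⟨f, hf, hmult⟩ := exists_monotone_enumeration d hfin hinf
  have hf0 : ∀ n, 0 ≤ f n := by
    intro n
    by_contra hneg
    have := hmult (f n)
    rw [hd _ (not_le.1 hneg), Nat.cast_zero, Set.encard_eq_zero] at this
    exact (this.subset (show n ∈ {m | f m = f n} from rfl) : n ∈ (∅ : Set ℕ))
  refine ⟨fun n => Real.sqrt (f n), fun n => Real.sqrt_nonneg _,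
    fun m n hmn => Real.sqrt_le_sqrt (hf hmn), fun lam => ?_⟩
  have hset : {n : ℕ | ((Real.sqrt (f n) : ℝ) : ℂ) ^ 2 = lam} = {n : ℕ | ((f n : ℝ) : ℂ) = lam} := by
    ext n
    change ((Real.sqrt (f n) : ℝ) : ℂ) ^ 2 = lam ↔ ((f n : ℝ) : ℂ) = lam
    rw [← Complex.ofReal_pow, Real.sq_sqrt (hf0 n)]
  rw [hset]
  by_cases hlam : ((lam.re : ℝ) : ℂ) = lam
  · rw [← hlam, ← hmult lam.re]
    congr 1
    ext n
    exact Complex.ofReal_inj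
  · have h1 : pencilEigenspace S B lam = ⊥ := by
      refine (Submodule.eq_bot_iff _).2 fun v hv => ?_
      by_contra hv0
      exact hlam (h.eigenvalue_real (mem_pencilEigenspace.1 hv) hv0).2
    rw [h1, finrank_bot, Nat.cast_zero, Set.encard_eq_zero]
    refine Set.eq_empty_of_forall_notMem fun n hn => hlam ?_
    have hn' : ((f n : ℝ) : ℂ) = lam := hn
    rw [← hn', Complex.ofReal_re]

end PencilSpectrum

/-! ### Dependence of the eigenvalues on the parameter -/

section PencilFamily

variable {V : Type*} [NormedAddCommGroup V] [InnerProductSpace ℂ V]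

/-- Nonnegative symmetric operators `D` and `Q` and a compact positive operator `B` such that
`D + B` is coercive. The eigenvalues of the pencils `(D + s Q, B)`, `s ≥ 0`, are compared. -/
structure IsPencilFamily (D Q B : V →L[ℂ] V) : Prop where
  symm_D : (D : V →ₗ[ℂ] V).IsSymmetric
  symm_Q : (Q : V →ₗ[ℂ] V).IsSymmetric
  symm_B : (B : V →ₗ[ℂ] V).IsSymmetric
  nonneg_D : ∀ v, 0 ≤ (⟪D v, v⟫_ℂ).re
  nonneg_Q : ∀ v, 0 ≤ (⟪Q v, v⟫_ℂ).re
  pos_B : ∀ v, v ≠ 0 → 0 < (⟪B v, v⟫_ℂ).re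
  compact_B : IsCompactOperator B
  coercive : ∃ c : ℝ, 0 < c ∧ ∀ v, c * ‖v‖ ^ 2 ≤ (⟪D v, v⟫_ℂ).re + (⟪B v, v⟫_ℂ).re

theorem re_inner_add_smul (D Q : V →L[ℂ] V) (s : ℝ) (v : V) :
    (⟪(D + (s : ℂ) • Q) v, v⟫_ℂ).re = (⟪D v, v⟫_ℂ).re + s * (⟪Q v, v⟫_ℂ).re := by
  simp

namespace IsPencilFamily

variable {D Q B : V →L[ℂ] V}

theorem isCompactPencil (h : IsPencilFamily D Q B) {s : ℝ} (hs : 0 ≤ s) :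
    IsCompactPencil (D + (s : ℂ) • Q) B where
  symm_left := by
    refine LinearMap.IsSymmetric.add h.symm_D fun x y => ?_
    have := h.symm_Q x y
    simp only [ContinuousLinearMap.coe_coe, ContinuousLinearMap.toLinearMap_smul, LinearMap.smul_apply,
      inner_smul_left, inner_smul_right, Complex.conj_ofReal] at this ⊢
    rw [this]
  symm_right := h.symm_B
  nonneg v := by
    rw [re_inner_add_smul]
    exact add_nonneg (h.nonneg_D v) (mul_nonneg hs (h.nonneg_Q v))
  pos := h.pos_B
  compact := h.compact_B
  coercive := by
    obtain ⟨c, hc, hcoer⟩ := h.coercive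
    refine ⟨c, hc, fun v => (hcoer v).trans ?_⟩
    rw [re_inner_add_smul]
    have := mul_nonneg hs (h.nonneg_Q v)
    linarith

variable {Ω : ℝ → ℕ → ℝ}

/-- The spectral subspace at `t` is a test space at `s`, where the form is smaller because `Q ≥ 0`.
-/
theorem sq_mono [CompleteSpace V] (h : IsPencilFamily D Q B)
    (hΩ : ∀ s : ℝ, 0 < s → IsPencilSpectrum (D + (s : ℂ) • Q) B (Ω s)) (n : ℕ) {s t : ℝ}
    (hs : 0 < s) (hst : s ≤ t) : Ω s n ^ 2 ≤ Ω t n ^ 2 := by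
  have ht := hs.trans_le hst
  have hpt := h.isCompactPencil ht.le
  refine (hΩ s hs).le_of_forall_le (h.isCompactPencil hs.le) (sq_nonneg _)
    ((hΩ t ht).lt_finrank hpt n) fun v hv => ?_
  have h1 := hpt.le_of_mem_pencilSubspace (sq_nonneg _) hv
  have h2 := mul_le_mul_of_nonneg_right hst (h.nonneg_Q v)
  rw [re_inner_add_smul] at h1 ⊢
  linarith

/-- Since `D ≥ 0` and `t/s ≥ 1`, the form of `D + t Q` is at most `t/s` times that of `D + s Q`.
Thus `Ω²/s` is nonincreasing. -/
theorem sq_le_div_mul [CompleteSpace V] (h : IsPencilFamily D Q B)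
    (hΩ : ∀ s : ℝ, 0 < s → IsPencilSpectrum (D + (s : ℂ) • Q) B (Ω s)) (n : ℕ) {s t : ℝ}
    (hs : 0 < s) (hst : s ≤ t) : Ω t n ^ 2 ≤ t / s * Ω s n ^ 2 := by
  have ht := hs.trans_le hst
  have hps := h.isCompactPencil hs.le
  refine (hΩ t ht).le_of_forall_le (h.isCompactPencil ht.le) (by positivity)
    ((hΩ s hs).lt_finrank hps n) fun v hv => ?_
  have h1 := hps.le_of_mem_pencilSubspace (sq_nonneg _) hv
  rw [re_inner_add_smul] at h1 ⊢
  have h2 := mul_le_mul_of_nonneg_left h1 (show 0 ≤ t / s by positivity)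
  have h3 : t / s * (s * (⟪Q v, v⟫_ℂ).re) = t * (⟪Q v, v⟫_ℂ).re := by field_simp
  have h4 := mul_le_mul_of_nonneg_right ((one_le_div hs).2 hst) (h.nonneg_D v)
  rw [mul_add, h3] at h2
  linarith

/-- Monotonicity of `Ω²` and of `Ω²/s` squeezes `Ω²` between `min 1 (s/s₀)` and `max 1 (s/s₀)` times
its value at `s₀`. -/
theorem continuousAt_sq [CompleteSpace V] (h : IsPencilFamily D Q B)
    (hΩ : ∀ s : ℝ, 0 < s → IsPencilSpectrum (D + (s : ℂ) • Q) B (Ω s)) (n : ℕ) {s₀ : ℝ}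
    (hs₀ : 0 < s₀) : ContinuousAt (fun s => Ω s n ^ 2) s₀ := by
  have hlow : Tendsto (fun s => min 1 (s / s₀) * Ω s₀ n ^ 2) (𝓝 s₀) (𝓝 (Ω s₀ n ^ 2)) := by
    have : ContinuousAt (fun s => min 1 (s / s₀) * Ω s₀ n ^ 2) s₀ := by fun_prop
    simpa [ContinuousAt, hs₀.ne'] using this
  have hup : Tendsto (fun s => max 1 (s / s₀) * Ω s₀ n ^ 2) (𝓝 s₀) (𝓝 (Ω s₀ n ^ 2)) := by
    have : ContinuousAt (fun s => max 1 (s / s₀) * Ω s₀ n ^ 2) s₀ := by fun_prop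
    simpa [ContinuousAt, hs₀.ne'] using this
  have hev : ∀ᶠ s in 𝓝 s₀, 0 < s := eventually_gt_nhds hs₀
  refine tendsto_of_tendsto_of_tendsto_of_le_of_le' hlow hup ?_ ?_
  · filter_upwards [hev] with s hs
    rcases le_total s s₀ with hle | hle
    · have h1 := h.sq_le_div_mul hΩ n hs hle
      calc _ ≤ s / s₀ * (s₀ / s * Ω s n ^ 2) := by gcongr; exact min_le_right _ _
        _ = _ := by field_simp
    · calc _ ≤ 1 * Ω s₀ n ^ 2 := by gcongr; exact min_le_left _ _
        _ ≤ _ := by rw [one_mul]; exact h.sq_mono hΩ n hs₀ hle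
  · filter_upwards [hev] with s hs
    rcases le_total s s₀ with hle | hle
    · calc _ ≤ 1 * Ω s₀ n ^ 2 := by rw [one_mul]; exact h.sq_mono hΩ n hs hle
        _ ≤ _ := by gcongr; exact le_max_left _ _
    · calc _ ≤ s / s₀ * Ω s₀ n ^ 2 := h.sq_le_div_mul hΩ n hs₀ hle
        _ ≤ _ := by gcongr; exact le_max_right _ _

/-- Normalized eigenvectors of nearby pencils subconverge to an eigenvector. -/
theorem exists_subseq_tendsto [CompleteSpace V] (h : IsPencilFamily D Q B) {s₀ l₀ : ℝ}
    (hs₀ : 0 ≤ s₀) {s l : ℕ → ℝ} (hs : Tendsto s atTop (𝓝 s₀)) (hl : Tendsto l atTop (𝓝 l₀))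
    {u : ℕ → V} (hu1 : ∀ j, ‖u j‖ = 1)
    (hu : ∀ᶠ j in atTop, (D + (s j : ℂ) • Q) (u j) = (l j : ℂ) • B (u j)) :
    ∃ (φ : ℕ → ℕ) (v : V), StrictMono φ ∧ Tendsto (fun j => u (φ j)) atTop (𝓝 v) ∧ ‖v‖ = 1 ∧
      (D + (s₀ : ℂ) • Q) v = (l₀ : ℂ) • B v := by
  have hp := h.isCompactPencil hs₀
  obtain ⟨c, hc, hcoer⟩ := hp.coercive
  obtain ⟨R, -, hRR⟩ := exists_symmetric_sqrt (A := D + (s₀ : ℂ) • Q + B)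
    (hp.symm_left.add hp.symm_right) hc fun v => by
      rw [add_apply, inner_add_left, Complex.add_re]; exact hcoer v
  obtain ⟨C, hC, hCB⟩ := IsCompactOperator.image_closedBall_subset_compact
    (f := (B : V →ₗ[ℂ] V)) h.compact_B 1
  obtain ⟨y, -, φ, hφ, hy⟩ := hC.tendsto_subseq (x := fun j => B (u j)) fun j =>
    hCB ⟨u j, by simp [hu1], rfl⟩
  have hφt := hφ.tendsto_atTop
  have hQ0 : Tendsto (fun j => ((s (φ j) - s₀ : ℝ) : ℂ) • Q (u (φ j))) atTop (𝓝 0) := by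
    rw [tendsto_zero_iff_norm_tendsto_zero]
    have hz : Tendsto (fun j => |s (φ j) - s₀| * ‖Q‖) atTop (𝓝 0) := by
      have h1 : Tendsto (fun j => s (φ j) - s₀) atTop (𝓝 0) := by
        simpa using (hs.comp hφt).sub_const s₀
      simpa using h1.abs.mul_const ‖Q‖
    refine squeeze_zero (fun _ => norm_nonneg _) (fun j => ?_) hz
    rw [norm_smul, Complex.norm_real, Real.norm_eq_abs]
    have := Q.le_opNorm (u (φ j))
    rw [hu1, mul_one] at this
    gcongr
  -- The equation rearranges to `(D + s₀ Q + B) u = (l + 1) B u - (s - s₀) Q u`. The right side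
  -- converges along the subsequence, by compactness of `B` and boundedness of `Q u`, and the
  -- operator on the left is `R²`, which is invertible.
  have hlim : Tendsto (fun j => ((l (φ j) + 1 : ℝ) : ℂ) • B (u (φ j))
      - ((s (φ j) - s₀ : ℝ) : ℂ) • Q (u (φ j))) atTop (𝓝 (((l₀ + 1 : ℝ) : ℂ) • y - 0)) := by
    refine Tendsto.sub (Tendsto.smul ?_ hy) hQ0
    exact (Complex.continuous_ofReal.tendsto _).comp ((hl.comp hφt).add_const 1)
  have hRu : ∀ᶠ j in atTop, R.symm (R.symm (((l (φ j) + 1 : ℝ) : ℂ) • B (u (φ j))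
      - ((s (φ j) - s₀ : ℝ) : ℂ) • Q (u (φ j)))) = u (φ j) := by
    filter_upwards [hφt.eventually hu] with j hj
    have : ((l (φ j) + 1 : ℝ) : ℂ) • B (u (φ j)) - ((s (φ j) - s₀ : ℝ) : ℂ) • Q (u (φ j))
        = R (R (u (φ j))) := by
      rw [hRR]
      simp only [add_apply, smul_apply] at hj ⊢
      push_cast
      rw [add_smul, ← hj, sub_smul, one_smul]
      abel
    rw [this, R.symm_apply_apply, R.symm_apply_apply]
  set v := R.symm (R.symm (((l₀ + 1 : ℝ) : ℂ) • y)) with hv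
  have huv : Tendsto (fun j => u (φ j)) atTop (𝓝 v) := by
    rw [sub_zero] at hlim
    refine Tendsto.congr' hRu ?_
    exact (((R.symm.continuous.comp R.symm.continuous).tendsto _).comp hlim)
  have hBv : B v = y := tendsto_nhds_unique ((B.continuous.tendsto v).comp huv) hy
  refine ⟨φ, v, hφ, huv, ?_, ?_⟩
  · refine tendsto_nhds_unique huv.norm ?_
    simp only [hu1]
    exact tendsto_const_nhds
  · have h1 : R (R v) = ((l₀ + 1 : ℝ) : ℂ) • y := by
      rw [hv, R.apply_symm_apply, R.apply_symm_apply]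
    rw [hRR, ← hBv, add_apply] at h1
    push_cast at h1
    rw [add_smul, one_smul] at h1
    exact add_right_cancel h1

/-- A simple eigenvalue is differentiable in the parameter. -/
theorem hasDerivAt_sq [CompleteSpace V] (h : IsPencilFamily D Q B)
    (hΩ : ∀ s : ℝ, 0 < s → IsPencilSpectrum (D + (s : ℂ) • Q) B (Ω s)) (n : ℕ) {s₀ : ℝ}
    (hs₀ : 0 < s₀)
    (hsimple : Module.finrank ℂ
      (pencilEigenspace (D + (s₀ : ℂ) • Q) B ((Ω s₀ n ^ 2 : ℝ) : ℂ)) = 1)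
    {u₀ : V} (hu₀ : u₀ ≠ 0) (heig : (D + (s₀ : ℂ) • Q) u₀ = ((Ω s₀ n ^ 2 : ℝ) : ℂ) • B u₀) :
    HasDerivAt (fun s => Ω s n ^ 2) ((⟪Q u₀, u₀⟫_ℂ).re / (⟪B u₀, u₀⟫_ℂ).re) s₀ := by
  have hunit : ∀ s : ℝ, 0 < s → ∃ u, ‖u‖ = 1 ∧
      (D + (s : ℂ) • Q) u = ((Ω s n ^ 2 : ℝ) : ℂ) • B u := by
    intro s hs
    obtain ⟨v, hv0, hv⟩ := (hΩ s hs).exists_eigenvector n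
    refine ⟨((‖v‖⁻¹ : ℝ) : ℂ) • v, by simp [norm_smul, hv0], ?_⟩
    rw [map_smul, map_smul, hv, smul_comm]
  have hex : ∀ s : ℝ, ∃ u, ‖u‖ = 1 ∧
      (0 < s → (D + (s : ℂ) • Q) u = ((Ω s n ^ 2 : ℝ) : ℂ) • B u) := by
    intro s
    by_cases hs : 0 < s
    · obtain ⟨u, h1, h2⟩ := hunit s hs
      exact ⟨u, h1, fun _ => h2⟩
    · obtain ⟨u, h1, -⟩ := hunit s₀ hs₀
      exact ⟨u, h1, fun hs' => absurd hs' hs⟩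
  choose u hu1 hu using hex
  rw [hasDerivAt_iff_tendsto_slope]
  -- The chosen eigenvectors need not depend continuously on `s`; it is enough to find a good
  -- subsequence of every sequence, since the limit of the quotients does not depend on it.
  refine tendsto_of_subseq_tendsto fun ns hns => ?_
  have hns1 : Tendsto ns atTop (𝓝 s₀) := hns.mono_right nhdsWithin_le_nhds
  have hns2 : ∀ᶠ j in atTop, ns j ≠ s₀ := hns.eventually eventually_mem_nhdsWithin
  have hns3 : ∀ᶠ j in atTop, 0 < ns j := hns1.eventually (eventually_gt_nhds hs₀)
  obtain ⟨φ, v, hφ, huv, hv1, hv⟩ := h.exists_subseq_tendsto hs₀.le hns1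
    ((h.continuousAt_sq hΩ n hs₀).tendsto.comp hns1) (u := fun j => u (ns j)) (fun j => hu1 _)
    (by filter_upwards [hns3] with j hj; exact hu _ hj)
  refine ⟨φ, ?_⟩
  -- Simplicity enters here: the limit eigenvector is a multiple of `u₀`, and the factor cancels in
  -- the quotient of forms.
  obtain ⟨c, hc⟩ : ∃ c : ℂ, c • u₀ = v := by
    obtain ⟨c, hc⟩ := (finrank_eq_one_iff_of_nonzero'
      (⟨u₀, mem_pencilEigenspace.2 heig⟩ : pencilEigenspace (D + (s₀ : ℂ) • Q) B _)
      (fun h0 => hu₀ (congrArg Subtype.val h0))).1 hsimple ⟨v, mem_pencilEigenspace.2 hv⟩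
    exact ⟨c, congrArg Subtype.val hc⟩
  have hc0 : c ≠ 0 := by
    rintro rfl
    rw [zero_smul] at hc
    rw [← hc, norm_zero] at hv1
    exact zero_ne_one hv1
  have hBre : (((⟪B u₀, u₀⟫_ℂ).re : ℝ) : ℂ) = ⟪B u₀, u₀⟫_ℂ := h.symm_B.coe_re_inner_apply_self u₀
  have hQre : (((⟪Q u₀, u₀⟫_ℂ).re : ℝ) : ℂ) = ⟪Q u₀, u₀⟫_ℂ := h.symm_Q.coe_re_inner_apply_self u₀
  have hB0 : ⟪B u₀, u₀⟫_ℂ ≠ 0 := by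
    rw [← hBre]; exact_mod_cast (h.pos_B u₀ hu₀).ne'
  have hBlim : Tendsto (fun j => ⟪B (u (ns (φ j))), u₀⟫_ℂ) atTop (𝓝 ⟪B v, u₀⟫_ℂ) :=
    ((B.continuous.tendsto v).comp huv).inner tendsto_const_nhds
  have hQlim : Tendsto (fun j => ⟪Q (u (ns (φ j))), u₀⟫_ℂ) atTop (𝓝 ⟪Q v, u₀⟫_ℂ) :=
    ((Q.continuous.tendsto v).comp huv).inner tendsto_const_nhds
  have hBv0 : ⟪B v, u₀⟫_ℂ ≠ 0 := by
    rw [← hc, map_smul, inner_smul_left]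
    exact mul_ne_zero (by simpa using hc0) hB0
  have hval : ⟪Q v, u₀⟫_ℂ / ⟪B v, u₀⟫_ℂ
      = (((⟪Q u₀, u₀⟫_ℂ).re / (⟪B u₀, u₀⟫_ℂ).re : ℝ) : ℂ) := by
    rw [← hc, map_smul, inner_smul_left, map_smul, inner_smul_left,
      mul_div_mul_left _ _ (by simpa using hc0), Complex.ofReal_div, hBre, hQre]
  have hquot := hQlim.div hBlim hBv0
  rw [hval] at hquot
  have hre := (Complex.continuous_re.tendsto _).comp hquot
  rw [Complex.ofReal_re] at hre
  refine Tendsto.congr' ?_ hre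
  filter_upwards [hφ.tendsto_atTop.eventually hns2, hφ.tendsto_atTop.eventually hns3,
    hBlim.eventually_ne hBv0] with j hj2 hj3 hj4
  set s := ns (φ j)
  -- Pair the equation at `s` with `u₀` and the equation at `s₀` with `u s`; by symmetry the terms
  -- with `D` cancel.
  have hkey : ((Ω s n ^ 2 - Ω s₀ n ^ 2 : ℝ) : ℂ) * ⟪B (u s), u₀⟫_ℂ
      = ((s - s₀ : ℝ) : ℂ) * ⟪Q (u s), u₀⟫_ℂ := by
    have h1 := congrArg (fun w => ⟪w, u₀⟫_ℂ) (hu s hj3)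
    have h2 := congrArg (fun w => ⟪u s, w⟫_ℂ) heig
    have hD : ⟪D (u s), u₀⟫_ℂ = ⟪u s, D u₀⟫_ℂ := h.symm_D _ _
    have hQ : ⟪Q (u s), u₀⟫_ℂ = ⟪u s, Q u₀⟫_ℂ := h.symm_Q _ _
    have hB : ⟪B (u s), u₀⟫_ℂ = ⟪u s, B u₀⟫_ℂ := h.symm_B _ _
    simp only [add_apply, smul_apply, inner_add_left, inner_add_right, inner_smul_left,
      inner_smul_right, Complex.conj_ofReal] at h1 h2
    rw [hD, hQ, hB] at h1
    rw [hQ, hB]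
    push_cast at h1 h2 ⊢
    linear_combination h2 - h1
  have hss : ((s - s₀ : ℝ) : ℂ) ≠ 0 := by exact_mod_cast sub_ne_zero.2 hj2
  have : ⟪Q (u s), u₀⟫_ℂ / ⟪B (u s), u₀⟫_ℂ
      = (((s - s₀)⁻¹ * (Ω s n ^ 2 - Ω s₀ n ^ 2) : ℝ) : ℂ) := by
    rw [div_eq_iff hj4, Complex.ofReal_mul, Complex.ofReal_inv, mul_assoc, hkey,
      inv_mul_cancel_left₀ hss]
  simp only [Function.comp_apply, Pi.div_apply, slope, vsub_eq_sub, smul_eq_mul]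
  rw [this, Complex.ofReal_re]

/-- `Ω²/s` decreases strictly unless some eigenvector is annihilated by `D`. -/
theorem sq_div_lt [CompleteSpace V] (h : IsPencilFamily D Q B)
    (hΩ : ∀ s : ℝ, 0 < s → IsPencilSpectrum (D + (s : ℂ) • Q) B (Ω s)) {n : ℕ} {s t : ℝ}
    (hs : 0 < s) (hst : s < t)
    (hD : ∀ u, u ≠ 0 → (D + (s : ℂ) • Q) u = ((Ω s n ^ 2 : ℝ) : ℂ) • B u → 0 < (⟪D u, u⟫_ℂ).re) :
    Ω t n ^ 2 / t < Ω s n ^ 2 / s := by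
  have ht := hs.trans hst
  have hps := h.isCompactPencil hs.le
  set x := Ω s n ^ 2 / s with hx
  have hx0 : 0 ≤ x := by positivity
  have hsx : s * x = Ω s n ^ 2 := by rw [hx]; field_simp
  set W := pencilSubspace (D + (s : ℂ) • Q) B (Ω s n ^ 2)
  have : FiniteDimensional ℂ W := hps.finiteDimensional_pencilSubspace (sq_nonneg _)
  have hform : ∀ v, (⟪(((t * x : ℝ) : ℂ) • B - (D + (t : ℂ) • Q)) v, v⟫_ℂ).re
      = t * x * (⟪B v, v⟫_ℂ).re - ((⟪D v, v⟫_ℂ).re + t * (⟪Q v, v⟫_ℂ).re) := by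
    intro v
    rw [sub_apply, inner_sub_left, Complex.sub_re, re_inner_add_smul, smul_apply, inner_smul_left,
      Complex.conj_ofReal, Complex.re_ofReal_mul]
  -- Multiply the bound `D + s Q ≤ s x B` on `W` by `t/s`. The surplus `(t/s - 1) D` is positive
  -- unless the form of `D` vanishes at `w`. In that case the bound is itself strict, for equality
  -- would make `w` an eigenvector, which `hD` excludes.
  have hpos : ∀ w ∈ W, w ≠ 0 →
      0 < (⟪(((t * x : ℝ) : ℂ) • B - (D + (t : ℂ) • Q)) w, w⟫_ℂ).re := by
    intro w hw hw0
    rw [hform]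
    have h1 := hps.le_of_mem_pencilSubspace (sq_nonneg _) hw
    rw [re_inner_add_smul, ← hsx] at h1
    have h1' := mul_le_mul_of_nonneg_left h1 (show 0 ≤ t / s by positivity)
    have e1 : t / s * ((⟪D w, w⟫_ℂ).re + s * (⟪Q w, w⟫_ℂ).re)
        = t / s * (⟪D w, w⟫_ℂ).re + t * (⟪Q w, w⟫_ℂ).re := by field_simp
    have e2 : t / s * (s * x * (⟪B w, w⟫_ℂ).re) = t * x * (⟪B w, w⟫_ℂ).re := by field_simp
    rw [e1, e2] at h1'
    rcases eq_or_lt_of_le (h.nonneg_D w) with hD0 | hD0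
    · rcases eq_or_lt_of_le h1 with heq | hlt
      · have hmem := hps.mem_pencilEigenspace_of_le (sq_nonneg _) hw (by
          rw [re_inner_add_smul, ← hsx, heq])
        exact absurd hD0 (hD w hw0 (mem_pencilEigenspace.1 hmem)).ne
      · have h2 := mul_lt_mul_of_pos_left hlt (show 0 < t / s by positivity)
        rw [e1, e2, ← hD0] at h2
        rw [← hD0]
        linarith
    · have h2 := mul_lt_mul_of_pos_right ((one_lt_div hs).2 hst) hD0
      linarith
  obtain ⟨δ, hδ, hle⟩ := exists_pos_le_re_inner hpos
  -- The strict inequality becomes a gap that is uniform on `W` and measured by `B`, so the Rayleigh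
  -- level `t x` can be lowered by `η`.
  obtain ⟨η, hη, hηle⟩ : ∃ η : ℝ, 0 < η ∧ ∀ w ∈ W, η * (⟪B w, w⟫_ℂ).re ≤ δ * ‖w‖ ^ 2 := by
    refine ⟨δ / (‖B‖ + 1), by positivity, fun w _ => ?_⟩
    have h1 := re_inner_le_opNorm B w
    rw [div_mul_eq_mul_div, div_le_iff₀ (by positivity)]
    nlinarith [mul_le_mul_of_nonneg_left h1 hδ.le, mul_nonneg hδ.le (sq_nonneg ‖w‖)]
  -- The variational bound needs a nonnegative level, hence the maximum with `0`; that `t x` is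
  -- positive is checked afterwards.
  have hfinal : Ω t n ^ 2 ≤ max (t * x - η) 0 := by
    refine (hΩ t ht).le_of_forall_le (h.isCompactPencil ht.le) (le_max_right _ _)
      ((hΩ s hs).lt_finrank hps n) fun w hw => ?_
    have h1 := hle w hw
    have h2 := hηle w hw
    rw [hform] at h1
    have hB0 : 0 ≤ (⟪B w, w⟫_ℂ).re := by
      by_cases hw0 : w = 0
      · simp [hw0]
      · exact (h.pos_B w hw0).le
    rw [re_inner_add_smul]
    have h3 := mul_le_mul_of_nonneg_right (le_max_left (t * x - η) 0) hB0
    linarith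
  rw [div_lt_iff₀ ht, mul_comm]
  refine hfinal.trans_lt (max_lt (by linarith) ?_)
  by_contra hneg
  have htx : t * x = 0 := le_antisymm (not_lt.1 hneg) (by positivity)
  have hW : W ≠ ⊥ := by
    intro hbot
    have := (hΩ s hs).lt_finrank hps n
    change n < Module.finrank ℂ W at this
    rw [hbot, finrank_bot] at this
    exact absurd this (Nat.not_lt_zero n)
  obtain ⟨w, hw, hw0⟩ := Submodule.exists_mem_ne_zero_of_ne_bot hW
  have h1 := hpos w hw hw0
  rw [hform, htx] at h1
  have := h.nonneg_D w
  have := mul_nonneg ht.le (h.nonneg_Q w)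
  linarith

/-- If `Q` is a multiple of `B`, an eigenvector annihilated by `D` belongs to the lowest
eigenvalue. -/
theorem eq_zero_of_re_inner_eq_zero [CompleteSpace V] (h : IsPencilFamily D Q B)
    {s : ℝ} (hs : 0 ≤ s) {ω : ℕ → ℝ} (hω : IsPencilSpectrum (D + (s : ℂ) • Q) B ω) {n : ℕ} {c : ℝ}
    (hQB : Q = (c : ℂ) • B) (hker : Module.finrank ℂ (LinearMap.ker (D : V →ₗ[ℂ] V)) ≤ 1)
    {u : V} (hu0 : u ≠ 0) (hu : (D + (s : ℂ) • Q) u = ((ω n ^ 2 : ℝ) : ℂ) • B u)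
    (hDu : (⟪D u, u⟫_ℂ).re = 0) : n = 0 := by
  have hp := h.isCompactPencil hs
  have hD0 : D u = 0 :=
    apply_eq_zero_of_re_inner_eq_zero (S := (D : V →ₗ[ℂ] V)) h.symm_D h.nonneg_D hDu
  have hQv : ∀ v, (⟪Q v, v⟫_ℂ).re = c * (⟪B v, v⟫_ℂ).re := by
    intro v
    rw [hQB, smul_apply, inner_smul_left, Complex.conj_ofReal, Complex.re_ofReal_mul]
  have hBu := h.pos_B u hu0
  have hval : ω n ^ 2 = s * c := by
    have h1 := congrArg (fun w => (⟪w, u⟫_ℂ).re) hu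
    simp only [re_inner_add_smul, hDu, hQv, inner_smul_left, Complex.conj_ofReal,
      Complex.re_ofReal_mul, zero_add] at h1
    have : (s * c - ω n ^ 2) * (⟪B u, u⟫_ℂ).re = 0 := by linarith
    rcases mul_eq_zero.1 this with h | h
    · linarith
    · exact absurd h hBu.ne'
  -- The value `s c` bounds every Rayleigh quotient from below, so all eigenvalues up to the index
  -- `n` equal it. For `n ≠ 0` its multiplicity is at least two, but its eigenspace is the kernel of
  -- `D`.
  by_contra hn
  obtain ⟨v, hv0, hv⟩ := hω.exists_eigenvector 0
  have hge : s * c ≤ ω 0 ^ 2 := by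
    have h1 := congrArg (fun w => (⟪w, v⟫_ℂ).re) hv
    simp only [re_inner_add_smul, hQv, inner_smul_left, Complex.conj_ofReal,
      Complex.re_ofReal_mul] at h1
    have h2 := h.nonneg_D v
    have h3 := h.pos_B v hv0
    by_contra hlt
    have := mul_lt_mul_of_pos_right (not_le.1 hlt) h3
    linarith
  have h0 : ω 0 ^ 2 = ω n ^ 2 := le_antisymm (hω.sq_mono (Nat.zero_le n)) (hval ▸ hge)
  have henc := hω.encard_eq (ω n ^ 2)
  have h2 : ({0, n} : Set ℕ).encard ≤ {m | ω m ^ 2 = ω n ^ 2}.encard := by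
    refine Set.encard_le_encard ?_
    rintro m (rfl | rfl)
    · exact h0
    · rfl
  rw [Set.encard_pair (Ne.symm hn), henc] at h2
  have hle : pencilEigenspace (D + (s : ℂ) • Q) B ((ω n ^ 2 : ℝ) : ℂ)
      ≤ LinearMap.ker (D : V →ₗ[ℂ] V) := by
    intro w hw
    have h3 := mem_pencilEigenspace.1 hw
    rw [hval, hQB, add_apply, smul_apply, smul_apply, smul_smul, ← Complex.ofReal_mul] at h3
    exact add_eq_right.1 h3
  -- Monotonicity of `finrank` requires the larger space to be finite dimensional, as `finrank` is
  -- `0` on infinite dimensional spaces.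
  have hfd : FiniteDimensional ℂ (LinearMap.ker (D : V →ₗ[ℂ] V)) := by
    have := hp.finiteDimensional_pencilEigenspace ((ω n ^ 2 : ℝ) : ℂ)
    refine Submodule.finiteDimensional_of_le (S₂ := pencilEigenspace (D + (s : ℂ) • Q) B
      ((ω n ^ 2 : ℝ) : ℂ)) fun w hw => ?_
    rw [mem_pencilEigenspace, hval, hQB, add_apply, smul_apply, smul_apply, smul_smul,
      ← Complex.ofReal_mul]
    exact add_eq_right.2 hw
  have h4 := (Submodule.finrank_mono hle).trans hker
  have h5 : (2 : ℕ∞) ≤ (1 : ℕ) := h2.trans (by exact_mod_cast h4)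
  exact absurd h5 (by norm_num)

/-- The limit of `Ω²/s` is the optimal lower bound of `Q` relative to `B`. -/
theorem tendsto_sq_div [CompleteSpace V] (h : IsPencilFamily D Q B)
    (hΩ : ∀ s : ℝ, 0 < s → IsPencilSpectrum (D + (s : ℂ) • Q) B (Ω s)) (n : ℕ) {m : ℝ}
    (hlow : ∀ v, m * (⟪B v, v⟫_ℂ).re ≤ (⟪Q v, v⟫_ℂ).re)
    (hup : ∀ ε, 0 < ε → ∃ W : Submodule ℂ V, FiniteDimensional ℂ W ∧ n < Module.finrank ℂ W ∧
      ∀ v ∈ W, (⟪Q v, v⟫_ℂ).re ≤ (m + ε) * (⟪B v, v⟫_ℂ).re) :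
    Tendsto (fun s => Ω s n ^ 2 / s) atTop (𝓝 m) := by
  rw [Metric.tendsto_atTop]
  intro ε hε
  obtain ⟨W, hWf, hWn, hW⟩ := hup (ε / 2) (half_pos hε)
  obtain ⟨x, hx, hxle⟩ := exists_re_inner_le_mul (A := D) (W := W) fun w _ => h.pos_B w
  have hge : ∀ s, 0 < s → m * s ≤ Ω s n ^ 2 := by
    intro s hs
    obtain ⟨v, hv0, hv⟩ := (hΩ s hs).exists_eigenvector n
    have h1 := congrArg (fun w => (⟪w, v⟫_ℂ).re) hv
    simp only [re_inner_add_smul, inner_smul_left, Complex.conj_ofReal,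
      Complex.re_ofReal_mul] at h1
    have h2 := h.nonneg_D v
    have h3 := h.pos_B v hv0
    have h4 := mul_le_mul_of_nonneg_left (hlow v) hs.le
    by_contra hlt
    have := mul_lt_mul_of_pos_right (not_le.1 hlt) h3
    linarith
  have hle : ∀ s, 0 < s → Ω s n ^ 2 ≤ max (x + s * (m + ε / 2)) 0 := by
    intro s hs
    refine (hΩ s hs).le_of_forall_le (h.isCompactPencil hs.le) (le_max_right _ _) hWn
      fun w hw => ?_
    have hB0 : 0 ≤ (⟪B w, w⟫_ℂ).re := by
      by_cases hw0 : w = 0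
      · simp [hw0]
      · exact (h.pos_B w hw0).le
    rw [re_inner_add_smul]
    have h1 := hxle w hw
    have h2 := mul_le_mul_of_nonneg_left (hW w hw) hs.le
    have h3 := mul_le_mul_of_nonneg_right (le_max_left (x + s * (m + ε / 2)) 0) hB0
    linarith
  -- For `s > 2x/ε` the contribution `x` of `D` is below `s ε/2`, the other half of `ε` being spent
  -- on the choice of `W`.
  refine ⟨max 1 (max (2 * x / ε + 1) 0), fun s hs => ?_⟩
  have hs1 : 1 ≤ s := (le_max_left _ _).trans hs
  have hs0 : 0 < s := by linarith
  have hs2 : 2 * x / ε < s := by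
    have := ((le_max_left _ _).trans (le_max_right _ _)).trans hs
    linarith
  have h1 := hge s hs0
  have h2 := hle s hs0
  rw [div_lt_iff₀ hε] at hs2
  have h3 : m ≤ Ω s n ^ 2 / s := (le_div_iff₀ hs0).2 h1
  rw [Real.dist_eq, abs_of_nonneg (by linarith), sub_lt_iff_lt_add, div_lt_iff₀ hs0]
  refine h2.trans_lt (max_lt (by nlinarith) ?_)
  by_contra hneg
  obtain ⟨v, hv0, -⟩ := (hΩ s hs0).exists_eigenvector n
  have hW0 : W ≠ ⊥ := by
    rintro rfl
    rw [finrank_bot] at hWn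
    exact absurd hWn (Nat.not_lt_zero n)
  obtain ⟨w, hw, hw0⟩ := Submodule.exists_mem_ne_zero_of_ne_bot hW0
  have h4 := hW w hw
  have h5 := h.nonneg_Q w
  have h6 := h.pos_B w hw0
  have h7 : 0 ≤ m + ε / 2 := by
    by_contra hlt
    have := mul_neg_of_neg_of_pos (not_le.1 hlt) h6
    linarith
  have h8 : 0 < (ε + m) * s := mul_pos (by linarith) hs0
  exact hneg h8

end IsPencilFamily

end PencilFamily

/-! ### Complex valued absolutely continuous functions -/

section AbsolutelyContinuous

theorem AbsolutelyContinuousOnInterval.congr_on {u v : ℝ → ℂ} {a b : ℝ}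
    (hu : AbsolutelyContinuousOnInterval u a b) (huv : ∀ x ∈ uIcc a b, u x = v x) :
    AbsolutelyContinuousOnInterval v a b := by
  refine Tendsto.congr' ?_ hu
  filter_upwards [mem_inf_of_right (mem_principal_self _)] with E hE
  refine Finset.sum_congr rfl fun i hi => ?_
  rw [huv _ (hE.1 i hi).1, huv _ (hE.1 i hi).2]

theorem AbsolutelyContinuousOnInterval.ofReal_comp {u : ℝ → ℝ} {a b : ℝ}
    (hu : AbsolutelyContinuousOnInterval u a b) :
    AbsolutelyContinuousOnInterval (fun x => (u x : ℂ)) a b := by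
  refine Tendsto.congr (fun E => Finset.sum_congr rfl fun i _ => ?_) hu
  exact (Complex.isometry_ofReal.dist_eq _ _).symm

theorem absolutelyContinuousOnInterval_integral {g : ℝ → ℂ} {a b : ℝ}
    (hg : IntervalIntegrable g volume a b) :
    AbsolutelyContinuousOnInterval (fun x => ∫ y in a..x, g y) a b := by
  have hre : IntervalIntegrable (fun x => (g x).re) volume a b := ⟨hg.1.re, hg.2.re⟩
  have him : IntervalIntegrable (fun x => (g x).im) volume a b := ⟨hg.1.im, hg.2.im⟩
  have h1 := (hre.absolutelyContinuousOnInterval_intervalIntegral (c := a) left_mem_uIcc).ofReal_comp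
  have h2 := (him.absolutelyContinuousOnInterval_intervalIntegral (c := a) left_mem_uIcc).ofReal_comp
  refine (h1.add (h2.const_smul Complex.I)).congr_on fun x hx => ?_
  have hgx : IntervalIntegrable g volume a x := hg.mono_set (uIcc_subset_uIcc_left hx)
  have hrex : IntervalIntegrable (fun x => ((g x).re : ℂ)) volume a x :=
    ⟨hgx.1.re.ofReal, hgx.2.re.ofReal⟩
  have himx : IntervalIntegrable (fun x => ((g x).im : ℂ)) volume a x :=
    ⟨hgx.1.im.ofReal, hgx.2.im.ofReal⟩
  simp only [Pi.add_apply, smul_eq_mul]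
  rw [← intervalIntegral.integral_ofReal, ← intervalIntegral.integral_ofReal,
    ← intervalIntegral.integral_const_mul, ← intervalIntegral.integral_add hrex
      (himx.const_mul _)]
  refine intervalIntegral.integral_congr fun y _ => ?_
  change ((g y).re : ℂ) + Complex.I * ((g y).im : ℂ) = g y
  rw [mul_comm, Complex.re_add_im]

/-- Fundamental theorem of calculus for complex valued absolutely continuous functions. -/
theorem AbsolutelyContinuousOnInterval.eq_add_integral {u g : ℝ → ℂ}
    (hu : AbsolutelyContinuousOnInterval u 0 1) (hg : IntervalIntegrable g volume 0 1)
    (hd : ∀ᵐ y : ℝ, y ∈ Icc (0 : ℝ) 1 → HasDerivAt u (g y) y) {x : ℝ} (hx : x ∈ Icc (0 : ℝ) 1) :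
    u x = u 0 + ∫ y in (0 : ℝ)..x, g y := by
  have h01 : uIcc (0 : ℝ) 1 = Icc 0 1 := uIcc_of_le zero_le_one
  -- The difference of `u` and the integral of `g` is absolutely continuous with derivative zero
  -- almost everywhere, hence constant.
  obtain ⟨C, hC⟩ := (hu.sub (absolutelyContinuousOnInterval_integral hg)).const_of_ae_hasDerivAt_zero
    (by
      filter_upwards [hd, hg.ae_hasDerivAt_integral] with y h1 h2 hy
      have := (h1 (h01 ▸ hy)).sub (h2 hy 0 left_mem_uIcc)
      rwa [sub_self] at this)
  have h0 := hC 0 left_mem_uIcc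
  have hx' := hC x (h01 ▸ hx)
  simp only [Pi.sub_apply, intervalIntegral.integral_same, sub_zero] at h0 hx'
  rw [h0, ← hx']
  ring

end AbsolutelyContinuous

/-! ### Primitives of square integrable functions -/

section Primitive

/-- Lebesgue measure on the unit interval. -/
noncomputable abbrev unitMeasure : Measure ℝ := volume.restrict (Ioc 0 1)

/-- The space of square integrable functions on the unit interval. -/
abbrev UnitL2 : Type := Lp ℂ 2 unitMeasure

instance isProbabilityMeasure_unitMeasure : IsProbabilityMeasure unitMeasure :=
  ⟨by simp [unitMeasure]⟩

theorem ae_unitMeasure_iff {p : ℝ → Prop} :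
    (∀ᵐ y ∂unitMeasure, p y) ↔ ∀ᵐ y : ℝ, y ∈ Icc (0 : ℝ) 1 → p y := by
  rw [unitMeasure, Measure.restrict_congr_set Ioc_ae_eq_Icc, ae_restrict_iff' measurableSet_Icc]

/-- The indicator of the interval `(x, y]` as a square integrable function. -/
noncomputable def indicatorIoc (x y : ℝ) : UnitL2 :=
  indicatorConstLp 2 (measurableSet_Ioc : MeasurableSet (Ioc x y)) (measure_ne_top _ _) 1

/-- The primitive vanishing at `0` of a square integrable function. -/
noncomputable def primitive (g : UnitL2) (x : ℝ) : ℂ := ⟪indicatorIoc 0 x, g⟫_ℂ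

/-- Writing integrals as inner products makes primitives pointwise linear in `g` and puts their
estimates under Cauchy-Schwarz. -/
theorem inner_indicatorIoc {x y : ℝ} (hx : 0 ≤ x) (hxy : x ≤ y) (hy : y ≤ 1) (g : UnitL2) :
    ⟪indicatorIoc x y, g⟫_ℂ = ∫ t in x..y, g t := by
  rw [indicatorIoc, L2.inner_indicatorConstLp_one, Measure.restrict_restrict measurableSet_Ioc,
    inter_eq_left.2 (Ioc_subset_Ioc hx hy), intervalIntegral.integral_of_le hxy]

theorem primitive_eq_integral (g : UnitL2) {x : ℝ} (hx : x ∈ Icc (0 : ℝ) 1) :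
    primitive g x = ∫ t in (0 : ℝ)..x, g t :=
  inner_indicatorIoc le_rfl hx.1 hx.2 g

theorem intervalIntegrable_unitL2 (g : UnitL2) : IntervalIntegrable g volume 0 1 := by
  rw [intervalIntegrable_iff_integrableOn_Ioc_of_le zero_le_one]
  exact (Lp.memLp g).integrable (by norm_num)

theorem primitive_zero (g : UnitL2) : primitive g 0 = 0 := by
  rw [primitive_eq_integral g (left_mem_Icc.2 zero_le_one), intervalIntegral.integral_same]

theorem absolutelyContinuous_primitive (g : UnitL2) :
    AbsolutelyContinuousOnInterval (primitive g) 0 1 :=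
  (absolutelyContinuousOnInterval_integral (intervalIntegrable_unitL2 g)).congr_on fun x hx =>
    (primitive_eq_integral g (by rwa [uIcc_of_le zero_le_one] at hx)).symm

theorem ae_mem_Ioo : ∀ᵐ y : ℝ, y ∈ Icc (0 : ℝ) 1 → y ∈ Ioo (0 : ℝ) 1 := by
  have h := (Ioo_ae_eq_Icc (a := (0 : ℝ)) (b := 1) (μ := volume)).mem_iff
  filter_upwards [h] with y hy using hy.2

theorem ae_hasDerivAt_primitive (g : UnitL2) :
    ∀ᵐ y : ℝ, y ∈ Icc (0 : ℝ) 1 → HasDerivAt (primitive g) (g y) y := by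
  filter_upwards [(intervalIntegrable_unitL2 g).ae_hasDerivAt_integral, ae_mem_Ioo]
    with y h1 h2 hy
  rw [uIcc_of_le zero_le_one] at h1
  refine (h1 hy 0 (left_mem_Icc.2 zero_le_one)).congr_of_eventuallyEq ?_
  filter_upwards [Ioo_mem_nhds (h2 hy).1 (h2 hy).2] with x hx
  exact primitive_eq_integral g (Ioo_subset_Icc_self hx)

theorem norm_indicatorIoc_le {x y : ℝ} (hxy : x ≤ y) : ‖indicatorIoc x y‖ ≤ Real.sqrt (y - x) := by
  refine norm_indicatorConstLp_le.trans ?_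
  rw [norm_one, one_mul, Real.sqrt_eq_rpow]
  rw [ENNReal.toReal_ofNat]
  refine Real.rpow_le_rpow measureReal_nonneg ?_ (by norm_num)
  have : unitMeasure.real (Ioc x y) ≤ volume.real (Ioc x y) :=
    ENNReal.toReal_mono (by simp) (Measure.restrict_apply_le _ _)
  refine this.trans ?_
  rw [Real.volume_real_Ioc_of_le hxy]

theorem primitive_sub_primitive (g : UnitL2) {x y : ℝ} (hx : 0 ≤ x) (hxy : x ≤ y) (hy : y ≤ 1) :
    primitive g y - primitive g x = ⟪indicatorIoc x y, g⟫_ℂ := by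
  have hg := intervalIntegrable_unitL2 g
  have hsub : ∀ z, z ∈ Icc (0 : ℝ) 1 → IntervalIntegrable g volume 0 z := fun z hz =>
    hg.mono_set (uIcc_subset_uIcc_left (by rwa [uIcc_of_le zero_le_one]))
  rw [inner_indicatorIoc hx hxy hy, primitive_eq_integral g ⟨hx.trans hxy, hy⟩,
    primitive_eq_integral g ⟨hx, hxy.trans hy⟩, intervalIntegral.integral_interval_sub_left
      (hsub _ ⟨hx.trans hxy, hy⟩) (hsub _ ⟨hx, hxy.trans hy⟩)]

/-- Cauchy-Schwarz: primitives are Hölder continuous of order `1/2`, uniformly on bounded sets.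
Compactness of the Volterra operator comes from this. -/
theorem norm_primitive_sub_le (g : UnitL2) {x y : ℝ} (hx : 0 ≤ x) (hxy : x ≤ y) (hy : y ≤ 1) :
    ‖primitive g y - primitive g x‖ ≤ Real.sqrt (y - x) * ‖g‖ := by
  rw [primitive_sub_primitive g hx hxy hy]
  exact (norm_inner_le_norm _ _).trans
    (mul_le_mul_of_nonneg_right (norm_indicatorIoc_le hxy) (norm_nonneg _))

theorem norm_primitive_le (g : UnitL2) {x : ℝ} (hx : x ∈ Icc (0 : ℝ) 1) :
    ‖primitive g x‖ ≤ ‖g‖ := by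
  have := norm_primitive_sub_le g le_rfl hx.1 hx.2
  rw [primitive_zero, sub_zero, sub_zero] at this
  refine this.trans (mul_le_of_le_one_left (norm_nonneg _) ?_)
  exact Real.sqrt_le_one.2 hx.2

theorem aestronglyMeasurable_of_continuousOn {u : ℝ → ℂ} (hu : ContinuousOn u (Icc 0 1)) :
    AEStronglyMeasurable u unitMeasure :=
  (hu.mono Ioc_subset_Icc_self).aestronglyMeasurable measurableSet_Ioc

theorem memLp_of_continuousOn {u : ℝ → ℂ} (hu : ContinuousOn u (Icc 0 1)) :
    MemLp u 2 unitMeasure := by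
  obtain ⟨C, hC⟩ := isCompact_Icc.exists_bound_of_continuousOn hu
  refine MemLp.of_bound (aestronglyMeasurable_of_continuousOn hu) C ?_
  exact (ae_restrict_iff' measurableSet_Ioc).2 (Eventually.of_forall fun x hx =>
    hC x (Ioc_subset_Icc_self hx))

theorem continuousOn_primitive (g : UnitL2) : ContinuousOn (primitive g) (Icc 0 1) := by
  have := (absolutelyContinuous_primitive g).continuousOn
  rwa [uIcc_of_le zero_le_one] at this

theorem memLp_primitive (g : UnitL2) : MemLp (primitive g) 2 unitMeasure :=
  memLp_of_continuousOn (continuousOn_primitive g)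

theorem norm_le_of_ae_bound {g : UnitL2} {C : ℝ} (hC : 0 ≤ C)
    (h : ∀ᵐ y ∂unitMeasure, ‖g y‖ ≤ C) : ‖g‖ ≤ C := by
  have := Lp.norm_le_of_ae_bound hC h
  simpa [measureUnivNNReal] using this

/-- The Volterra operator `g ↦ ∫₀ˣ g`. -/
noncomputable def volterra : UnitL2 →L[ℂ] UnitL2 :=
  LinearMap.mkContinuous
    { toFun := fun g => (memLp_primitive g).toLp
      map_add' := fun f g => by
        rw [← MemLp.toLp_add]
        congr 1
        funext x
        simp [primitive, inner_add_right]
      map_smul' := fun c g => by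
        rw [RingHom.id_apply, ← MemLp.toLp_const_smul]
        congr 1
        funext x
        simp [primitive, inner_smul_right] } 1 fun g => by
    rw [one_mul]
    refine norm_le_of_ae_bound (norm_nonneg _) ?_
    filter_upwards [(memLp_primitive g).coeFn_toLp, ae_restrict_mem measurableSet_Ioc] with y hy hy'
    change ‖((memLp_primitive g).toLp : UnitL2) y‖ ≤ _
    rw [hy]
    exact norm_primitive_le g (Ioc_subset_Icc_self hy')

theorem volterra_ae (g : UnitL2) : volterra g =ᵐ[unitMeasure] primitive g :=
  (memLp_primitive g).coeFn_toLp

/-- The constant function `1`. -/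
noncomputable def unitOne : UnitL2 := indicatorIoc 0 1

theorem unitOne_ae : (unitOne : ℝ → ℂ) =ᵐ[unitMeasure] fun _ => 1 := by
  have : (unitOne : ℝ → ℂ) =ᵐ[unitMeasure] (Ioc 0 1).indicator fun _ => 1 :=
    indicatorConstLp_coeFn (hs := measurableSet_Ioc) (hμs := measure_ne_top _ _)
  filter_upwards [this, ae_restrict_mem measurableSet_Ioc] with y hy hy'
  rw [hy, indicator_of_mem hy']

theorem inner_unitOne (g : UnitL2) : ⟪unitOne, g⟫_ℂ = primitive g 1 := rfl

theorem inner_unitOne_self : ⟪unitOne, unitOne⟫_ℂ = 1 := by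
  rw [L2.inner_def, integral_congr_ae (g := fun _ => (1 : ℂ))]
  · simp
  · filter_upwards [unitOne_ae] with y hy
    rw [hy]
    simp

theorem norm_unitOne : ‖unitOne‖ = 1 := by
  have h := inner_self_eq_norm_sq (𝕜 := ℂ) unitOne
  rw [inner_unitOne_self, RCLike.one_re] at h
  exact (pow_eq_one_iff_of_nonneg (norm_nonneg _) two_ne_zero).1 h.symm

theorem isCompactOperator_rankOne (x y : UnitL2) :
    IsCompactOperator (InnerProductSpace.rankOne ℂ x y) := by
  rw [InnerProductSpace.rankOne_def']
  exact (isCompactOperator_of_locallyCompactSpace_dom (innerSL ℂ y)).clm_comp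
    (ContinuousLinearMap.toSpanSingleton ℂ x)

/-- A square integrable function all of whose primitives are constant vanishes. -/
theorem eq_zero_of_primitive_eq {g : UnitL2} {c : ℂ}
    (h : ∀ᵐ y : ℝ, y ∈ Icc (0 : ℝ) 1 → primitive g y = c) : g = 0 := by
  have hcont := continuousOn_primitive g
  -- Continuity upgrades the almost everywhere identity to an identity on the open interval, which
  -- can be differentiated.
  have heq : ∀ y ∈ Ioo (0 : ℝ) 1, primitive g y = c := by
    have h1 : (primitive g) =ᵐ[volume.restrict (Ioo (0 : ℝ) 1)] fun _ => c := by
      rw [Filter.EventuallyEq, ae_restrict_iff' measurableSet_Ioo]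
      filter_upwards [h] with y hy hy' using hy (Ioo_subset_Icc_self hy')
    exact Measure.eqOn_open_of_ae_eq h1 isOpen_Ioo (hcont.mono Ioo_subset_Icc_self)
      continuousOn_const
  rw [Lp.eq_zero_iff_ae_eq_zero]
  refine ae_unitMeasure_iff.2 ?_
  filter_upwards [ae_hasDerivAt_primitive g, ae_mem_Ioo] with y h1 h2 hy
  refine (h1 hy).unique ((hasDerivAt_const y c).congr_of_eventuallyEq ?_)
  filter_upwards [Ioo_mem_nhds (h2 hy).1 (h2 hy).2] with x hx using heq x hx

end Primitive

/-! ### Compactness and adjoint of the Volterra operator -/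

section Volterra

/-- The Volterra operator with the primitive replaced by its values on a grid of step `1/N`. -/
noncomputable def volterraStep (N : ℕ) : UnitL2 →L[ℂ] UnitL2 :=
  ∑ i ∈ Finset.range N, InnerProductSpace.rankOne ℂ
    (indicatorIoc ((i : ℝ) / N) (((i + 1 : ℕ) : ℝ) / N)) (indicatorIoc 0 ((i : ℝ) / N))

theorem volterraStep_ae (N : ℕ) (g : UnitL2) : ∀ᵐ y ∂unitMeasure, ∀ i < N,
    y ∈ Ioc ((i : ℝ) / N) (((i + 1 : ℕ) : ℝ) / N) →
      volterraStep N g y = primitive g ((i : ℝ) / N) := by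
  have happ : volterraStep N g = ∑ i ∈ Finset.range N, primitive g ((i : ℝ) / N) •
      indicatorIoc ((i : ℝ) / N) (((i + 1 : ℕ) : ℝ) / N) := by
    rw [volterraStep, sum_apply]
    rfl
  have hind : ∀ᵐ y ∂unitMeasure, ∀ i : ℕ,
      (primitive g ((i : ℝ) / N) • indicatorIoc ((i : ℝ) / N) (((i + 1 : ℕ) : ℝ) / N) : UnitL2) y
        = primitive g ((i : ℝ) / N) *
          (Ioc ((i : ℝ) / N) (((i + 1 : ℕ) : ℝ) / N)).indicator (fun _ => 1) y := by
    rw [ae_all_iff]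
    intro i
    filter_upwards [Lp.coeFn_smul (primitive g ((i : ℝ) / N))
      (indicatorIoc ((i : ℝ) / N) (((i + 1 : ℕ) : ℝ) / N)),
      indicatorConstLp_coeFn (p := 2) (μ := unitMeasure) (c := (1 : ℂ))
        (hs := (measurableSet_Ioc : MeasurableSet (Ioc ((i : ℝ) / N) (((i + 1 : ℕ) : ℝ) / N))))
        (hμs := measure_ne_top _ _)] with y h1 h2
    rw [h1, Pi.smul_apply, smul_eq_mul, indicatorIoc, h2]
  rw [happ]
  filter_upwards [hind, Lp.coeFn_finsetSum (Finset.range N) fun i : ℕ =>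
    (primitive g ((i : ℝ) / N) • indicatorIoc ((i : ℝ) / N) (((i + 1 : ℕ) : ℝ) / N) : UnitL2)]
    with y h1 h2 i hi hy
  rw [h2, Finset.sum_apply, Finset.sum_eq_single i]
  · rw [h1, indicator_of_mem hy, mul_one]
  · intro j _ hj
    rw [h1, indicator_of_notMem, mul_zero]
    intro hyj
    have hN : (0 : ℝ) < N := by exact_mod_cast (Nat.zero_le i).trans_lt hi
    have h3 := hy.1.trans_le hyj.2
    have h4 := hyj.1.trans_le hy.2
    rw [div_lt_div_iff_of_pos_right hN] at h3 h4
    have h5 : i < j + 1 := by exact_mod_cast h3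
    have h6 : j < i + 1 := by exact_mod_cast h4
    omega
  · intro h; exact absurd (Finset.mem_range.2 hi) h

theorem norm_volterra_sub_step_le {N : ℕ} (hN : 0 < N) :
    ‖volterraStep N - volterra‖ ≤ Real.sqrt (1 / N) := by
  have hN' : (0 : ℝ) < N := by exact_mod_cast hN
  refine ContinuousLinearMap.opNorm_le_bound _ (Real.sqrt_nonneg _) fun g => ?_
  refine norm_le_of_ae_bound (by positivity) ?_
  filter_upwards [volterraStep_ae N g, volterra_ae g, ae_restrict_mem measurableSet_Ioc,
    Lp.coeFn_sub (volterraStep N g) (volterra g)] with y h1 h2 hy h3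
  rw [sub_apply, h3, Pi.sub_apply, h2]
  -- The cells `(i/N, (i+1)/N]` are closed on the right, so the cell of `y` has `i + 1 = ⌈y N⌉`.
  obtain ⟨i, hi⟩ : ∃ i : ℕ, ⌈y * N⌉₊ = i + 1 :=
    Nat.exists_eq_succ_of_ne_zero (Nat.ceil_pos.2 (mul_pos hy.1 hN')).ne'
  have hle : y * N ≤ ((i + 1 : ℕ) : ℝ) := hi ▸ Nat.le_ceil _
  have hlt : (i : ℝ) < y * N := by
    have := Nat.ceil_lt_add_one (mul_pos hy.1 hN').le
    rw [hi] at this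
    push_cast at this
    linarith
  have hiN : i < N := by
    have : (i : ℝ) < N := hlt.trans_le (mul_le_of_le_one_left hN'.le hy.2)
    exact_mod_cast this
  have h4 : (i : ℝ) / N < y := (div_lt_iff₀ hN').2 hlt
  rw [h1 i hiN ⟨h4, (le_div_iff₀ hN').2 hle⟩, norm_sub_rev]
  refine (norm_primitive_sub_le g (by positivity) h4.le hy.2).trans ?_
  gcongr
  push_cast at hle
  rw [le_div_iff₀ hN', sub_mul, div_mul_cancel₀ _ hN'.ne']
  linarith

/-- A norm limit of the finite rank operators `volterraStep N` is compact. -/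
theorem isCompactOperator_volterra : IsCompactOperator volterra := by
  have hlim : Tendsto volterraStep atTop (𝓝 volterra) := by
    rw [tendsto_iff_norm_sub_tendsto_zero]
    refine squeeze_zero' (Eventually.of_forall fun _ => norm_nonneg _) (g := fun N : ℕ =>
      Real.sqrt (1 / N)) ?_ ?_
    · filter_upwards [eventually_gt_atTop 0] with N hN using norm_volterra_sub_step_le hN
    · have := (Real.continuous_sqrt.tendsto 0).comp (tendsto_one_div_atTop_nhds_zero_nat (𝕜 := ℝ))
      rwa [Real.sqrt_zero] at this
  refine isCompactOperator_of_tendsto hlim (Eventually.of_forall fun N => ?_)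
  exact (compactOperator (RingHom.id ℂ) UnitL2 UnitL2).sum_mem fun i _ =>
    isCompactOperator_rankOne _ _

/-- Integration by parts on the unit interval. -/
theorem inner_volterra_add (f g : UnitL2) :
    ⟪volterra f, g⟫_ℂ + ⟪f, volterra g⟫_ℂ = ⟪f, unitOne⟫_ℂ * ⟪unitOne, g⟫_ℂ := by
  have hfi : IntervalIntegrable (fun y => starRingEnd ℂ (f y)) volume 0 1 := by
    have := intervalIntegrable_unitL2 f
    have hL := Complex.conjCLE.toContinuousLinearMap.integrable_comp this.1
    have hR := Complex.conjCLE.toContinuousLinearMap.integrable_comp this.2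
    exact ⟨hL, hR⟩
  have hconj : ∀ x ∈ Icc (0 : ℝ) 1, starRingEnd ℂ (primitive f x)
      = ∫ y in (0 : ℝ)..x, starRingEnd ℂ (f y) := by
    intro x hx
    rw [primitive_eq_integral f hx, intervalIntegral.integral_of_le hx.1,
      intervalIntegral.integral_of_le hx.1, integral_conj]
  have hac : AbsolutelyContinuousOnInterval (fun x => starRingEnd ℂ (primitive f x)) 0 1 :=
    (absolutelyContinuousOnInterval_integral hfi).congr_on fun x hx =>
      (hconj x (by rwa [uIcc_of_le zero_le_one] at hx)).symm
  have hprod := hac.smul (absolutelyContinuous_primitive g)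
  have hcf : ContinuousOn (fun x => starRingEnd ℂ (primitive f x)) (uIcc 0 1) := hac.continuousOn
  have hcg := (absolutelyContinuous_primitive g).continuousOn
  have hi1 : IntervalIntegrable (fun y => starRingEnd ℂ (f y) * primitive g y) volume 0 1 :=
    hfi.mul_continuousOn hcg
  have hi2 : IntervalIntegrable (fun y => starRingEnd ℂ (primitive f y) * g y) volume 0 1 :=
    (intervalIntegrable_unitL2 g).continuousOn_mul hcf
  -- Both primitives vanish at `0`, so the fundamental theorem for their product at `1` has only one
  -- boundary term.
  have hftc := hprod.eq_add_integral (hi1.add hi2) (by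
    filter_upwards [ae_hasDerivAt_primitive f, ae_hasDerivAt_primitive g] with y h1 h2 hy
    exact (h1 hy).star.mul (h2 hy)) (right_mem_Icc.2 zero_le_one)
  have e1 : ⟪volterra f, g⟫_ℂ = ∫ y in (0 : ℝ)..1, starRingEnd ℂ (primitive f y) * g y := by
    rw [L2.inner_def, intervalIntegral.integral_of_le zero_le_one]
    refine integral_congr_ae ?_
    filter_upwards [volterra_ae f] with y hy
    rw [hy, RCLike.inner_apply, mul_comm]
  have e2 : ⟪f, volterra g⟫_ℂ = ∫ y in (0 : ℝ)..1, starRingEnd ℂ (f y) * primitive g y := by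
    rw [L2.inner_def, intervalIntegral.integral_of_le zero_le_one]
    refine integral_congr_ae ?_
    filter_upwards [volterra_ae g] with y hy
    rw [hy, RCLike.inner_apply, mul_comm]
  rw [e1, e2, add_comm, ← intervalIntegral.integral_add hi1 hi2, ← inner_conj_symm f unitOne, inner_unitOne,
    inner_unitOne]
  simp only [Pi.smul_apply', smul_eq_mul, primitive_zero, mul_zero, zero_add] at hftc
  exact hftc.symm

/-- Integration by parts: the adjoint integrates from `x` to `1`, that is, total integral minus
primitive. -/
theorem adjoint_volterra : ContinuousLinearMap.adjoint volterra
    = InnerProductSpace.rankOne ℂ unitOne unitOne - volterra := by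
  refine (ContinuousLinearMap.eq_adjoint_iff _ _).2 (fun f g => ?_) |>.symm
  have := inner_volterra_add f g
  rw [sub_apply, inner_sub_left, InnerProductSpace.rankOne_apply, inner_smul_left,
    inner_conj_symm]
  linear_combination -this

end Volterra

/-! ### Multiplication operators -/

section Multiplication

/-- Multiplication by a bounded real function. -/
noncomputable def mulOp (f : ℝ → ℝ) (hf : MemLp (fun y => (f y : ℂ)) ⊤ unitMeasure) :
    UnitL2 →L[ℂ] UnitL2 :=
  (ContinuousLinearMap.mul ℂ ℂ).holderL unitMeasure ⊤ 2 2 hf.toLp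

variable {f : ℝ → ℝ}

theorem mulOp_ae (hf : MemLp (fun y => (f y : ℂ)) ⊤ unitMeasure)
    (g : UnitL2) : mulOp f hf g =ᵐ[unitMeasure] fun y => (f y : ℂ) * g y := by
  have h1 := (ContinuousLinearMap.mul ℂ ℂ).coeFn_holder (r := 2) hf.toLp g
  filter_upwards [h1, hf.coeFn_toLp] with y h1 h2
  change ((ContinuousLinearMap.mul ℂ ℂ).holder 2 hf.toLp g : UnitL2) y = _
  rw [h1, h2]
  rfl

theorem inner_mulOp (hf : MemLp (fun y => (f y : ℂ)) ⊤ unitMeasure)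
    (g h : UnitL2) : ⟪mulOp f hf g, h⟫_ℂ = ⟪g, mulOp f hf h⟫_ℂ := by
  rw [L2.inner_def, L2.inner_def]
  refine integral_congr_ae ?_
  filter_upwards [mulOp_ae hf g, mulOp_ae hf h] with y h1 h2
  rw [h1, h2, RCLike.inner_apply, RCLike.inner_apply, map_mul, Complex.conj_ofReal]
  ring

theorem integrable_mul_norm_sq (hf : MemLp (fun y => (f y : ℂ)) ⊤ unitMeasure)
    (g : UnitL2) :
    Integrable (fun y => f y * ‖g y‖ ^ 2) unitMeasure := by
  refine (L2.integrable_inner (𝕜 := ℂ) g (mulOp f hf g)).re.congr ?_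
  filter_upwards [mulOp_ae hf g] with y h1
  rw [h1, RCLike.inner_apply, mul_assoc, Complex.mul_conj, Complex.normSq_eq_norm_sq]
  norm_cast

theorem re_inner_mulOp (hf : MemLp (fun y => (f y : ℂ)) ⊤ unitMeasure)
    (g : UnitL2) :
    (⟪mulOp f hf g, g⟫_ℂ).re = ∫ y, f y * ‖g y‖ ^ 2 ∂unitMeasure := by
  rw [inner_mulOp, L2.inner_def]
  refine (integral_re (L2.integrable_inner (𝕜 := ℂ) g (mulOp f hf g))).symm.trans
    (integral_congr_ae ?_)
  filter_upwards [mulOp_ae hf g] with y h1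
  rw [h1, RCLike.inner_apply, mul_assoc, Complex.mul_conj, Complex.normSq_eq_norm_sq]
  norm_cast

theorem norm_sq_eq_integral (g : UnitL2) : ‖g‖ ^ 2 = ∫ y, ‖g y‖ ^ 2 ∂unitMeasure := by
  have h := inner_self_eq_norm_sq (𝕜 := ℂ) g
  rw [← h, L2.inner_def, ← integral_re (L2.integrable_inner (𝕜 := ℂ) g g)]
  refine integral_congr_ae (Eventually.of_forall fun y => ?_)
  exact inner_self_eq_norm_sq (𝕜 := ℂ) (g y)

theorem mul_norm_sq_le_re_inner_mulOp (hf : MemLp (fun y => (f y : ℂ)) ⊤ unitMeasure)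
    {c : ℝ} (hc : ∀ y, c ≤ f y) (g : UnitL2) :
    c * ‖g‖ ^ 2 ≤ (⟪mulOp f hf g, g⟫_ℂ).re := by
  rw [re_inner_mulOp, norm_sq_eq_integral, ← integral_const_mul]
  refine integral_mono_ae ?_ (integrable_mul_norm_sq hf g) (Eventually.of_forall fun y => ?_)
  · exact ((memLp_two_iff_integrable_sq_norm (Lp.aestronglyMeasurable g)).1 (Lp.memLp g)).const_mul c
  · exact mul_le_mul_of_nonneg_right (hc y) (by positivity)

end Multiplication

/-! ### The quadratic forms of the Floquet problem on `L²` -/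

section FloquetOperators

/-- The rank one projection `g ↦ ∫ g` onto the constants. -/
noncomputable abbrev meanOp : UnitL2 →L[ℂ] UnitL2 := InnerProductSpace.rankOne ℂ unitOne unitOne

/-- Quasi-periodic functions `u` with Floquet factor `α + 2` are parametrized by `g = u' - α u(0)`;
`slopeOp α g` is the derivative of the function with parameter `g`. -/
noncomputable def slopeOp (α : ℂ) : UnitL2 →L[ℂ] UnitL2 := 1 + α • meanOp

/-- The quasi-periodic function with parameter `g`. -/
noncomputable def valueOp (α : ℂ) : UnitL2 →L[ℂ] UnitL2 := meanOp + volterra ∘L slopeOp α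

/-- The operator of the form `∫ f |T g|²`. -/
noncomputable def formOp (T : UnitL2 →L[ℂ] UnitL2) (f : ℝ → ℝ)
    (hf : MemLp (fun y => (f y : ℂ)) ⊤ unitMeasure) : UnitL2 →L[ℂ] UnitL2 :=
  ContinuousLinearMap.adjoint T ∘L mulOp f hf ∘L T

theorem meanOp_apply (g : UnitL2) : meanOp g = ⟪unitOne, g⟫_ℂ • unitOne := rfl

theorem slopeOp_apply (α : ℂ) (g : UnitL2) :
    slopeOp α g = g + (α * ⟪unitOne, g⟫_ℂ) • unitOne := by
  simp [slopeOp, mul_smul]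

theorem valueOp_apply (α : ℂ) (g : UnitL2) :
    valueOp α g = ⟪unitOne, g⟫_ℂ • unitOne + volterra (slopeOp α g) := rfl

/-- The integral of `u'` is `(1 + α) u(0)`, so `u(1) = (α + 2) u(0)` holds automatically for every
parameter `g`. -/
theorem inner_unitOne_slopeOp (α : ℂ) (g : UnitL2) :
    ⟪unitOne, slopeOp α g⟫_ℂ = (1 + α) * ⟪unitOne, g⟫_ℂ := by
  rw [slopeOp_apply, inner_add_right, inner_smul_right, inner_unitOne_self]
  ring

theorem inner_formOp (T : UnitL2 →L[ℂ] UnitL2) {f : ℝ → ℝ}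
    (hf : MemLp (fun y => (f y : ℂ)) ⊤ unitMeasure) (g h : UnitL2) :
    ⟪formOp T f hf g, h⟫_ℂ = ⟪mulOp f hf (T g), T h⟫_ℂ :=
  ContinuousLinearMap.adjoint_inner_left T _ _

theorem isSymmetric_formOp (T : UnitL2 →L[ℂ] UnitL2) {f : ℝ → ℝ}
    (hf : MemLp (fun y => (f y : ℂ)) ⊤ unitMeasure) :
    (formOp T f hf : UnitL2 →ₗ[ℂ] UnitL2).IsSymmetric := by
  intro g h
  change ⟪formOp T f hf g, h⟫_ℂ = ⟪g, formOp T f hf h⟫_ℂ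
  rw [inner_formOp, inner_mulOp, ← inner_conj_symm, ← inner_formOp, inner_conj_symm]

theorem le_re_inner_formOp (T : UnitL2 →L[ℂ] UnitL2) {f : ℝ → ℝ}
    (hf : MemLp (fun y => (f y : ℂ)) ⊤ unitMeasure) {c : ℝ} (hc : ∀ y, c ≤ f y) (g : UnitL2) :
    c * ‖T g‖ ^ 2 ≤ (⟪formOp T f hf g, g⟫_ℂ).re := by
  rw [inner_formOp]
  exact mul_norm_sq_le_re_inner_mulOp hf hc _

theorem isCompactOperator_valueOp (α : ℂ) : IsCompactOperator (valueOp α) :=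
  (isCompactOperator_rankOne unitOne unitOne).add (isCompactOperator_volterra.comp_clm (slopeOp α))

theorem volterra_eq_smul_unitOne {g : UnitL2} {c : ℂ} (h : volterra g = c • unitOne) : g = 0 := by
  refine eq_zero_of_primitive_eq (c := c) (ae_unitMeasure_iff.1 ?_)
  filter_upwards [volterra_ae g, Lp.coeFn_smul c unitOne, unitOne_ae] with y h1 h2 h3
  rw [← h1, h, h2, Pi.smul_apply, h3, smul_eq_mul, mul_one]

theorem unitOne_ne_zero : unitOne ≠ 0 := by
  rw [← norm_ne_zero_iff, norm_unitOne]
  exact one_ne_zero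

/-- If `u` vanishes, its derivative and then its initial value vanish, and these two determine `g`.
-/
theorem eq_zero_of_valueOp_eq_zero {α : ℂ} {g : UnitL2} (h : valueOp α g = 0) : g = 0 := by
  have h1 : volterra (slopeOp α g) = (-⟪unitOne, g⟫_ℂ) • unitOne := by
    rw [valueOp_apply, add_comm] at h
    rw [neg_smul]
    exact eq_neg_of_add_eq_zero_left h
  have h2 := volterra_eq_smul_unitOne h1
  rw [h2, map_zero, eq_comm, smul_eq_zero, neg_eq_zero] at h1
  have h3 := h1.resolve_right unitOne_ne_zero
  rw [slopeOp_apply, h3, mul_zero, zero_smul, add_zero] at h2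
  exact h2

theorem eq_smul_of_slopeOp_eq_zero {α : ℂ} {g : UnitL2} (h : slopeOp α g = 0) :
    g = (-(α * ⟪unitOne, g⟫_ℂ)) • unitOne := by
  rw [slopeOp_apply] at h
  rw [neg_smul]
  exact eq_neg_of_add_eq_zero_left h

/-- The parameter is recovered boundedly from `u'` and `u`: `u(0) = u - ∫₀ˣ u'` and `g = u' - α
u(0)`. -/
theorem exists_norm_le_slopeOp_add_valueOp (α : ℂ) : ∃ M : ℝ, 0 < M ∧ ∀ g : UnitL2,
    ‖g‖ ≤ M * (‖slopeOp α g‖ + ‖valueOp α g‖) := by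
  refine ⟨1 + ‖α‖ * (1 + ‖volterra‖), by positivity, fun g => ?_⟩
  have h1 : meanOp g = valueOp α g - volterra (slopeOp α g) := by
    rw [valueOp_apply, meanOp_apply, add_sub_cancel_right]
  have h2 : g = slopeOp α g - α • meanOp g := by
    rw [slopeOp_apply, meanOp_apply, mul_smul, add_sub_cancel_right]
  have h3 : ‖meanOp g‖ ≤ ‖valueOp α g‖ + ‖volterra‖ * ‖slopeOp α g‖ := by
    rw [h1]
    exact (norm_sub_le _ _).trans (add_le_add_right (volterra.le_opNorm _) _)
  have h4 : ‖g‖ ≤ ‖slopeOp α g‖ + ‖α‖ * ‖meanOp g‖ := by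
    calc ‖g‖ = ‖slopeOp α g - α • meanOp g‖ := by rw [← h2]
      _ ≤ _ := (norm_sub_le _ _).trans (by rw [norm_smul])
  have h5 := mul_le_mul_of_nonneg_left h3 (norm_nonneg α)
  have p1 := mul_nonneg (norm_nonneg α) (norm_nonneg (slopeOp α g))
  have p2 := mul_nonneg (mul_nonneg (norm_nonneg α) (norm_nonneg volterra))
    (norm_nonneg (valueOp α g))
  have p3 := norm_nonneg (valueOp α g)
  nlinarith

theorem isPencilFamily_formOp (α : ℂ) {μ₁ μ₂ ρ : ℝ → ℝ}
    (m₁ : MemLp (fun y => (μ₁ y : ℂ)) ⊤ unitMeasure)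
    (m₂ : MemLp (fun y => (μ₂ y : ℂ)) ⊤ unitMeasure)
    (mρ : MemLp (fun y => (ρ y : ℂ)) ⊤ unitMeasure) {c₁ c₃ : ℝ} (hc₁ : 0 < c₁) (hc₃ : 0 < c₃)
    (h₁ : ∀ y, c₁ ≤ μ₁ y) (h₂ : ∀ y, 0 ≤ μ₂ y) (h₃ : ∀ y, c₃ ≤ ρ y) :
    IsPencilFamily (formOp (slopeOp α) μ₁ m₁) (formOp (valueOp α) μ₂ m₂)
      (formOp (valueOp α) ρ mρ) where
  symm_D := isSymmetric_formOp _ _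
  symm_Q := isSymmetric_formOp _ _
  symm_B := isSymmetric_formOp _ _
  nonneg_D g := le_trans (by positivity) (le_re_inner_formOp _ m₁ h₁ g)
  nonneg_Q g := by
    have := le_re_inner_formOp (valueOp α) m₂ h₂ g
    rwa [zero_mul] at this
  pos_B g hg := by
    refine lt_of_lt_of_le ?_ (le_re_inner_formOp _ mρ h₃ g)
    have : 0 < ‖valueOp α g‖ := norm_pos_iff.2 fun h => hg (eq_zero_of_valueOp_eq_zero h)
    positivity
  compact_B := ((isCompactOperator_valueOp α).clm_comp (mulOp ρ mρ)).clm_comp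
    (ContinuousLinearMap.adjoint (valueOp α))
  coercive := by
    obtain ⟨M, hM, hle⟩ := exists_norm_le_slopeOp_add_valueOp α
    have hc : 0 < min c₁ c₃ := lt_min hc₁ hc₃
    -- The factor `2` comes from `(a + b)² ≤ 2 (a² + b²)`, the factor `M²` from squaring the bound
    -- on `‖g‖`.
    refine ⟨min c₁ c₃ / (2 * M ^ 2), by positivity, fun g => ?_⟩
    have h4 := le_re_inner_formOp (slopeOp α) m₁ h₁ g
    have h5 := le_re_inner_formOp (valueOp α) mρ h₃ g
    have h6 := mul_le_mul_of_nonneg_right (min_le_left c₁ c₃) (sq_nonneg ‖slopeOp α g‖)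
    have h7 := mul_le_mul_of_nonneg_right (min_le_right c₁ c₃) (sq_nonneg ‖valueOp α g‖)
    have h8 : ‖g‖ ^ 2 ≤ 2 * M ^ 2 * (‖slopeOp α g‖ ^ 2 + ‖valueOp α g‖ ^ 2) := by
      refine (pow_le_pow_left₀ (norm_nonneg g) (hle g) 2).trans ?_
      rw [mul_pow]
      have := add_sq_le (a := ‖slopeOp α g‖) (b := ‖valueOp α g‖)
      nlinarith [sq_nonneg M, mul_le_mul_of_nonneg_left this (sq_nonneg M)]
    calc _ ≤ min c₁ c₃ / (2 * M ^ 2) *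
          (2 * M ^ 2 * (‖slopeOp α g‖ ^ 2 + ‖valueOp α g‖ ^ 2)) := by gcongr
      _ = min c₁ c₃ * ‖slopeOp α g‖ ^ 2 + min c₁ c₃ * ‖valueOp α g‖ ^ 2 := by field_simp
      _ ≤ _ := by linarith

/-- The form of `D` vanishes only for `u' = 0`, and then `g = -α u(0)` is constant. -/
theorem finrank_ker_formOp_slopeOp_le (α : ℂ) {μ₁ : ℝ → ℝ}
    (m₁ : MemLp (fun y => (μ₁ y : ℂ)) ⊤ unitMeasure) {c₁ : ℝ} (hc₁ : 0 < c₁)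
    (h₁ : ∀ y, c₁ ≤ μ₁ y) :
    Module.finrank ℂ (LinearMap.ker (formOp (slopeOp α) μ₁ m₁ : UnitL2 →ₗ[ℂ] UnitL2)) ≤ 1 := by
  have hle : LinearMap.ker (formOp (slopeOp α) μ₁ m₁ : UnitL2 →ₗ[ℂ] UnitL2) ≤ ℂ ∙ unitOne := by
    intro g hg
    have hg' : formOp (slopeOp α) μ₁ m₁ g = 0 := hg
    have h2 := le_re_inner_formOp (slopeOp α) m₁ h₁ g
    rw [hg', inner_zero_left, Complex.zero_re] at h2
    have h3 : slopeOp α g = 0 := by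
      by_contra hne
      have : 0 < ‖slopeOp α g‖ := norm_pos_iff.2 hne
      have : 0 < c₁ * ‖slopeOp α g‖ ^ 2 := by positivity
      linarith
    rw [eq_smul_of_slopeOp_eq_zero h3]
    exact Submodule.smul_mem _ _ (Submodule.mem_span_singleton_self _)
  exact (Submodule.finrank_mono hle).trans (finrank_span_singleton unitOne_ne_zero).le

theorem adjoint_slopeOp_apply (α : ℂ) (g : UnitL2) : ContinuousLinearMap.adjoint (slopeOp α) g
    = g + (starRingEnd ℂ α * ⟪unitOne, g⟫_ℂ) • unitOne := by
  have h : ContinuousLinearMap.adjoint (slopeOp α) = 1 + starRingEnd ℂ α • meanOp := by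
    refine ((ContinuousLinearMap.eq_adjoint_iff _ _).2 fun x y => ?_).symm
    rw [slopeOp_apply]
    simp only [add_apply, one_apply_eq_self, smul_apply, meanOp_apply, inner_add_left,
      inner_add_right, inner_smul_left, inner_smul_right, Complex.conj_conj, inner_conj_symm]
    ring
  rw [h]
  simp [mul_smul]

theorem adjoint_valueOp_apply (α : ℂ) (w : UnitL2) : ContinuousLinearMap.adjoint (valueOp α) w
    = ⟪unitOne, w⟫_ℂ • unitOne + ContinuousLinearMap.adjoint (slopeOp α)
      (⟪unitOne, w⟫_ℂ • unitOne - volterra w) := by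
  rw [valueOp, map_add, InnerProductSpace.adjoint_rankOne, ContinuousLinearMap.adjoint_comp,
    adjoint_volterra]
  rfl

/-- The weak form of the equation `(z)' = w` with quasi-periodic `z`. -/
theorem adjoint_slopeOp_add_adjoint_valueOp_eq_zero_iff {K : ℝ} {α : ℂ}
    (hα : α + 2 = Complex.exp (Complex.I * K)) (z w : UnitL2) :
    ContinuousLinearMap.adjoint (slopeOp α) z + ContinuousLinearMap.adjoint (valueOp α) w = 0 ↔
      ∃ p₀ : ℂ, z = p₀ • unitOne + volterra w ∧
        p₀ + ⟪unitOne, w⟫_ℂ = Complex.exp (Complex.I * K) * p₀ := by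
  have hconj : starRingEnd ℂ α + 2 = Complex.exp (-(Complex.I * K)) := by
    have := congrArg (starRingEnd ℂ) hα
    rwa [map_add, ← Complex.exp_conj, map_mul, Complex.conj_I, Complex.conj_ofReal, neg_mul,
      map_ofNat] at this
  have hexp : Complex.exp (Complex.I * K) * Complex.exp (-(Complex.I * K)) = 1 := by
    rw [← Complex.exp_add, add_neg_cancel, Complex.exp_zero]
  set E := Complex.exp (Complex.I * K)
  set E' := Complex.exp (-(Complex.I * K))
  have hsum : ContinuousLinearMap.adjoint (slopeOp α) z
      + ContinuousLinearMap.adjoint (valueOp α) w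
      = ContinuousLinearMap.adjoint (slopeOp α) (z + (⟪unitOne, w⟫_ℂ • unitOne - volterra w))
        + ⟪unitOne, w⟫_ℂ • unitOne := by
    rw [adjoint_valueOp_apply, map_add]
    abel
  rw [hsum, adjoint_slopeOp_apply]
  -- The weak equation forces `v` to be a constant, which is the value of the flux at `1`;
  -- subtracting the integral of `w` gives its value `p₀` at `0`. The remaining scalar equation is
  -- the quasi-periodicity of the flux, since `e^{-iK}` is both the conjugate and the inverse of
  -- `e^{iK}`.
  set v := z + (⟪unitOne, w⟫_ℂ • unitOne - volterra w) with hv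
  constructor
  · intro h
    obtain ⟨ζ, hζ⟩ : ∃ ζ, ζ = -(starRingEnd ℂ α * ⟪unitOne, v⟫_ℂ + ⟪unitOne, w⟫_ℂ) := ⟨_, rfl⟩
    have hvζ : v = ζ • unitOne := by
      rw [hζ, neg_smul, add_smul]
      rw [add_assoc] at h
      exact eq_neg_of_add_eq_zero_left h
    have h1 : ⟪unitOne, v⟫_ℂ = ζ := by
      rw [hvζ, inner_smul_right, inner_unitOne_self, mul_one]
    rw [h1] at hζ
    refine ⟨ζ - ⟪unitOne, w⟫_ℂ, ?_, ?_⟩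
    · have : z = v - (⟪unitOne, w⟫_ℂ • unitOne - volterra w) := by rw [hv]; abel
      rw [this, hvζ, sub_smul]
      abel
    · linear_combination E * hζ - ζ * E * hconj - ζ * hexp
  · rintro ⟨p₀, hz, hp⟩
    have hvp : v = (p₀ + ⟪unitOne, w⟫_ℂ) • unitOne := by
      rw [hv, hz, add_smul]
      abel
    rw [hvp, inner_smul_right, inner_unitOne_self, mul_one, ← add_smul, ← add_smul, smul_eq_zero]
    left
    linear_combination (p₀ + ⟪unitOne, w⟫_ℂ) * hconj + E' * hp + p₀ * hexp

end FloquetOperators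

/-! ### Equivalence of the weak and the pointwise eigenvalue problem -/

section Representation

/-- The quasi-periodic function with parameter `g`, extended by zero to the line. -/
noncomputable def floquetFun (α : ℂ) : UnitL2 →ₗ[ℂ] (ℝ → ℂ) where
  toFun g := (Icc (0 : ℝ) 1).indicator fun x => ⟪unitOne, g⟫_ℂ + primitive (slopeOp α g) x
  map_add' f g := by
    rw [← indicator_add']
    congr 1
    funext x
    simp only [primitive, map_add, inner_add_right, Pi.add_apply]
    ring
  map_smul' c g := by
    funext x
    by_cases hx : x ∈ Icc (0 : ℝ) 1
    · rw [Pi.smul_apply, indicator_of_mem hx, indicator_of_mem hx]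
      simp only [primitive, map_smul, inner_smul_right, smul_eq_mul, mul_add, RingHom.id_apply]
    · rw [Pi.smul_apply, indicator_of_notMem hx, indicator_of_notMem hx, smul_zero]

theorem floquetFun_apply (α : ℂ) (g : UnitL2) {x : ℝ} (hx : x ∈ Icc (0 : ℝ) 1) :
    floquetFun α g x = ⟪unitOne, g⟫_ℂ + primitive (slopeOp α g) x := by
  change (Icc (0 : ℝ) 1).indicator (fun x => ⟪unitOne, g⟫_ℂ + primitive (slopeOp α g) x) x = _
  rw [indicator_of_mem hx]

theorem floquetFun_of_notMem (α : ℂ) (g : UnitL2) {x : ℝ} (hx : x ∉ Icc (0 : ℝ) 1) :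
    floquetFun α g x = 0 := by
  change (Icc (0 : ℝ) 1).indicator (fun x => ⟪unitOne, g⟫_ℂ + primitive (slopeOp α g) x) x = _
  rw [indicator_of_notMem hx]

theorem floquetFun_zero_apply (α : ℂ) (g : UnitL2) : floquetFun α g 0 = ⟪unitOne, g⟫_ℂ := by
  rw [floquetFun_apply α g (left_mem_Icc.2 zero_le_one), primitive_zero, add_zero]

theorem floquetFun_one_apply (α : ℂ) (g : UnitL2) :
    floquetFun α g 1 = (α + 2) * ⟪unitOne, g⟫_ℂ := by
  rw [floquetFun_apply α g (right_mem_Icc.2 zero_le_one), ← inner_unitOne, inner_unitOne_slopeOp]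
  ring

theorem AbsolutelyContinuousOnInterval.const_add_complex {u : ℝ → ℂ} {a b : ℝ} (c : ℂ)
    (hu : AbsolutelyContinuousOnInterval u a b) :
    AbsolutelyContinuousOnInterval (fun x => c + u x) a b := by
  refine Tendsto.congr (fun E => Finset.sum_congr rfl fun i _ => ?_) hu
  rw [dist_add_left]

theorem absolutelyContinuous_floquetFun (α : ℂ) (g : UnitL2) :
    AbsolutelyContinuousOnInterval (floquetFun α g) 0 1 :=
  ((absolutelyContinuous_primitive (slopeOp α g)).const_add_complex ⟪unitOne, g⟫_ℂ).congr_on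
    fun x hx => (floquetFun_apply α g (by rwa [uIcc_of_le zero_le_one] at hx)).symm

theorem ae_hasDerivAt_floquetFun (α : ℂ) (g : UnitL2) :
    ∀ᵐ y : ℝ, y ∈ Icc (0 : ℝ) 1 → HasDerivAt (floquetFun α g) (slopeOp α g y) y := by
  filter_upwards [ae_hasDerivAt_primitive (slopeOp α g), ae_mem_Ioo] with y h1 h2 hy
  refine ((h1 hy).const_add ⟪unitOne, g⟫_ℂ).congr_of_eventuallyEq ?_
  filter_upwards [Ioo_mem_nhds (h2 hy).1 (h2 hy).2] with x hx
  exact floquetFun_apply α g (Ioo_subset_Icc_self hx)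

theorem valueOp_ae (α : ℂ) (g : UnitL2) : valueOp α g =ᵐ[unitMeasure] floquetFun α g := by
  rw [valueOp_apply]
  filter_upwards [Lp.coeFn_add (⟪unitOne, g⟫_ℂ • unitOne) (volterra (slopeOp α g)),
    Lp.coeFn_smul ⟪unitOne, g⟫_ℂ unitOne, unitOne_ae, volterra_ae (slopeOp α g),
    ae_restrict_mem measurableSet_Ioc] with y h1 h2 h3 h4 hy
  rw [h1, Pi.add_apply, h2, Pi.smul_apply, h3, h4, smul_eq_mul, mul_one,
    floquetFun_apply α g (Ioc_subset_Icc_self hy)]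

theorem injective_floquetFun (α : ℂ) : Function.Injective (floquetFun α) := by
  refine (injective_iff_map_eq_zero _).2 fun g hg => eq_zero_of_valueOp_eq_zero (α := α) ?_
  rw [Lp.eq_zero_iff_ae_eq_zero]
  filter_upwards [valueOp_ae α g] with y hy
  rw [hy, hg]

/-- The parameter is `g = h - α u(0)`; the boundary condition makes its mean equal to `u(0)`, which
is what the parametrization requires. -/
theorem exists_floquetFun_eq {α : ℂ} {u : ℝ → ℂ} {h : UnitL2}
    (hu : AbsolutelyContinuousOnInterval u 0 1) (h0 : ∀ y, y ∉ Icc (0 : ℝ) 1 → u y = 0)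
    (h1 : u 1 = (α + 2) * u 0) (hd : ∀ᵐ y : ℝ, y ∈ Icc (0 : ℝ) 1 → deriv u y = h y) :
    ∃ g, floquetFun α g = u ∧ slopeOp α g = h := by
  have hftc : ∀ x ∈ Icc (0 : ℝ) 1, u x = u 0 + primitive h x := fun x hx => by
    rw [primitive_eq_integral h hx]
    refine hu.eq_add_integral (intervalIntegrable_unitL2 h) ?_ hx
    filter_upwards [hd, ae_differentiableAt_of_ac hu] with y h1 h2 hy
    rw [← h1 hy]
    exact (h2 hy).hasDerivAt
  have hmean : ⟪unitOne, h - (α * u 0) • unitOne⟫_ℂ = u 0 := by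
    have := hftc 1 (right_mem_Icc.2 zero_le_one)
    rw [inner_sub_right, inner_smul_right, inner_unitOne_self, inner_unitOne]
    linear_combination h1 - this
  have hslope : slopeOp α (h - (α * u 0) • unitOne) = h := by
    rw [slopeOp_apply, hmean, sub_add_cancel]
  refine ⟨h - (α * u 0) • unitOne, ?_, hslope⟩
  funext x
  by_cases hx : x ∈ Icc (0 : ℝ) 1
  · rw [floquetFun_apply α _ hx, hmean, hslope, hftc x hx]
  · rw [h0 x hx]
    exact floquetFun_of_notMem α _ hx

variable {α : ℂ} {μ₁ μ₂ ρ : ℝ → ℝ}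

theorem re_inner_formOp_slopeOp (m₁ : MemLp (fun y => (μ₁ y : ℂ)) ⊤ unitMeasure) (g : UnitL2) :
    (⟪formOp (slopeOp α) μ₁ m₁ g, g⟫_ℂ).re
      = ∫ y in (0 : ℝ)..1, μ₁ y * ‖deriv (floquetFun α g) y‖ ^ 2 := by
  rw [inner_formOp, re_inner_mulOp, intervalIntegral.integral_of_le zero_le_one]
  refine integral_congr_ae ?_
  filter_upwards [ae_unitMeasure_iff.2 (ae_hasDerivAt_floquetFun α g)] with y hy
  rw [hy.deriv]

theorem re_inner_formOp_valueOp (mρ : MemLp (fun y => (ρ y : ℂ)) ⊤ unitMeasure) (g : UnitL2) :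
    (⟪formOp (valueOp α) ρ mρ g, g⟫_ℂ).re
      = ∫ y in (0 : ℝ)..1, ρ y * ‖floquetFun α g y‖ ^ 2 := by
  rw [inner_formOp, re_inner_mulOp, intervalIntegral.integral_of_le zero_le_one]
  refine integral_congr_ae ?_
  filter_upwards [valueOp_ae α g] with y hy
  rw [hy]

theorem smul_mulOp_valueOp_sub_ae (m₂ : MemLp (fun y => (μ₂ y : ℂ)) ⊤ unitMeasure)
    (mρ : MemLp (fun y => (ρ y : ℂ)) ⊤ unitMeasure) (s : ℝ) (lam : ℂ) (g : UnitL2) :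
    ((s : ℂ) • mulOp μ₂ m₂ (valueOp α g) - lam • mulOp ρ mρ (valueOp α g) : UnitL2)
      =ᵐ[unitMeasure] fun y => ((s : ℂ) * μ₂ y - lam * ρ y) * floquetFun α g y := by
  filter_upwards [Lp.coeFn_sub ((s : ℂ) • mulOp μ₂ m₂ (valueOp α g))
      (lam • mulOp ρ mρ (valueOp α g)), Lp.coeFn_smul (s : ℂ) (mulOp μ₂ m₂ (valueOp α g)),
    Lp.coeFn_smul lam (mulOp ρ mρ (valueOp α g)), mulOp_ae m₂ (valueOp α g),
    mulOp_ae mρ (valueOp α g), valueOp_ae α g] with y h1 h2 h3 h4 h5 h6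
  rw [h1, Pi.sub_apply, h2, h3, Pi.smul_apply, Pi.smul_apply, h4, h5, h6, smul_eq_mul,
    smul_eq_mul]
  ring

/-- The weak equation says that the flux `μ₁ u'` is a quasi-periodic primitive of `w = (s μ₂ - lam
ρ) u`. The class of `w` in `L²` is determined by `g`, so the existential quantifier is harmless. -/
theorem mem_pencilEigenspace_formOp_iff {K s : ℝ} {lam : ℂ}
    (hα : α + 2 = Complex.exp (Complex.I * K))
    (m₁ : MemLp (fun y => (μ₁ y : ℂ)) ⊤ unitMeasure)
    (m₂ : MemLp (fun y => (μ₂ y : ℂ)) ⊤ unitMeasure)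
    (mρ : MemLp (fun y => (ρ y : ℂ)) ⊤ unitMeasure) (g : UnitL2) :
    g ∈ pencilEigenspace (formOp (slopeOp α) μ₁ m₁ + (s : ℂ) • formOp (valueOp α) μ₂ m₂)
        (formOp (valueOp α) ρ mρ) lam ↔
      ∃ w : UnitL2, w =ᵐ[unitMeasure]
          (fun y => ((s : ℂ) * μ₂ y - lam * ρ y) * floquetFun α g y) ∧
        ∃ p₀ : ℂ, mulOp μ₁ m₁ (slopeOp α g) = p₀ • unitOne + volterra w ∧
          p₀ + ⟪unitOne, w⟫_ℂ = Complex.exp (Complex.I * K) * p₀ := by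
  set w : UnitL2 := (s : ℂ) • mulOp μ₂ m₂ (valueOp α g) - lam • mulOp ρ mρ (valueOp α g) with hw
  have hwae := smul_mulOp_valueOp_sub_ae (α := α) m₂ mρ s lam g
  rw [← hw] at hwae
  have hunique : ∀ w' : UnitL2, w' =ᵐ[unitMeasure]
      (fun y => ((s : ℂ) * μ₂ y - lam * ρ y) * floquetFun α g y) → w' = w := fun w' h =>
    Lp.ext (h.trans hwae.symm)
  have hiff := adjoint_slopeOp_add_adjoint_valueOp_eq_zero_iff hα (mulOp μ₁ m₁ (slopeOp α g)) w
  have hpen : g ∈ pencilEigenspace (formOp (slopeOp α) μ₁ m₁ + (s : ℂ) • formOp (valueOp α) μ₂ m₂)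
        (formOp (valueOp α) ρ mρ) lam ↔
      ContinuousLinearMap.adjoint (slopeOp α) (mulOp μ₁ m₁ (slopeOp α g))
        + ContinuousLinearMap.adjoint (valueOp α) w = 0 := by
    rw [mem_pencilEigenspace, ← sub_eq_zero, hw, map_sub, map_smul, map_smul, ← add_sub_assoc]
    rfl
  rw [hpen, hiff]
  constructor
  · rintro h
    exact ⟨w, hwae, h⟩
  · rintro ⟨w', hw', h⟩
    rwa [hunique w' hw'] at h

theorem map_pencilEigenspace_formOp {K k : ℝ} {lam : ℂ}
    (hα : α + 2 = Complex.exp (Complex.I * K))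
    (m₁ : MemLp (fun y => (μ₁ y : ℂ)) ⊤ unitMeasure)
    (m₁' : MemLp (fun y => (((μ₁ y)⁻¹ : ℝ) : ℂ)) ⊤ unitMeasure)
    (m₂ : MemLp (fun y => (μ₂ y : ℂ)) ⊤ unitMeasure)
    (mρ : MemLp (fun y => (ρ y : ℂ)) ⊤ unitMeasure)
    (h₁ : ∀ y, 0 < μ₁ y) (h₃ : ∀ y, 0 < ρ y) :
    (pencilEigenspace (formOp (slopeOp α) μ₁ m₁ + ((k ^ 2 : ℝ) : ℂ) • formOp (valueOp α) μ₂ m₂)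
        (formOp (valueOp α) ρ mρ) lam).map (floquetFun α)
      = floquetEigenspace μ₁ μ₂ ρ K k lam := by
  ext u
  rw [Submodule.mem_map]
  constructor
  · rintro ⟨g, hg, rfl⟩
    obtain ⟨w, hw, p₀, hp, hp₁⟩ := (mem_pencilEigenspace_formOp_iff hα m₁ m₂ mρ g).1 hg
    refine ⟨⟨fun x => p₀ + primitive w x, ⟨absolutelyContinuous_floquetFun α g,
      (absolutelyContinuous_primitive w).const_add_complex p₀, ?_⟩, ?_, ?_, ?_⟩, fun y hy =>
      floquetFun_of_notMem α g hy⟩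
    · refine ae_unitMeasure_iff.1 ?_
      filter_upwards [ae_unitMeasure_iff.2 (ae_hasDerivAt_floquetFun α g),
        mulOp_ae m₁ (slopeOp α g), Lp.coeFn_add (p₀ • unitOne) (volterra w),
        Lp.coeFn_smul p₀ unitOne, unitOne_ae, volterra_ae w] with y h1 h2 h3 h4 h5 h6
      rw [h1.deriv, ← h2, hp, h3, Pi.add_apply, h4, Pi.smul_apply, h5, h6, smul_eq_mul, mul_one]
    · rw [floquetFun_one_apply, floquetFun_zero_apply, hα]
    · simp only [primitive_zero, add_zero]
      rw [← inner_unitOne, hp₁]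
    · filter_upwards [ae_hasDerivAt_primitive w, ae_unitMeasure_iff.1 hw] with y h1 h2 hy
      rw [((h1 hy).const_add p₀).deriv, h2 hy]
      have hne : (ρ y : ℂ) ≠ 0 := Complex.ofReal_ne_zero.2 (h₃ y).ne'
      push_cast
      field_simp
      ring
  -- The flux is continuous and `1/μ₁` is bounded, so `u' = p/μ₁` is square integrable and `u` has a
  -- parameter `g`.
  · rintro ⟨⟨p, hflux, hu1, hp1, heq⟩, hu0⟩
    have hpc : ContinuousOn p (Icc 0 1) := by
      have := hflux.ac_flux.continuousOn
      rwa [uIcc_of_le zero_le_one] at this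
    have hpL := memLp_of_continuousOn hpc
    obtain ⟨g, rfl, hg⟩ := exists_floquetFun_eq (α := α) (h := mulOp _ m₁' hpL.toLp) hflux.ac hu0
      (by rw [hu1, hα]) (by
        filter_upwards [hflux.eq, ae_unitMeasure_iff.1 (mulOp_ae m₁' hpL.toLp),
          ae_unitMeasure_iff.1 hpL.coeFn_toLp] with y h1 h2 h3 hy
        rw [h2 hy, h3 hy, h1 hy]
        have hne : (μ₁ y : ℂ) ≠ 0 := Complex.ofReal_ne_zero.2 (h₁ y).ne'
        push_cast
        field_simp)
    refine ⟨g, (mem_pencilEigenspace_formOp_iff hα m₁ m₂ mρ g).2 ?_, rfl⟩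
    have hwae := smul_mulOp_valueOp_sub_ae (α := α) m₂ mρ (k ^ 2) lam g
    set w : UnitL2 := ((k ^ 2 : ℝ) : ℂ) • mulOp μ₂ m₂ (valueOp α g)
      - lam • mulOp ρ mρ (valueOp α g)
    have hftc : ∀ x ∈ Icc (0 : ℝ) 1, p x = p 0 + primitive w x := fun x hx => by
      rw [primitive_eq_integral w hx]
      refine hflux.ac_flux.eq_add_integral (intervalIntegrable_unitL2 w) ?_ hx
      filter_upwards [heq, ae_differentiableAt_of_ac hflux.ac_flux, ae_unitMeasure_iff.1 hwae]
        with y h1 h2 h3 hy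
      have hne : (ρ y : ℂ) ≠ 0 := Complex.ofReal_ne_zero.2 (h₃ y).ne'
      have h4 := h1 hy
      have : w y = deriv p y := by
        rw [h3 hy]
        field_simp at h4
        push_cast
        linear_combination h4
      rw [this]
      exact (h2 hy).hasDerivAt
    refine ⟨w, hwae, p 0, ?_, ?_⟩
    · refine Lp.ext ?_
      rw [hg]
      filter_upwards [mulOp_ae m₁ (mulOp _ m₁' hpL.toLp), mulOp_ae m₁' hpL.toLp, hpL.coeFn_toLp,
        Lp.coeFn_add (p 0 • unitOne) (volterra w),
        Lp.coeFn_smul (p 0) unitOne, unitOne_ae, volterra_ae w,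
        ae_restrict_mem measurableSet_Ioc] with y h1 h2 h3 h4 h5 h6 h7 hy
      have hne : (μ₁ y : ℂ) ≠ 0 := Complex.ofReal_ne_zero.2 (h₁ y).ne'
      rw [h1, h2, h3, h4, Pi.add_apply, h5, Pi.smul_apply, h6, h7, smul_eq_mul, mul_one,
        ← hftc y (Ioc_subset_Icc_self hy)]
      push_cast
      field_simp
    · rw [← hp1, inner_unitOne, hftc 1 (right_mem_Icc.2 zero_le_one)]

theorem finrank_floquetEigenspace {K k : ℝ} {lam : ℂ}
    (hα : α + 2 = Complex.exp (Complex.I * K))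
    (m₁ : MemLp (fun y => (μ₁ y : ℂ)) ⊤ unitMeasure)
    (m₁' : MemLp (fun y => (((μ₁ y)⁻¹ : ℝ) : ℂ)) ⊤ unitMeasure)
    (m₂ : MemLp (fun y => (μ₂ y : ℂ)) ⊤ unitMeasure)
    (mρ : MemLp (fun y => (ρ y : ℂ)) ⊤ unitMeasure)
    (h₁ : ∀ y, 0 < μ₁ y) (h₃ : ∀ y, 0 < ρ y) :
    Module.finrank ℂ (floquetEigenspace μ₁ μ₂ ρ K k lam) = Module.finrank ℂ
      (pencilEigenspace (formOp (slopeOp α) μ₁ m₁ + ((k ^ 2 : ℝ) : ℂ) • formOp (valueOp α) μ₂ m₂)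
        (formOp (valueOp α) ρ mρ) lam) := by
  rw [← map_pencilEigenspace_formOp hα m₁ m₁' m₂ mρ h₁ h₃]
  exact (Submodule.equivMapOfInjective _ (injective_floquetFun α) _).finrank_eq.symm

theorem isFloquetSpectrum_iff {K k : ℝ}
    (hα : α + 2 = Complex.exp (Complex.I * K))
    (m₁ : MemLp (fun y => (μ₁ y : ℂ)) ⊤ unitMeasure)
    (m₁' : MemLp (fun y => (((μ₁ y)⁻¹ : ℝ) : ℂ)) ⊤ unitMeasure)
    (m₂ : MemLp (fun y => (μ₂ y : ℂ)) ⊤ unitMeasure)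
    (mρ : MemLp (fun y => (ρ y : ℂ)) ⊤ unitMeasure)
    (h₁ : ∀ y, 0 < μ₁ y) (h₃ : ∀ y, 0 < ρ y) (ω : ℕ → ℝ) :
    IsFloquetSpectrum μ₁ μ₂ ρ K k ω ↔ IsPencilSpectrum
      (formOp (slopeOp α) μ₁ m₁ + ((k ^ 2 : ℝ) : ℂ) • formOp (valueOp α) μ₂ m₂)
        (formOp (valueOp α) ρ mρ) ω :=
  ⟨fun h => ⟨h.nonneg, h.mono, fun lam => by
    rw [h.multiplicity, finrank_floquetEigenspace hα m₁ m₁' m₂ mρ h₁ h₃]⟩,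
  fun h => ⟨h.nonneg, h.mono, fun lam => by
    rw [h.multiplicity, finrank_floquetEigenspace hα m₁ m₁' m₂ mρ h₁ h₃]⟩⟩

end Representation

/-! ### Piecewise continuous coefficients -/

section PiecewiseContinuous

variable {f g : ℝ → ℝ}

theorem PiecewiseContinuous.mul (hf : PiecewiseContinuous f) (hg : PiecewiseContinuous g) :
    PiecewiseContinuous fun y => f y * g y := by
  refine ⟨fun a b => ((hf.1 a b).union (hg.1 a b)).subset fun y hy => ?_, fun y => ?_⟩
  · by_contra h
    simp only [mem_union, mem_ofPred_eq, not_or, not_and, not_not] at h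
    exact hy.2 ((h.1 hy.1).mul (h.2 hy.1))
  · obtain ⟨⟨l, hl⟩, r, hr⟩ := hf.2 y
    obtain ⟨⟨l', hl'⟩, r', hr'⟩ := hg.2 y
    exact ⟨⟨_, hl.mul hl'⟩, _, hr.mul hr'⟩

theorem PiecewiseContinuous.inv (hf : PiecewiseContinuous f) {c : ℝ} (hc : 0 < c)
    (hcf : ∀ y, c ≤ f y) : PiecewiseContinuous fun y => (f y)⁻¹ := by
  refine ⟨fun a b => (hf.1 a b).subset fun y hy => ⟨hy.1, fun h => hy.2 ?_⟩, fun y => ?_⟩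
  · exact h.inv₀ (hc.trans_le (hcf y)).ne'
  · obtain ⟨⟨l, hl⟩, r, hr⟩ := hf.2 y
    have hl0 : c ≤ l := ge_of_tendsto hl (Eventually.of_forall hcf)
    have hr0 : c ≤ r := ge_of_tendsto hr (Eventually.of_forall hcf)
    exact ⟨⟨_, hl.inv₀ (hc.trans_le hl0).ne'⟩, _, hr.inv₀ (hc.trans_le hr0).ne'⟩

/-- The two one-sided limits and the value at the point bound `f` near each point; compactness makes
the bound global. -/
theorem PiecewiseContinuous.exists_bound (hf : PiecewiseContinuous f) (a b : ℝ) :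
    ∃ C, ∀ y ∈ Icc a b, |f y| ≤ C := by
  refine isCompact_Icc.induction_on (p := fun s => ∃ C, ∀ y ∈ s, |f y| ≤ C) ⟨0, by simp⟩
    (fun s t hst ⟨C, hC⟩ => ⟨C, fun y hy => hC y (hst hy)⟩) (fun s t ⟨C, hC⟩ ⟨C', hC'⟩ =>
      ⟨max C C', fun y hy => hy.elim (fun h => (hC y h).trans (le_max_left _ _))
        fun h => (hC' y h).trans (le_max_right _ _)⟩) fun y _ => ?_
  obtain ⟨⟨l, hl⟩, r, hr⟩ := hf.2 y
  refine ⟨{z | |f z| ≤ max (|f y|) (max (|l| + 1) (|r| + 1))}, mem_nhdsWithin_of_mem_nhds ?_,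
    ⟨_, fun z hz => hz⟩⟩
  rw [← nhdsNE_sup_pure, ← nhdsLT_sup_nhdsGT]
  refine ⟨⟨?_, ?_⟩, ?_⟩
  · filter_upwards [hl.abs.eventually_lt_const (lt_add_one |l|)] with z hz
    exact hz.le.trans ((le_max_left _ _).trans (le_max_right _ _))
  · filter_upwards [hr.abs.eventually_lt_const (lt_add_one |r|)] with z hz
    exact hz.le.trans ((le_max_right _ _).trans (le_max_right _ _))
  · exact le_max_left (|f y|) _

theorem PiecewiseContinuous.ae_continuousAt (hf : PiecewiseContinuous f) :
    ∀ᵐ y : ℝ, y ∈ Icc (0 : ℝ) 1 → ContinuousAt f y := by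
  filter_upwards [compl_mem_ae_iff.2 ((hf.1 0 1).measure_zero volume)] with y hy h
  by_contra hc
  exact hy ⟨h, hc⟩

theorem PiecewiseContinuous.memLp (hf : PiecewiseContinuous f) :
    MemLp (fun y => (f y : ℂ)) ⊤ unitMeasure := by
  obtain ⟨C, hC⟩ := hf.exists_bound 0 1
  have hm : AEStronglyMeasurable f unitMeasure := by
    have hcont : ContinuousOn f (Ioc 0 1 \ {y | y ∈ Icc (0 : ℝ) 1 ∧ ¬ ContinuousAt f y}) := by
      intro y hy
      have : ContinuousAt f y := by
        by_contra h
        exact hy.2 ⟨Ioc_subset_Icc_self hy.1, h⟩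
      exact this.continuousWithinAt
    have hfin := hf.1 0 1
    have := hcont.aestronglyMeasurable (μ := volume) (measurableSet_Ioc.diff hfin.measurableSet)
    rwa [Measure.restrict_congr_set (sdiff_null_ae_eq_self (hfin.measure_zero volume))] at this
  refine memLp_top_of_bound (Complex.continuous_ofReal.comp_aestronglyMeasurable hm) C ?_
  refine ae_unitMeasure_iff.2 (Eventually.of_forall fun y hy => ?_)
  rw [Complex.norm_real]
  exact hC y hy

/-- A piecewise continuous function has a least one-sided limit. -/
theorem PiecewiseContinuous.exists_isLeast_oneSidedLimits (hf : PiecewiseContinuous f) :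
    ∃ m, IsLeast (oneSidedLimits f) m := by
  choose L hL using fun y => (hf.2 y).1
  choose R hR using fun y => (hf.2 y).2
  -- A lower bound of `f` on one side of `y` passes to both one-sided limits at nearby points of
  -- that side. Hence the smaller of the two limits is lower semicontinuous and attains its minimum
  -- on `[0,1]`.
  have hopen : ∀ (c : ℝ) (s : Set ℝ) (y : ℝ), IsOpen s → (∀ᶠ x in 𝓝[s] y, c ≤ f x) →
      ∀ᶠ z in 𝓝[s] y, c ≤ min (L z) (R z) := by
    intro c s y hs h
    filter_upwards [eventually_eventually_nhdsWithin.2 h, self_mem_nhdsWithin] with z hz hzs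
    rw [hs.nhdsWithin_eq hzs] at hz
    exact le_min (ge_of_tendsto (hL z) (hz.filter_mono nhdsWithin_le_nhds))
      (ge_of_tendsto (hR z) (hz.filter_mono nhdsWithin_le_nhds))
  have hlsc : LowerSemicontinuousOn (fun y => min (L y) (R y)) (Icc 0 1) := by
    intro y _ c hc
    obtain ⟨c', hc', hc'y⟩ := exists_between hc
    refine Eventually.filter_mono nhdsWithin_le_nhds ?_
    rw [← nhdsNE_sup_pure, ← nhdsLT_sup_nhdsGT]
    refine eventually_sup.2 ⟨eventually_sup.2 ⟨?_, ?_⟩, eventually_pure.2 hc⟩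
    · filter_upwards [hopen c' (Iio y) y isOpen_Iio
        ((hL y).eventually_const_le (hc'y.trans_le (min_le_left _ _)))] with z hz
      exact hc'.trans_le hz
    · filter_upwards [hopen c' (Ioi y) y isOpen_Ioi
        ((hR y).eventually_const_le (hc'y.trans_le (min_le_right _ _)))] with z hz
      exact hc'.trans_le hz
  obtain ⟨y, hy, hmin⟩ := hlsc.exists_isMinOn (nonempty_Icc.2 zero_le_one) isCompact_Icc
  refine ⟨min (L y) (R y), ⟨y, hy, ?_⟩, ?_⟩
  · rcases min_choice (L y) (R y) with h | h <;> rw [h]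
    exacts [Or.inl (hL y), Or.inr (hR y)]
  · rintro l ⟨z, hz, h | h⟩
    · rw [tendsto_nhds_unique h (hL z)]
      exact (hmin hz).trans (min_le_left _ _)
    · rw [tendsto_nhds_unique h (hR z)]
      exact (hmin hz).trans (min_le_right _ _)

theorem PiecewiseContinuous.ae_le_of_isLeast (hf : PiecewiseContinuous f) {m : ℝ}
    (hm : IsLeast (oneSidedLimits f) m) : ∀ᵐ y : ℝ, y ∈ Icc (0 : ℝ) 1 → m ≤ f y := by
  filter_upwards [hf.ae_continuousAt] with y hy h
  exact hm.2 ⟨y, h, Or.inl ((hy h).tendsto.mono_left nhdsWithin_le_nhds)⟩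

/-- Near a point where a one-sided limit is attained, a periodic function is close to it. -/
theorem exists_Ioo_forall_lt_of_mem_oneSidedLimits (hf : Function.Periodic f 1) {m x : ℝ}
    (hm : m ∈ oneSidedLimits f) (hx : m < x) :
    ∃ a b : ℝ, 0 ≤ a ∧ a < b ∧ b ≤ 1 ∧ ∀ y ∈ Ioo a b, f y < x := by
  obtain ⟨y, hy, h | h⟩ := hm
  · obtain ⟨c, hc, hcy⟩ := mem_nhdsLT_iff_exists_Ioo_subset.1 (h.eventually_lt_const hx)
    -- A left neighbourhood of `0` lies outside the unit interval and is shifted by one period; a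
    -- right neighbourhood of `1` is treated likewise below.
    rcases hy.1.eq_or_lt with rfl | hy0
    · refine ⟨max 0 (c + 1), 1, le_max_left _ _, max_lt one_pos ?_, le_rfl, fun z hz => ?_⟩
      · linarith [mem_Iio.1 hc]
      · rw [← hf.sub_eq]
        exact hcy ⟨by linarith [(le_max_right 0 (c + 1)).trans_lt hz.1], by linarith [hz.2]⟩
    · exact ⟨max 0 c, y, le_max_left _ _, max_lt hy0 hc, hy.2, fun z hz =>
        hcy ⟨(le_max_right _ _).trans_lt hz.1, hz.2⟩⟩
  · obtain ⟨c, hc, hcy⟩ := mem_nhdsGT_iff_exists_Ioo_subset.1 (h.eventually_lt_const hx)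
    rcases hy.2.eq_or_lt with rfl | hy1
    · refine ⟨0, min 1 (c - 1), le_rfl, lt_min one_pos ?_, min_le_left _ _, fun z hz => ?_⟩
      · linarith [mem_Ioi.1 hc]
      · rw [← hf z]
        exact hcy ⟨by linarith [hz.1], by linarith [hz.2.trans_le (min_le_right 1 (c - 1))]⟩
    · exact ⟨y, min 1 c, hy.1, lt_min hy1 hc, min_le_left _ _, fun z hz =>
        hcy ⟨hz.1, hz.2.trans_le (min_le_right _ _)⟩⟩

/-- A property that is periodic and holds almost everywhere on a period holds almost everywhere. -/
theorem ae_of_ae_Icc_of_periodic {p : ℝ → Prop} (hp : Function.Periodic p 1)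
    (h : ∀ᵐ y : ℝ, y ∈ Icc (0 : ℝ) 1 → p y) : ∀ᵐ y : ℝ, p y := by
  have h' : ∀ᵐ y : ℝ, ∀ n : ℤ, y + n ∈ Icc (0 : ℝ) 1 → p (y + n) := by
    refine ae_all_iff.2 fun n => ?_
    exact (quasiMeasurePreserving_add_right volume (n : ℝ)).ae h
  filter_upwards [h'] with y hy
  have h1 := hy (-⌊y⌋) (by
    push_cast
    rw [← sub_eq_add_neg]
    exact ⟨by linarith [Int.floor_le y], by linarith [Int.lt_floor_add_one y]⟩)
  have h2 := hp.int_mul (-⌊y⌋) y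
  rw [mul_one] at h2
  rwa [h2] at h1

end PiecewiseContinuous

/-! ### Test functions supported in a short interval -/

section LocalizedSubspace

theorem inner_indicatorIoc_indicatorIoc_of_le {a b c d : ℝ} (h : b ≤ c) :
    ⟪indicatorIoc a b, indicatorIoc c d⟫_ℂ = 0 := by
  rw [indicatorIoc, indicatorIoc, L2.inner_indicatorConstLp_indicatorConstLp,
    Ioc_inter_Ioc, Ioc_eq_empty_of_le]
  · simp
  · exact (min_le_left _ _).trans (h.trans (le_max_right _ _))

theorem inner_indicatorIoc_indicatorIoc_of_le' {a b c d : ℝ} (h : d ≤ a) :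
    ⟪indicatorIoc a b, indicatorIoc c d⟫_ℂ = 0 := by
  rw [← inner_conj_symm, inner_indicatorIoc_indicatorIoc_of_le h, map_zero]

theorem indicatorIoc_ne_zero {a b : ℝ} (ha : 0 ≤ a) (hab : a < b) (hb : b ≤ 1) :
    indicatorIoc a b ≠ 0 := by
  intro h
  have h1 : ⟪indicatorIoc a b, indicatorIoc a b⟫_ℂ = 0 := by rw [h, inner_zero_left]
  rw [indicatorIoc, L2.inner_indicatorConstLp_indicatorConstLp, inter_self, measureReal_def,
    Measure.restrict_apply measurableSet_Ioc, inter_eq_left.2 (Ioc_subset_Ioc ha hb),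
    Real.volume_Ioc, ENNReal.toReal_ofReal (sub_nonneg.2 hab.le)] at h1
  simp [sub_eq_zero, hab.ne'] at h1

/-- There are many square integrable functions of mean zero whose primitives vanish outside a
given interval. -/
theorem exists_submodule_primitive_eq_zero {a b : ℝ} (ha : 0 ≤ a) (hab : a < b) (hb : b ≤ 1)
    (n : ℕ) : ∃ W : Submodule ℂ UnitL2, FiniteDimensional ℂ W ∧ n < Module.finrank ℂ W ∧
      ∀ g ∈ W, ⟪unitOne, g⟫_ℂ = 0 ∧ ∀ x ∈ Icc (0 : ℝ) 1, x ∉ Ioo a b → primitive g x = 0 := by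
  -- With `n + 2` cells, the mean zero condition costs at most one dimension and leaves at least `n
  -- + 1`.
  set δ : ℝ := (b - a) / (n + 2) with hδ
  have hδ0 : 0 < δ := div_pos (sub_pos.2 hab) (by positivity)
  have hδn : (n + 2) * δ = b - a := by rw [hδ]; field_simp
  set e : Fin (n + 2) → UnitL2 := fun i => indicatorIoc (a + i * δ) (a + (i + 1) * δ) with he
  have hle : ∀ i : Fin (n + 2), a + ((i : ℝ) + 1) * δ ≤ b := fun i => by
    have h1 : ((i : ℕ) : ℝ) + 1 ≤ n + 2 := by exact_mod_cast i.2
    have := mul_le_mul_of_nonneg_right h1 hδ0.le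
    linarith
  have hge : ∀ i : Fin (n + 2), a ≤ a + (i : ℝ) * δ := fun i => by
    have : 0 ≤ (i : ℝ) * δ := by positivity
    linarith
  have hind : LinearIndependent ℂ e := by
    refine linearIndependent_of_ne_zero_of_inner_eq_zero (fun i => ?_) fun i j hij => ?_
    · exact indicatorIoc_ne_zero (ha.trans (hge i)) (by linarith) ((hle i).trans hb)
    · rcases lt_or_gt_of_ne hij with h | h
      · refine inner_indicatorIoc_indicatorIoc_of_le ?_
        have h1 : ((i : ℕ) : ℝ) + 1 ≤ (j : ℕ) := by exact_mod_cast h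
        have := mul_le_mul_of_nonneg_right h1 hδ0.le
        linarith
      · refine inner_indicatorIoc_indicatorIoc_of_le' ?_
        have h1 : ((j : ℕ) : ℝ) + 1 ≤ (i : ℕ) := by exact_mod_cast h
        have := mul_le_mul_of_nonneg_right h1 hδ0.le
        linarith
  set U : Submodule ℂ UnitL2 := Submodule.span ℂ (range e) with hU
  have hUfin : Module.finrank ℂ U = n + 2 := by
    rw [hU, finrank_span_eq_card hind, Fintype.card_fin]
  have hUfd : FiniteDimensional ℂ U := FiniteDimensional.span_of_finite ℂ (finite_range e)
  have hUker : ∀ v : UnitL2, (∀ i, ⟪v, e i⟫_ℂ = 0) → ∀ g ∈ U, ⟪v, g⟫_ℂ = 0 := by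
    intro v hv g hg
    have : U ≤ LinearMap.ker (innerSL ℂ v : UnitL2 →ₗ[ℂ] ℂ) := by
      rw [hU, Submodule.span_le]
      rintro _ ⟨i, rfl⟩
      exact hv i
    exact this hg
  set φ : U →ₗ[ℂ] ℂ := (innerSL ℂ unitOne : UnitL2 →ₗ[ℂ] ℂ).domRestrict U with hφ
  have hrank := LinearMap.finrank_range_add_finrank_ker φ
  have hrange : Module.finrank ℂ (LinearMap.range φ) ≤ 1 :=
    (Submodule.finrank_le _).trans (Module.finrank_self ℂ).le
  refine ⟨(LinearMap.ker φ).map U.subtype, inferInstance, ?_, ?_⟩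
  · rw [Submodule.finrank_map_subtype_eq]
    omega
  · rintro _ ⟨g, hg, rfl⟩
    have hg0 : ⟪unitOne, (g : UnitL2)⟫_ℂ = 0 := hg
    refine ⟨hg0, fun x hx hxab => ?_⟩
    rw [mem_Ioo, not_and_or, not_lt, not_lt] at hxab
    rcases hxab with h | h
    · exact hUker _ (fun i => inner_indicatorIoc_indicatorIoc_of_le (h.trans (hge i))) g g.2
    · have h1 := primitive_sub_primitive (g : UnitL2) hx.1 hx.2 le_rfl
      rw [hUker _ (fun i => inner_indicatorIoc_indicatorIoc_of_le' ((hle i).trans h)) g g.2,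
        ← inner_unitOne, hg0, zero_sub, neg_eq_zero] at h1
      exact h1

end LocalizedSubspace

/-! ### Comparison of the forms and the degenerate case -/

section FloquetForms

variable {α : ℂ} {μ₁ μ₂ ρ : ℝ → ℝ}

/-- A factor on each side lets the lower bound by `m` and the upper bound by `m + ε` both be
instances, with the two coefficients exchanged. -/
theorem mul_re_inner_formOp_valueOp_le (m₂ : MemLp (fun y => (μ₂ y : ℂ)) ⊤ unitMeasure)
    (mρ : MemLp (fun y => (ρ y : ℂ)) ⊤ unitMeasure) {a b : ℝ} {g : UnitL2}
    (h : ∀ᵐ y : ℝ, y ∈ Icc (0 : ℝ) 1 →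
      a * (μ₂ y * ‖floquetFun α g y‖ ^ 2) ≤ b * (ρ y * ‖floquetFun α g y‖ ^ 2)) :
    a * (⟪formOp (valueOp α) μ₂ m₂ g, g⟫_ℂ).re ≤ b * (⟪formOp (valueOp α) ρ mρ g, g⟫_ℂ).re := by
  rw [inner_formOp, inner_formOp, re_inner_mulOp, re_inner_mulOp, ← integral_const_mul,
    ← integral_const_mul]
  refine integral_mono_ae ((integrable_mul_norm_sq m₂ _).const_mul a)
    ((integrable_mul_norm_sq mρ _).const_mul b) ?_
  filter_upwards [ae_unitMeasure_iff.2 h, valueOp_ae α g] with y h1 h2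
  rwa [h2]

theorem formOp_eq_smul (T : UnitL2 →L[ℂ] UnitL2)
    (m₂ : MemLp (fun y => (μ₂ y : ℂ)) ⊤ unitMeasure)
    (mρ : MemLp (fun y => (ρ y : ℂ)) ⊤ unitMeasure) {c : ℝ}
    (h : ∀ᵐ y : ℝ, μ₂ y = c * ρ y) : formOp T μ₂ m₂ = (c : ℂ) • formOp T ρ mρ := by
  have hmul : mulOp μ₂ m₂ = (c : ℂ) • mulOp ρ mρ := by
    ext1 g
    refine Lp.ext ?_
    filter_upwards [mulOp_ae m₂ g, mulOp_ae mρ g, Lp.coeFn_smul (c : ℂ) (mulOp ρ mρ g),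
      ae_unitMeasure_iff.2 (h.mono fun y hy _ => hy)] with y h1 h2 h3 h4
    rw [smul_apply, h1, h3, Pi.smul_apply, h2, h4, smul_eq_mul]
    push_cast
    ring
  rw [formOp, formOp, hmul, ContinuousLinearMap.smul_comp, ContinuousLinearMap.comp_smul]

/-- An eigenfunction with vanishing derivative exists only for periodic boundary conditions and
proportional coefficients. -/
theorem exp_eq_one_and_exists_of_re_inner_nonpos {K s r c₁ : ℝ}
    (hα : α + 2 = Complex.exp (Complex.I * K))
    (m₁ : MemLp (fun y => (μ₁ y : ℂ)) ⊤ unitMeasure)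
    (m₂ : MemLp (fun y => (μ₂ y : ℂ)) ⊤ unitMeasure)
    (mρ : MemLp (fun y => (ρ y : ℂ)) ⊤ unitMeasure) (hc₁ : 0 < c₁) (h₁ : ∀ y, c₁ ≤ μ₁ y)
    (hs : 0 < s) {g : UnitL2} (hg0 : g ≠ 0)
    (hg : g ∈ pencilEigenspace (formOp (slopeOp α) μ₁ m₁ + (s : ℂ) • formOp (valueOp α) μ₂ m₂)
        (formOp (valueOp α) ρ mρ) (r : ℂ))
    (hD : (⟪formOp (slopeOp α) μ₁ m₁ g, g⟫_ℂ).re ≤ 0) :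
    Complex.exp (Complex.I * K) = 1 ∧
      ∃ c : ℝ, ∀ᵐ y : ℝ, y ∈ Icc (0 : ℝ) 1 → μ₂ y = c * ρ y := by
  have hslope : slopeOp α g = 0 := by
    by_contra hne
    have h1 : 0 < ‖slopeOp α g‖ := norm_pos_iff.2 hne
    have h2 : 0 < c₁ * ‖slopeOp α g‖ ^ 2 := by positivity
    linarith [le_re_inner_formOp (slopeOp α) m₁ h₁ g]
  have hmean : ⟪unitOne, g⟫_ℂ ≠ 0 := by
    intro h
    have := eq_smul_of_slopeOp_eq_zero hslope
    rw [h, mul_zero, neg_zero, zero_smul] at this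
    exact hg0 this
  refine ⟨?_, r / s, ?_⟩
  · have h1 := inner_unitOne_slopeOp α g
    rw [hslope, inner_zero_right, eq_comm] at h1
    rw [← hα]
    linear_combination (mul_eq_zero.1 h1).resolve_right hmean
  · obtain ⟨w, hw, p₀, hp, -⟩ := (mem_pencilEigenspace_formOp_iff hα m₁ m₂ mρ g).1 hg
    -- The flux is zero, so the primitive of `w` is constant; then `(s μ₂ - r ρ) u(0) = 0` with
    -- `u(0) ≠ 0`.
    have hw0 : w = 0 := by
      refine volterra_eq_smul_unitOne (c := -p₀) ?_
      rw [hslope, map_zero] at hp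
      rw [neg_smul]
      exact eq_neg_of_add_eq_zero_right hp.symm
    filter_upwards [ae_unitMeasure_iff.1 hw,
      ae_unitMeasure_iff.1 ((Lp.eq_zero_iff_ae_eq_zero).1 hw0)] with y h1 h2 hy
    have h3 := (h1 hy).symm.trans (h2 hy)
    rw [floquetFun_apply α g hy, hslope, primitive, inner_zero_right, add_zero, Pi.zero_apply,
      mul_eq_zero] at h3
    have h4 := h3.resolve_right hmean
    have h5 : s * μ₂ y - r * ρ y = 0 := by exact_mod_cast h4
    field_simp
    linarith

end FloquetForms

/-! ### Assembly of the three statements -/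

theorem mainTheorem10 (μ₁ μ₂ ρ : ℝ → ℝ)
    (hμ₁ : IsCoefficient μ₁) (hμ₂ : IsCoefficient μ₂) (hρ : IsCoefficient ρ) :
    ∃ m : ℝ, IsLeast (oneSidedLimits fun y => μ₂ y / ρ y) m ∧
      ∀ K : ℝ,
        (∀ k : ℝ, ∃! ω : ℕ → ℝ, IsFloquetSpectrum μ₁ μ₂ ρ K k ω) ∧
        ∀ ω : ℝ → ℕ → ℝ, (∀ k : ℝ, IsFloquetSpectrum μ₁ μ₂ ρ K k (ω k)) → ∀ n : ℕ,
          Tendsto (fun k : ℝ => ω k n ^ 2 / k ^ 2) atTop (𝓝 m) ∧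
          (∀ k : ℝ, 0 < k →
            Module.finrank ℂ (floquetEigenspace μ₁ μ₂ ρ K k ((ω k n : ℂ) ^ 2)) = 1 →
            ∀ u ∈ floquetEigenspace μ₁ μ₂ ρ K k ((ω k n : ℂ) ^ 2), u ≠ 0 →
              HasDerivAt (fun s : ℝ => ω (Real.sqrt s) n ^ 2 / s)
                (-(1 / k ^ 4) * ((∫ y in (0 : ℝ)..1, μ₁ y * ‖deriv u y‖ ^ 2) /
                  ∫ y in (0 : ℝ)..1, ρ y * ‖u y‖ ^ 2)) (k ^ 2)) ∧
          (¬ (n = 0 ∧ (∃ j : ℤ, K = 2 * Real.pi * j) ∧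
              ∃ c : ℝ, ∀ᵐ y : ℝ, μ₂ y = c * ρ y) →
            StrictAntiOn (fun s : ℝ => ω (Real.sqrt s) n ^ 2 / s) (Ioi 0) ∧
            ∀ k : ℝ, 0 < k → ∀ u ∈ floquetEigenspace μ₁ μ₂ ρ K k ((ω k n : ℂ) ^ 2), u ≠ 0 →
              -(1 / k ^ 4) * ((∫ y in (0 : ℝ)..1, μ₁ y * ‖deriv u y‖ ^ 2) /
                ∫ y in (0 : ℝ)..1, ρ y * ‖u y‖ ^ 2) < 0) := by
  obtain ⟨c₁, hc₁, h₁⟩ := hμ₁.pos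
  obtain ⟨c₂, hc₂, h₂⟩ := hμ₂.pos
  obtain ⟨c₃, hc₃, h₃⟩ := hρ.pos
  have h₁' : ∀ y, 0 < μ₁ y := fun y => hc₁.trans_le (h₁ y)
  have h₃' : ∀ y, 0 < ρ y := fun y => hc₃.trans_le (h₃ y)
  have m₁ := hμ₁.piecewiseContinuous.memLp
  have m₁' := (hμ₁.piecewiseContinuous.inv hc₁ h₁).memLp
  have m₂ := hμ₂.piecewiseContinuous.memLp
  have mρ := hρ.piecewiseContinuous.memLp
  have hq : PiecewiseContinuous fun y => μ₂ y / ρ y := by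
    simp only [div_eq_mul_inv]
    exact hμ₂.piecewiseContinuous.mul (hρ.piecewiseContinuous.inv hc₃ h₃)
  have hqper : Function.Periodic (fun y => μ₂ y / ρ y) 1 := hμ₂.periodic.div hρ.periodic
  obtain ⟨m, hm⟩ := hq.exists_isLeast_oneSidedLimits
  refine ⟨m, hm, fun K => ?_⟩
  obtain ⟨α, hα⟩ : ∃ α : ℂ, α + 2 = Complex.exp (Complex.I * K) := ⟨_, sub_add_cancel _ _⟩
  have hfam := isPencilFamily_formOp α m₁ m₂ mρ hc₁ hc₃ h₁ (fun y => hc₂.le.trans (h₂ y)) h₃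
  have hiff := fun (k : ℝ) (ω : ℕ → ℝ) =>
    isFloquetSpectrum_iff (k := k) hα m₁ m₁' m₂ mρ h₁' h₃' ω
  have hmap := fun (k : ℝ) (lam : ℂ) =>
    map_pencilEigenspace_formOp (k := k) (lam := lam) hα m₁ m₁' m₂ mρ h₁' h₃'
  have hfinrank := fun (k : ℝ) (lam : ℂ) =>
    finrank_floquetEigenspace (k := k) (lam := lam) hα m₁ m₁' m₂ mρ h₁' h₃'
  have hker := finrank_ker_formOp_slopeOp_le α m₁ hc₁ h₁
  have hDint := fun g => re_inner_formOp_slopeOp (α := α) m₁ g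
  have hBint := fun g => re_inner_formOp_valueOp (α := α) mρ g
  have hdeg := fun (s r : ℝ) (hs : 0 < s) (g : UnitL2) (hg0 : g ≠ 0) =>
    exp_eq_one_and_exists_of_re_inner_nonpos (r := r) hα m₁ m₂ mρ hc₁ h₁ hs hg0
  have hprop : ∀ c : ℝ, (∀ᵐ y : ℝ, μ₂ y = c * ρ y) →
      formOp (valueOp α) μ₂ m₂ = (c : ℂ) • formOp (valueOp α) ρ mρ := fun c hc =>
    formOp_eq_smul _ m₂ mρ hc
  have hlow : ∀ g, m * (⟪formOp (valueOp α) ρ mρ g, g⟫_ℂ).re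
      ≤ (⟪formOp (valueOp α) μ₂ m₂ g, g⟫_ℂ).re := by
    intro g
    rw [← one_mul (⟪formOp (valueOp α) μ₂ m₂ g, g⟫_ℂ).re]
    refine mul_re_inner_formOp_valueOp_le mρ m₂ ?_
    filter_upwards [hq.ae_le_of_isLeast hm] with y hy h
    rw [one_mul, ← mul_assoc]
    exact mul_le_mul_of_nonneg_right ((le_div_iff₀ (h₃' y)).1 (hy h)) (sq_nonneg _)
  have hup : ∀ (n : ℕ) (ε : ℝ), 0 < ε → ∃ W : Submodule ℂ UnitL2, FiniteDimensional ℂ W ∧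
      n < Module.finrank ℂ W ∧ ∀ g ∈ W, (⟪formOp (valueOp α) μ₂ m₂ g, g⟫_ℂ).re
        ≤ (m + ε) * (⟪formOp (valueOp α) ρ mρ g, g⟫_ℂ).re := by
    intro n ε hε
    obtain ⟨a, b, ha, hab, hb, hlt⟩ :=
      exists_Ioo_forall_lt_of_mem_oneSidedLimits hqper hm.1 (lt_add_of_pos_right m hε)
    obtain ⟨W, hWfd, hWn, hW⟩ := exists_submodule_primitive_eq_zero ha hab hb n
    refine ⟨W, hWfd, hWn, fun g hg => ?_⟩
    rw [← one_mul (⟪formOp (valueOp α) μ₂ m₂ g, g⟫_ℂ).re]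
    refine mul_re_inner_formOp_valueOp_le m₂ mρ (Eventually.of_forall fun y hy => ?_)
    obtain ⟨hg0, hgx⟩ := hW g hg
    by_cases hyab : y ∈ Ioo a b
    · rw [one_mul, ← mul_assoc]
      exact mul_le_mul_of_nonneg_right ((div_lt_iff₀ (h₃' y)).1 (hlt y hyab)).le (sq_nonneg _)
    · have : floquetFun α g y = 0 := by
        rw [floquetFun_apply α g hy, slopeOp_apply, hg0, mul_zero, zero_smul, add_zero,
          hgx y hy hyab, add_zero]
      simp [this]
  have hDnonneg := hfam.nonneg_D
  -- From here on only the collected facts about the three operators matter.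
  generalize formOp (slopeOp α) μ₁ m₁ = D at *
  generalize formOp (valueOp α) μ₂ m₂ = Q at *
  generalize formOp (valueOp α) ρ mρ = B at *
  have hparam : ∀ (k r : ℝ) (u : ℝ → ℂ), u ∈ floquetEigenspace μ₁ μ₂ ρ K k ((r : ℂ) ^ 2) → u ≠ 0 →
      ∃ g : UnitL2, floquetFun α g = u ∧ g ≠ 0 ∧
        g ∈ pencilEigenspace (D + ((k ^ 2 : ℝ) : ℂ) • Q) B ((r ^ 2 : ℝ) : ℂ) := by
    intro k r u hu hu0
    rw [← Complex.ofReal_pow, ← hmap, Submodule.mem_map] at hu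
    obtain ⟨g, hg, rfl⟩ := hu
    exact ⟨g, rfl, fun h => hu0 (by rw [h, map_zero]), hg⟩
  refine ⟨fun k => ?_, fun ω hω n => ?_⟩
  · have hp := hfam.isCompactPencil (sq_nonneg k)
    obtain ⟨ω, hω⟩ := hp.exists_spectrum fun n => by
      obtain ⟨W, h1, h2, -⟩ := hup n 1 one_pos
      exact ⟨W, h1, h2⟩
    exact ⟨ω, (hiff k ω).2 hω, fun ω' hω' => ((hiff k ω').1 hω').unique hp hω⟩
  have hΩ : ∀ s : ℝ, 0 < s → IsPencilSpectrum (D + (s : ℂ) • Q) B (ω (Real.sqrt s)) := by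
    intro s hs
    have := (hiff (Real.sqrt s) _).1 (hω (Real.sqrt s))
    rwa [Real.sq_sqrt hs.le] at this
  refine ⟨?_, fun k hk hsimple u hu hu0 => ?_, fun hexc => ?_⟩
  · have h1 := (hfam.tendsto_sq_div hΩ n hlow (hup n)).comp
      (tendsto_pow_atTop (α := ℝ) two_ne_zero)
    refine h1.congr' ?_
    filter_upwards [eventually_ge_atTop (0 : ℝ)] with k hk
    simp only [Function.comp_apply, Real.sqrt_sq hk]
  · obtain ⟨g, rfl, hg0, hg⟩ := hparam k _ u hu hu0
    rw [← hDint, ← hBint]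
    have hk2 : 0 < k ^ 2 := by positivity
    have hsq := Real.sqrt_sq hk.le
    have heig := mem_pencilEigenspace.1 hg
    rw [hfinrank, ← Complex.ofReal_pow] at hsimple
    have hder := hfam.hasDerivAt_sq hΩ n hk2 (by rwa [hsq]) hg0 (by rwa [hsq])
    -- With `d`, `q`, `b` the values of the forms at `g` and `s = k²`, the quotient rule gives `(s
    -- q/b - ω²)/s²`; the Rayleigh identity `d + s q = ω² b` turns this into `-d/(s² b)`.
    have hquot := hder.div (hasDerivAt_id (k ^ 2)) hk2.ne'
    have hB := hfam.pos_B g hg0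
    have hform : (⟪D g, g⟫_ℂ).re + k ^ 2 * (⟪Q g, g⟫_ℂ).re
        = ω k n ^ 2 * (⟪B g, g⟫_ℂ).re := by
      rw [← re_inner_add_smul, heig, inner_smul_left, Complex.conj_ofReal, Complex.re_ofReal_mul]
    refine hquot.congr_deriv ?_
    simp only [id, hsq]
    field_simp
    linear_combination hform
  · have hpos : ∀ s : ℝ, 0 < s → ∀ g, g ≠ 0 →
        (D + (s : ℂ) • Q) g = ((ω (Real.sqrt s) n ^ 2 : ℝ) : ℂ) • B g → 0 < (⟪D g, g⟫_ℂ).re := by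
      intro s hs g hg0 hg
      by_contra hneg
      have hD0 : (⟪D g, g⟫_ℂ).re = 0 := le_antisymm (not_lt.1 hneg) (hDnonneg g)
      obtain ⟨hK, c, hc⟩ := hdeg s _ hs g hg0 (mem_pencilEigenspace.2 hg) hD0.le
      -- The exceptional case is stated on the whole line, so proportionality on one period is
      -- extended by periodicity.
      have hc' : ∀ᵐ y : ℝ, μ₂ y = c * ρ y := by
        refine ae_of_ae_Icc_of_periodic (fun y => ?_) hc
        rw [hμ₂.periodic y, hρ.periodic y]
      refine hexc ⟨hfam.eq_zero_of_re_inner_eq_zero hs.le (hΩ s hs) (hprop c hc') hker hg0 hg hD0,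
        ?_, c, hc'⟩
      obtain ⟨j, hj⟩ := Complex.exp_eq_one_iff.1 hK
      refine ⟨j, ?_⟩
      have : (K : ℂ) = ((2 * Real.pi * j : ℝ) : ℂ) := by
        push_cast
        refine mul_left_cancel₀ Complex.I_ne_zero ?_
        rw [hj]
        ring
      exact_mod_cast this
    refine ⟨fun s hs t _ hst => hfam.sq_div_lt hΩ hs hst (hpos s hs), fun k hk u hu hu0 => ?_⟩
    obtain ⟨g, rfl, hg0, hg⟩ := hparam k _ u hu hu0
    rw [← hDint, ← hBint]
    have hD := hpos (k ^ 2) (by positivity) g hg0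
      (by rw [Real.sqrt_sq hk.le]; exact mem_pencilEigenspace.1 hg)
    have hB := hfam.pos_B g hg0
    rw [neg_mul, neg_lt_zero]
    positivity
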